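/- **Setting.** Let $(C,T_1,T_2,\dots)$ be a sequence of real random variables such that $\mathbb P[C\neq 0]>0$ and, almost surely, only finitely many, say $N$, of the $T_k$ are nonzero, ordered so that $T_1\ge T_2\ge\dots\ge T_N$ and $T_k=0$ for $k>N$. Put $\Sigma_\alpha:=\sum_{k=1}^N|T_k|^\alpha$ for $\alpha>0$, and $\beta:=\operatorname{ess\,sup}T_N^-\in[0,\infty]$ (with $T_N^-:=0$ if $N=0$). Let $(C(v),T_1(v),T_2(v),\dots)$, where $v$ ranges over the vertices of the Ulam–Harris tree $\bigcup_{n\ge0}\{1,2,\dots\}^n$, be i.i.d. copies of $(C,T_1,T_2,\dots)$; let $L(\varnothing):=1$, $L(vk):=L(v)T_k(v)$, and $$W_n:=\sum_{j=0}^{n}\ \sum_{|v|=j}L(v)C(v),\qquad W:=\lim_{n\to\infty}W_n .$$ Let $\mathbb D_\varphi:=\{\theta\in\mathbb R:\mathbb E e^{\theta C}<\infty\}$ and $\mathbb D_\Psi:=\{\theta\in\mathbb R:\mathbb E e^{\theta W}<\infty\}$. Consider the conditions * (10) $\ \mathbb EC=0$, $\|C\|_p<\infty$ and $\mathbb E\,\Sigma_p<1$;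 * (12) $\ |T_k|\le1$ for all $k$, almost surely; * (14) $\ \|C\|_2<\infty$ and $\mathbb E e^{\theta\Sigma_2}<\infty$ for some $\theta>0$; and the four cases * (a1) (12) holds, $\beta=0$, and $\mathbb D_\varphi\neq\{0\}$; * (a2) (12) holds, $\beta>0$, and $\mathbb D_\varphi\supseteq(-\varepsilon,\varepsilon)$ for some $\varepsilon>0$; * (a3) $\mathbb P[T_1>1]>0$, $\beta=0$, and $w^*\Sigma_1+C\le w^*$ a.s. for some real $w^*\ge0$; * (a4) $\mathbb P[T_1>1]>0$, $\beta=0$, and $w_*\Sigma_1+C\ge w_*$ a.s. for some real $w_*\le0$. **Theorem.** Suppose that (10) holds for some $p\in[1,2]$. Then $W_n$ converges almost surely, so that $W$ is well defined, and the following hold. (a) If $\mathbb D_\Psi\neq\{0\}$, then exactly one of the cases (a1)–(a4) occurs. Moreover, in cases (a1) and (a2), $\mathbb D_\Psi\supseteq(-\varepsilon,\varepsilon)\cap\mathbb D_\varphi$ for some $\varepsilon>0$, and in case (a2) even $\mathbb D_\Psi\supseteq(-\varepsilon,\varepsilon)$ for some $\varepsilon>0$; in case (a3), $\|C^+\|_\infty\le\|W^+\|_\infty<\infty$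 and $\mathbb D_\Psi=[0,\infty)$; in case (a4), $\|C^-\|_\infty\le\|W^-\|_\infty<\infty$ and $\mathbb D_\Psi=(-\infty,0]$. (b) Conversely, each of (a3) and (a4) implies $\mathbb D_\Psi\neq\{0\}$. If (14) holds, then each of (a1) and (a2) implies $\mathbb D_\Psi\neq\{0\}$ and $\mathbb D_\Psi\supseteq(-\varepsilon,\varepsilon)\cap\mathbb D_\varphi$ for some $\varepsilon>0$. -/

import Mathlib

open MeasureTheory ProbabilityTheory Filter Topology Set
open scoped ENNReal

namespace Smoothing

noncomputable section

/-! Vertices of the Ulam-Harris tree are lists of natural numbers, read from the vertex back to the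
root: `[]` is the root and `k :: v` is the child number `k` of `v`. Weights are indexed from `0`:
`T v k` is the weight `T_{k+1}(v)` of the edge from `v` to its child `k :: v`. -/

/-- Almost surely, for some `N`: the first `N` weights are nonzero and non-increasing, and all
later weights vanish. In particular the number `N` of nonzero weights is almost surely finite. -/
def OrderedWeights {Ω : Type*} [MeasurableSpace Ω] (μ : Measure Ω) (T : ℕ → Ω → ℝ) : Prop :=
  ∀ᵐ ω ∂μ, ∃ N : ℕ, (∀ k < N, T k ω ≠ 0) ∧ (∀ i j, i ≤ j → j < N → T j ω ≤ T i ω) ∧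
    ∀ k, N ≤ k → T k ω = 0

/-- The power sum `Σ_α = ∑_{k ≤ N} |T_k|^α` for `α > 0` (vanishing weights contribute `0`). -/
def powerSum {Ω : Type*} (T : ℕ → Ω → ℝ) (α : ℝ) (ω : Ω) : ℝ :=
  ∑' k, |T k ω| ^ α

/-- `E C = 0`, `‖C‖_p < ∞` and `‖Σ_p‖_1 < 1`. -/
def MomentCondition {Ω : Type*} [MeasurableSpace Ω] (μ : Measure Ω) (C : Ω → ℝ) (T : ℕ → Ω → ℝ)
    (p : ℝ) : Prop :=
  ∫ ω, C ω ∂μ = 0 ∧ MemLp C (ENNReal.ofReal p) μ ∧ eLpNorm (powerSum T p) 1 μ < 1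

/-- `max_k |T_k| ≤ 1` almost surely. -/
def WeightsLeOne {Ω : Type*} [MeasurableSpace Ω] (μ : Measure Ω) (T : ℕ → Ω → ℝ) : Prop :=
  ∀ᵐ ω ∂μ, ∀ k, |T k ω| ≤ 1

/-- `β = ess sup T_N⁻ ∈ [0, ∞]`, where `T_N` is the smallest of the nonzero weights, so that
`T_N⁻ = sup_k T_k⁻` (and this is `0` if there is no nonzero weight). -/
def beta {Ω : Type*} [MeasurableSpace Ω] (μ : Measure Ω) (T : ℕ → Ω → ℝ) : ℝ≥0∞ :=
  essSup (fun ω => ⨆ k, ENNReal.ofReal (-(T k ω))) μ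

/-- First case: weights in `[0, 1]`, and `C` has a nontrivial exponential moment. -/
def CaseA1 {Ω : Type*} [MeasurableSpace Ω] (μ : Measure Ω) (C : Ω → ℝ) (T : ℕ → Ω → ℝ) : Prop :=
  WeightsLeOne μ T ∧ beta μ T = 0 ∧ integrableExpSet C μ ≠ {0}

/-- Second case: weights in `[-1, 1]`, not all nonnegative, and the domain of the moment generating
function of `C` contains a neighbourhood of `0`. -/
def CaseA2 {Ω : Type*} [MeasurableSpace Ω] (μ : Measure Ω) (C : Ω → ℝ) (T : ℕ → Ω → ℝ) : Prop :=
  WeightsLeOne μ T ∧ 0 < beta μ T ∧ ∃ ε > 0, Ioo (-ε) ε ⊆ integrableExpSet C μ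

/-- Third case: `P[T_1 > 1] > 0`, `β = 0`, and `w Σ_1 + C ≤ w` almost surely for some `w ≥ 0`. -/
def CaseA3 {Ω : Type*} [MeasurableSpace Ω] (μ : Measure Ω) (C : Ω → ℝ) (T : ℕ → Ω → ℝ) : Prop :=
  0 < μ {ω | 1 < T 0 ω} ∧ beta μ T = 0 ∧ ∃ w : ℝ, 0 ≤ w ∧ ∀ᵐ ω ∂μ, w * powerSum T 1 ω + C ω ≤ w

/-- Fourth case: `P[T_1 > 1] > 0`, `β = 0`, and `w Σ_1 + C ≥ w` almost surely for some `w ≤ 0`. -/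
def CaseA4 {Ω : Type*} [MeasurableSpace Ω] (μ : Measure Ω) (C : Ω → ℝ) (T : ℕ → Ω → ℝ) : Prop :=
  0 < μ {ω | 1 < T 0 ω} ∧ beta μ T = 0 ∧ ∃ w : ℝ, w ≤ 0 ∧ ∀ᵐ ω ∂μ, w ≤ w * powerSum T 1 ω + C ω

/-- `‖C‖_2 < ∞` and `E exp(θ Σ_2) < ∞` for some `θ > 0`. -/
def ExpCondition {Ω : Type*} [MeasurableSpace Ω] (μ : Measure Ω) (C : Ω → ℝ) (T : ℕ → Ω → ℝ) :
    Prop :=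
  MemLp C 2 μ ∧ ∃ θ > 0, θ ∈ integrableExpSet (powerSum T 2) μ

/-- The random elements `(C(v), T_1(v), T_2(v), …)`, for `v` in the Ulam-Harris tree, are
independent and identically distributed. -/
structure IsIIDTree {Ω : Type*} [MeasurableSpace Ω] (μ : Measure Ω) (C : List ℕ → Ω → ℝ)
    (T : List ℕ → ℕ → Ω → ℝ) : Prop where
  measurable_C : ∀ v, Measurable (C v)
  measurable_T : ∀ v k, Measurable (T v k)
  indep : iIndepFun (fun (v : List ℕ) (ω : Ω) => ((C v ω, fun k => T v k ω) : ℝ × (ℕ → ℝ))) μ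
  ident : ∀ v : List ℕ,
    IdentDistrib (fun ω => ((C v ω, fun k => T v k ω) : ℝ × (ℕ → ℝ)))
      (fun ω => ((C [] ω, fun k => T [] k ω) : ℝ × (ℕ → ℝ))) μ μ

/-- The branch weight `L(v)`: the product of the edge weights from the root to `v`. -/
def branchWeight {Ω : Type*} (T : List ℕ → ℕ → Ω → ℝ) : List ℕ → Ω → ℝ
  | [], _ => 1
  | k :: v, ω => branchWeight T v ω * T v k ω

/-- `∑_{|v| = n} L(v) C(v)`; almost surely only finitely many summands are nonzero. -/
def levelSum {Ω : Type*} (C : List ℕ → Ω → ℝ) (T : List ℕ → ℕ → Ω → ℝ) (n : ℕ) (ω : Ω) : ℝ :=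
  ∑' v : {v : List ℕ // v.length = n}, branchWeight T v ω * C v ω

/-- `W_n = ∑_{k = 0}^{n} ∑_{|v| = k} L(v) C(v)`. -/
def partialW {Ω : Type*} (C : List ℕ → Ω → ℝ) (T : List ℕ → ℕ → Ω → ℝ) (n : ℕ) (ω : Ω) : ℝ :=
  ∑ k ∈ Finset.range (n + 1), levelSum C T k ω

/-- The canonical solution `W = lim_n W_n`. -/
def canonicalW {Ω : Type*} (C : List ℕ → Ω → ℝ) (T : List ℕ → ℕ → Ω → ℝ) (ω : Ω) : ℝ :=
  limUnder atTop (fun n => partialW C T n ω)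

end

end Smoothing

namespace Smoothing

set_option linter.unusedSectionVars false

/-! Let Ψ be the moment generating function of W. The tree recursion W = C + ∑ T_k W_k, with
independent copies W_k of W, gives Ψ(θ) = E[e^{θC} ∏ Ψ(θT_k)]. Moreover Ψ is minimal: any G ≥ 1 with
G(0) = 1 that is a supersolution of this equation dominates Ψ, by induction for W_n and then Fatou.
Existence of W comes from a von Bahr–Esseen type inequality: the L^p norms of the generation sums
decay geometrically. `IsMinimalSolution` isolates these facts; afterwards the tree plays no role.

Necessity. Since E W = 0, Ψ ≥ 1 and Ψ increases along rays from 0, so Ψ(θ) ≥ E[e^{θC} Ψ(θT_k)] for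
each single k. Hence a weight that can be negative carries finiteness of Ψ to the other side of 0.
If |T_k| can exceed some a > 1, this bound controls Ψ(aθ), or after two steps Ψ(a²θ), by Ψ(θ);
iterating it gives Ψ at most exponential growth, so W is bounded on the relevant side
(`bddAbove_of_scaling`). If W were bounded on both sides, comparing essential suprema and infima in
the recursion would force Σ_1 ≤ 1 (`weightsLeOne_of_bounded`). So large weights allow Ψ to be finite
on only one side, exclude negative weights, and make the essential supremum of W (or of -W) an
invariant bound as in (a3) or (a4).

Sufficiency. One exhibits supersolutions, set to ∞ off the region of interest: e^{θw} on a half-line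
for (a3), (a4), and e^{Kθ²} near 0 for (a1), (a2) under (14) (`exists_expMoment_lt_top`).

In part (a) condition (14) is not assumed. In case (a1), if Ψ is finite on one side of 0 and the
generating function of C on the other, the bound Ψ(θ) ≥ e^{mθ²} inserted into the equation yields
(14) (`expCondition_of_expMoment`); otherwise convexity of the domain suffices. -/

/-! ### A von Bahr–Esseen type inequality for 1 ≤ p ≤ 2. -/

/-- For y < -1, |1 + y| ≤ |y| and the linear term is absorbed by 2|y|^p. On [-1, 1], Bernoulli for
the concave power p - 1 leaves (p - 1)y² ≤ |y|^p. For y > 1, 1 + y ≤ 2y and 2^p ≤ 4. -/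
lemma abs_one_add_rpow_le {p : ℝ} (hp1 : 1 ≤ p) (hp2 : p ≤ 2) (y : ℝ) :
    |1 + y| ^ p ≤ 1 + p * y + 4 * |y| ^ p := by
  have hp0 : 0 < p := by linarith
  rcases lt_or_ge y (-1) with h1 | h1
  · have hy : |y| = -y := abs_of_neg (by linarith)
    have hle : |1 + y| ≤ |y| := by rw [hy, abs_of_neg (by linarith)]; linarith
    have h2 : |1 + y| ^ p ≤ |y| ^ p := Real.rpow_le_rpow (abs_nonneg _) hle hp0.le
    have h3 : |y| ≤ |y| ^ p := by
      conv_lhs => rw [← Real.rpow_one |y|]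
      exact Real.rpow_le_rpow_of_exponent_le (by rw [hy]; linarith) hp1
    have h4 : p * |y| ≤ 2 * |y| := by gcongr
    have : p * y = -(p * |y|) := by rw [hy]; ring
    nlinarith
  · rw [abs_of_nonneg (by linarith : (0 : ℝ) ≤ 1 + y)]
    rcases le_or_gt y 1 with h2 | h2
    · have hb : (1 + y) ^ (p - 1) ≤ 1 + (p - 1) * y :=
        rpow_one_add_le_one_add_mul_self h1 (by linarith) (by linarith)
      have h3 : (1 + y) ^ p = (1 + y) * (1 + y) ^ (p - 1) := by
        rcases eq_or_lt_of_le (show (0 : ℝ) ≤ 1 + y by linarith) with h0 | h0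
        · rw [← h0, Real.zero_rpow hp0.ne']; ring
        · conv_rhs => rw [← Real.rpow_one (1 + y), ← Real.rpow_mul h0.le, one_mul, ← Real.rpow_add h0]
          ring_nf
      have h4 : (1 + y) * (1 + y) ^ (p - 1) ≤ (1 + y) * (1 + (p - 1) * y) := by
        apply mul_le_mul_of_nonneg_left hb; linarith
      have h5 : y ^ 2 ≤ |y| ^ p := by
        rw [← sq_abs, ← Real.rpow_natCast]
        rcases eq_or_ne y 0 with rfl | hy0
        · simp [Real.zero_rpow hp0.ne']
        · exact Real.rpow_le_rpow_of_exponent_ge (abs_pos.mpr hy0) (abs_le.mpr ⟨h1, h2⟩) (by simpa using hp2)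
      nlinarith [sq_nonneg y]
    · have h3 : (1 + y) ^ p ≤ (2 * y) ^ p :=
        Real.rpow_le_rpow (by linarith) (by linarith) hp0.le
      have h4 : (2 * y) ^ p = 2 ^ p * y ^ p := Real.mul_rpow (by norm_num) (by linarith)
      have h5 : (2 : ℝ) ^ p ≤ 2 ^ (2 : ℝ) := Real.rpow_le_rpow_of_exponent_le (by norm_num) hp2
      have h6 : (2 : ℝ) ^ (2 : ℝ) = 4 := by norm_num
      have h7 : 0 ≤ y ^ p := Real.rpow_nonneg (by linarith) _
      rw [abs_of_pos (by linarith : (0 : ℝ) < y)]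
      nlinarith

/-- Scaling of the previous inequality by x. The derivative is written |x|^p / x so that division by
zero gives the right value 0 at x = 0. -/
lemma abs_add_rpow_le {p : ℝ} (hp1 : 1 ≤ p) (hp2 : p ≤ 2) (x z : ℝ) :
    |x + z| ^ p ≤ |x| ^ p + p * (|x| ^ p / x * z) + 4 * |z| ^ p := by
  have hp0 : 0 < p := by linarith
  rcases eq_or_ne x 0 with rfl | hx
  · have : 0 ≤ |z| ^ p := by positivity
    simp [Real.zero_rpow hp0.ne']; linarith
  · have h1 : |x + z| ^ p = |x| ^ p * |1 + z / x| ^ p := by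
      rw [← Real.mul_rpow (abs_nonneg _) (abs_nonneg _), ← abs_mul]; congr 2; field_simp
    have h2 : |z| ^ p = |x| ^ p * |z / x| ^ p := by
      rw [← Real.mul_rpow (abs_nonneg _) (abs_nonneg _), ← abs_mul]; congr 2; field_simp
    have h3 := abs_one_add_rpow_le hp1 hp2 (z / x)
    have h4 := mul_le_mul_of_nonneg_left h3 (by positivity : 0 ≤ |x| ^ p)
    rw [h1, h2]
    calc _ ≤ _ := h4
      _ = _ := by ring

lemma rpow_div_mul_le {p : ℝ} (hp1 : 1 ≤ p) (x l : ℝ) :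
    |(|x| ^ p / x) * l| ≤ |x| ^ p + |l| ^ p := by
  rcases eq_or_ne x 0 with rfl | hx
  · simp; positivity
  have hx' : 0 < |x| := abs_pos.mpr hx
  rw [abs_mul, abs_div, abs_of_nonneg (by positivity : 0 ≤ |x| ^ p)]
  rcases le_total |l| |x| with h | h
  · have : |x| ^ p / |x| * |l| ≤ |x| ^ p / |x| * |x| := by gcongr
    rw [div_mul_cancel₀ _ hx'.ne'] at this
    have : 0 ≤ |l| ^ p := by positivity
    linarith
  · have hl : 0 < |l| := lt_of_lt_of_le hx' h
    have h1 : |x| ^ p / |x| = |x| ^ (p - 1) := by rw [Real.rpow_sub hx', Real.rpow_one]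
    have h2 : |l| ^ p = |l| ^ (p - 1) * |l| := by
      rw [Real.rpow_sub hl, Real.rpow_one, div_mul_cancel₀ _ hl.ne']
    have h3 : |x| ^ (p - 1) ≤ |l| ^ (p - 1) := Real.rpow_le_rpow hx'.le h (by linarith)
    have h4 : |x| ^ (p - 1) * |l| ≤ |l| ^ (p - 1) * |l| := by gcongr
    have : 0 ≤ |x| ^ p := by positivity
    rw [h1, h2]; linarith

section

variable {Ω : Type*} [mΩ : MeasurableSpace Ω] {μ : Measure Ω} [IsProbabilityMeasure μ]

lemma memLp_mul_of_indep {p : ℝ} (hp1 : 1 ≤ p) {L Y : Ω → ℝ}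
    (hL : MemLp L (ENNReal.ofReal p) μ) (hY : MemLp Y (ENNReal.ofReal p) μ)
    (hLm : Measurable L) (hYm : Measurable Y) (hind : IndepFun L Y μ) :
    MemLp (fun ω => L ω * Y ω) (ENNReal.ofReal p) μ ∧
      ∫ ω, |L ω * Y ω| ^ p ∂μ = (∫ ω, |L ω| ^ p ∂μ) * ∫ ω, |Y ω| ^ p ∂μ := by
  have hp0 : 0 < p := by linarith
  have hpE : (ENNReal.ofReal p).toReal = p := ENNReal.toReal_ofReal hp0.le
  have hpne : ENNReal.ofReal p ≠ 0 := by simpa using hp0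
  have iL : Integrable (fun ω => |L ω| ^ p) μ := by
    simpa [hpE] using hL.integrable_norm_rpow hpne ENNReal.ofReal_ne_top
  have iY : Integrable (fun ω => |Y ω| ^ p) μ := by
    simpa [hpE] using hY.integrable_norm_rpow hpne ENNReal.ofReal_ne_top
  have hm : Measurable (fun x : ℝ => |x| ^ p) := by fun_prop
  have hind' : IndepFun (fun ω => |L ω| ^ p) (fun ω => |Y ω| ^ p) μ := hind.comp hm hm
  have heq : (fun ω => |L ω * Y ω| ^ p) = fun ω => |L ω| ^ p * |Y ω| ^ p := by
    ext ω; rw [abs_mul, Real.mul_rpow (abs_nonneg _) (abs_nonneg _)]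
  have hi : Integrable (fun ω => |L ω| ^ p * |Y ω| ^ p) μ := hind'.integrable_mul iL iY
  refine ⟨?_, ?_⟩
  · rw [← integrable_norm_rpow_iff
      (f := fun ω => L ω * Y ω) (hLm.mul hYm).aestronglyMeasurable hpne ENNReal.ofReal_ne_top]
    simpa only [hpE, Real.norm_eq_abs, heq] using hi
  · rw [heq]
    exact hind'.integral_mul_eq_mul_integral iL.aestronglyMeasurable iY.aestronglyMeasurable

/-- The linear term of the expansion has mean zero, because Y is centred and independent of (S, L)
jointly; only the p-th order remainder survives. -/
lemma integral_abs_add_mul_rpow_le {p : ℝ} (hp1 : 1 ≤ p) (hp2 : p ≤ 2) {S L Y : Ω → ℝ}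
    (hS : MemLp S (ENNReal.ofReal p) μ) (hL : MemLp L (ENNReal.ofReal p) μ)
    (hY : MemLp Y (ENNReal.ofReal p) μ) (hSm : Measurable S) (hLm : Measurable L)
    (hYm : Measurable Y) (hind : IndepFun (fun ω => (S ω, L ω)) Y μ) (hY0 : ∫ ω, Y ω ∂μ = 0) :
    ∫ ω, |S ω + L ω * Y ω| ^ p ∂μ
      ≤ ∫ ω, |S ω| ^ p ∂μ + 4 * ((∫ ω, |L ω| ^ p ∂μ) * ∫ ω, |Y ω| ^ p ∂μ) := by
  have hp0 : 0 < p := by linarith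
  have hpE : (ENNReal.ofReal p).toReal = p := ENNReal.toReal_ofReal hp0.le
  have hpne : ENNReal.ofReal p ≠ 0 := by simpa using hp0
  have key : ∀ {f : Ω → ℝ}, MemLp f (ENNReal.ofReal p) μ → Integrable (fun ω => |f ω| ^ p) μ := by
    intro f hf
    simpa [hpE] using hf.integrable_norm_rpow hpne ENNReal.ofReal_ne_top
  have hindL : IndepFun L Y μ := hind.comp measurable_snd measurable_id
  obtain ⟨hLY, hLYe⟩ := memLp_mul_of_indep hp1 hL hY hLm hYm hindL
  have hD : Measurable (fun q : ℝ × ℝ => (|q.1| ^ p / q.1) * q.2) := by fun_prop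
  have hindD : IndepFun (fun ω => (|S ω| ^ p / S ω) * L ω) Y μ := hind.comp hD measurable_id
  have iD : Integrable (fun ω => (|S ω| ^ p / S ω) * L ω) μ := by
    refine Integrable.mono' ((key hS).add (key hL)) (by fun_prop) (ae_of_all _ fun ω => ?_)
    exact rpow_div_mul_le hp1 _ _
  have iY : Integrable Y μ := hY.integrable (by simpa using hp1)
  have iDY : Integrable (fun ω => ((|S ω| ^ p / S ω) * L ω) * Y ω) μ := hindD.integrable_mul iD iY
  have eDY : ∫ ω, ((|S ω| ^ p / S ω) * L ω) * Y ω ∂μ = 0 := by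
    have := hindD.integral_mul_eq_mul_integral iD.aestronglyMeasurable iY.aestronglyMeasurable
    rw [hY0, mul_zero] at this
    exact this
  have hsum : MemLp (fun ω => S ω + L ω * Y ω) (ENNReal.ofReal p) μ := hS.add hLY
  calc ∫ ω, |S ω + L ω * Y ω| ^ p ∂μ
      ≤ ∫ ω, (|S ω| ^ p + p * (((|S ω| ^ p / S ω) * L ω) * Y ω) + 4 * |L ω * Y ω| ^ p) ∂μ := by
        refine integral_mono (key hsum)
          (((key hS).add (iDY.const_mul p)).add ((key hLY).const_mul 4)) fun ω => ?_
        have := abs_add_rpow_le hp1 hp2 (S ω) (L ω * Y ω)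
        simpa [mul_assoc] using this
    _ = _ := by
        have hSD : Integrable (fun ω => |S ω| ^ p + p * (((|S ω| ^ p / S ω) * L ω) * Y ω)) μ :=
          (key hS).add (iDY.const_mul p)
        rw [integral_add hSD ((key hLY).const_mul 4),
          integral_add (key hS) (iDY.const_mul p), integral_const_mul, integral_const_mul, eDY,
          hLYe]
        ring

end

/-! ### Moments of branch weights and of finite sums over the tree. -/

/-- An i.i.d. weighted tree with almost surely finitely many nonzero weights per vertex, centred
`C ∈ L^p` and `E Σ_p < 1`. -/
structure IsContractiveTree {Ω : Type*} [MeasurableSpace Ω] (μ : Measure Ω) (C : List ℕ → Ω → ℝ)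
    (T : List ℕ → ℕ → Ω → ℝ) (p : ℝ) : Prop where
  iid : IsIIDTree μ C T
  finite : ∀ᵐ ω ∂μ, ∃ N, ∀ k, N ≤ k → T [] k ω = 0
  centered : ∫ ω, C [] ω ∂μ = 0
  memLp_C : MemLp (C []) (ENNReal.ofReal p) μ
  memLp_T : ∀ k, MemLp (T [] k) (ENNReal.ofReal p) μ
  summable : Summable (fun k => ∫ ω, |T [] k ω| ^ p ∂μ)
  lt_one : ∑' k, ∫ ω, |T [] k ω| ^ p ∂μ < 1

/-- The σ-algebra generated by the data at all vertices other than `v`. -/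
@[reducible] def sigmaOff {Ω : Type*} (C : List ℕ → Ω → ℝ) (T : List ℕ → ℕ → Ω → ℝ)
    (v : List ℕ) : MeasurableSpace Ω :=
  ⨆ u ∈ {u | u ≠ v}, MeasurableSpace.comap (fun ω => ((C u ω, fun k => T u k ω) : ℝ × (ℕ → ℝ)))
    inferInstance

section

variable {Ω : Type*} [mΩ : MeasurableSpace Ω] {μ : Measure Ω} [IsProbabilityMeasure μ]
  {C : List ℕ → Ω → ℝ} {T : List ℕ → ℕ → Ω → ℝ}

lemma measurable_branchWeight (h : IsIIDTree μ C T) (v : List ℕ) :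
    Measurable (branchWeight T v) := by
  induction v with
  | nil => exact measurable_const
  | cons k v ih => exact ih.mul (h.measurable_T v k)

lemma comap_le_sigmaOff {u v : List ℕ} (huv : u ≠ v) :
    MeasurableSpace.comap (fun ω => ((C u ω, fun k => T u k ω) : ℝ × (ℕ → ℝ))) inferInstance
      ≤ sigmaOff C T v :=
  le_iSup₂_of_le u huv le_rfl

lemma measurable_sigmaOff_C {u v : List ℕ} (huv : u ≠ v) :
    Measurable[sigmaOff C T v] (C u) := by
  have h : Measurable[MeasurableSpace.comap
      (fun ω => ((C u ω, fun k => T u k ω) : ℝ × (ℕ → ℝ))) inferInstance] (C u) :=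
    measurable_fst.comp (comap_measurable _)
  exact h.mono (comap_le_sigmaOff huv) le_rfl

lemma measurable_sigmaOff_T {u v : List ℕ} (huv : u ≠ v) (k : ℕ) :
    Measurable[sigmaOff C T v] (T u k) := by
  have h : Measurable[MeasurableSpace.comap
      (fun ω => ((C u ω, fun k => T u k ω) : ℝ × (ℕ → ℝ))) inferInstance] (T u k) :=
    ((measurable_pi_apply k).comp measurable_snd).comp (comap_measurable
      (fun ω => ((C u ω, fun k => T u k ω) : ℝ × (ℕ → ℝ))))
  exact h.mono (comap_le_sigmaOff huv) le_rfl

/-- The weight of u uses data at strict ancestors of u only, and these are shorter than v. -/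
lemma measurable_sigmaOff_branchWeight {u v : List ℕ} (huv : u.length ≤ v.length) :
    Measurable[sigmaOff C T v] (branchWeight T u) := by
  induction u with
  | nil => exact measurable_const
  | cons k u ih =>
    simp only [List.length_cons] at huv
    have h1 : u ≠ v := by rintro rfl; omega
    exact Measurable.mul (ih (by omega)) (measurable_sigmaOff_T h1 k)

lemma indep_sigmaOff (h : IsIIDTree μ C T) (v : List ℕ) :
    Indep (sigmaOff C T v) (MeasurableSpace.comap
      (fun ω => ((C v ω, fun k => T v k ω) : ℝ × (ℕ → ℝ))) inferInstance) μ := by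
  have h1 := indep_iSup_of_disjoint (S := {u | u ≠ v}) (T := {v})
    (m := fun u => MeasurableSpace.comap
      (fun ω => ((C u ω, fun k => T u k ω) : ℝ × (ℕ → ℝ))) inferInstance) (μ := μ)
    (fun u => ((h.measurable_C u).prodMk (measurable_pi_lambda _ (h.measurable_T u))).comap_le)
    h.indep.iIndep (by simp)
  simpa [sigmaOff] using h1

lemma indepFun_of_sigmaOff (h : IsIIDTree μ C T) (v : List ℕ) {β : Type*} [MeasurableSpace β]
    {f : Ω → β} (hf : Measurable[sigmaOff C T v] f) :
    IndepFun f (fun ω => ((C v ω, fun k => T v k ω) : ℝ × (ℕ → ℝ))) μ := by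
  rw [IndepFun_iff_Indep]
  exact indep_of_indep_of_le_left (indep_sigmaOff h v) hf.comap_le

lemma identDistrib_C (h : IsIIDTree μ C T) (v : List ℕ) : IdentDistrib (C v) (C []) μ μ :=
  (h.ident v).comp measurable_fst

lemma identDistrib_T (h : IsIIDTree μ C T) (v : List ℕ) (k : ℕ) :
    IdentDistrib (T v k) (T [] k) μ μ :=
  (h.ident v).comp ((measurable_pi_apply k).comp measurable_snd)

/-- `E |L(v)|^p` in product form. -/
noncomputable def branchMoment (μ : Measure Ω) (T : List ℕ → ℕ → Ω → ℝ) (p : ℝ) (v : List ℕ) : ℝ :=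
  (v.map fun k => ∫ ω, |T [] k ω| ^ p ∂μ).prod

lemma branchMoment_nonneg (p : ℝ) (v : List ℕ) : 0 ≤ branchMoment μ T p v := by
  unfold branchMoment
  apply List.prod_nonneg
  intro a ha
  obtain ⟨k, -, rfl⟩ := List.mem_map.mp ha
  positivity

variable {p : ℝ}

lemma memLp_branchWeight (hp : 1 ≤ p) (h : IsContractiveTree μ C T p) (v : List ℕ) :
    MemLp (branchWeight T v) (ENNReal.ofReal p) μ ∧
      ∫ ω, |branchWeight T v ω| ^ p ∂μ = branchMoment μ T p v := by
  induction v with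
  | nil =>
    refine ⟨memLp_const 1, ?_⟩
    simp [branchWeight, branchMoment]
  | cons k v ih =>
    have hind : IndepFun (branchWeight T v) (T v k) μ :=
      (indepFun_of_sigmaOff h.iid v (measurable_sigmaOff_branchWeight le_rfl)).comp
        measurable_id ((measurable_pi_apply k).comp measurable_snd)
    have hid := identDistrib_T h.iid v k
    have hm : MemLp (T v k) (ENNReal.ofReal p) μ := hid.symm.memLp_iff.mp (h.memLp_T k)
    have := memLp_mul_of_indep hp ih.1 hm (measurable_branchWeight h.iid v)
      (h.iid.measurable_T v k) hind
    refine ⟨this.1, ?_⟩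
    have h2 : ∫ ω, |T v k ω| ^ p ∂μ = ∫ ω, |T [] k ω| ^ p ∂μ :=
      (hid.comp (show Measurable (fun x : ℝ => |x| ^ p) by fun_prop)).integral_eq
    simp only [branchWeight]
    rw [this.2, ih.2, h2]
    simp [branchMoment, mul_comm]

lemma memLp_branchWeight_mul (hp : 1 ≤ p) (h : IsContractiveTree μ C T p) (v : List ℕ) :
    MemLp (fun ω => branchWeight T v ω * C v ω) (ENNReal.ofReal p) μ ∧
      ∫ ω, branchWeight T v ω * C v ω ∂μ = 0 := by
  have hind : IndepFun (branchWeight T v) (C v) μ :=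
    (indepFun_of_sigmaOff h.iid v (measurable_sigmaOff_branchWeight le_rfl)).comp
      measurable_id measurable_fst
  have hid := identDistrib_C h.iid v
  have hm : MemLp (C v) (ENNReal.ofReal p) μ := hid.symm.memLp_iff.mp h.memLp_C
  refine ⟨(memLp_mul_of_indep hp (memLp_branchWeight hp h v).1 hm (measurable_branchWeight h.iid v)
    (h.iid.measurable_C v) hind).1, ?_⟩
  have := hind.integral_mul_eq_mul_integral
    (measurable_branchWeight h.iid v).aestronglyMeasurable
    (h.iid.measurable_C v).aestronglyMeasurable
  rw [hid.integral_eq, h.centered, mul_zero] at this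
  exact this

/-- Vertices are added in order of length. When v is added, all earlier summands and L(v) avoid the
data at v, so C(v) is a fresh centred factor, and each vertex costs 4 E|L(v)|^p E|C|^p. -/
lemma integral_sum_rpow_le (hp : 1 ≤ p) (hp2 : p ≤ 2) (h : IsContractiveTree μ C T p)
    (F : Finset (List ℕ)) :
    ∫ ω, |∑ v ∈ F, branchWeight T v ω * C v ω| ^ p ∂μ
      ≤ 4 * (∫ ω, |C [] ω| ^ p ∂μ) * ∑ v ∈ F, branchMoment μ T p v := by
  refine Finset.induction_on_max_value List.length F ?_ ?_
  · have : p ≠ 0 := by linarith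
    simp [Real.zero_rpow this]
  · intro v s hv hmax ih
    have hS : Measurable[sigmaOff C T v] (fun ω => ∑ u ∈ s, branchWeight T u ω * C u ω) := by
      refine Finset.measurable_fun_sum s fun u hu => ?_
      have huv : u ≠ v := by rintro rfl; exact hv hu
      exact Measurable.mul (measurable_sigmaOff_branchWeight (hmax u hu))
        (measurable_sigmaOff_C huv)
    have hL : Measurable[sigmaOff C T v] (branchWeight T v) :=
      measurable_sigmaOff_branchWeight le_rfl
    have hind := (indepFun_of_sigmaOff h.iid v (hS.prodMk hL)).comp measurable_id measurable_fst
    have hid := identDistrib_C h.iid v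
    have hm : MemLp (C v) (ENNReal.ofReal p) μ := hid.symm.memLp_iff.mp h.memLp_C
    have hSL : MemLp (fun ω => ∑ u ∈ s, branchWeight T u ω * C u ω) (ENNReal.ofReal p) μ :=
      memLp_finsetSum s fun u _ => (memLp_branchWeight_mul hp h u).1
    have key := integral_abs_add_mul_rpow_le hp hp2 hSL (memLp_branchWeight hp h v).1 hm
      (Finset.measurable_fun_sum s fun u _ =>
        (measurable_branchWeight h.iid u).mul (h.iid.measurable_C u))
      (measurable_branchWeight h.iid v) (h.iid.measurable_C v) hind
      (by rw [hid.integral_eq, h.centered])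
    have h2 : ∫ ω, |C v ω| ^ p ∂μ = ∫ ω, |C [] ω| ^ p ∂μ :=
      (hid.comp (show Measurable (fun x : ℝ => |x| ^ p) by fun_prop)).integral_eq
    rw [h2, (memLp_branchWeight hp h v).2] at key
    simp only [Finset.sum_insert hv]
    calc _ = ∫ ω, |∑ u ∈ s, branchWeight T u ω * C u ω + branchWeight T v ω * C v ω| ^ p ∂μ := by
          simp only [add_comm]
      _ ≤ _ := key
      _ ≤ _ := by
        rw [mul_add]; linarith

lemma eLpNorm_branchSum_le (hp : 1 ≤ p) (hp2 : p ≤ 2) (h : IsContractiveTree μ C T p)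
    (F : Finset (List ℕ)) :
    eLpNorm (fun ω => ∑ v ∈ F, branchWeight T v ω * C v ω) 1 μ
      ≤ ENNReal.ofReal ((4 * (∫ ω, |C [] ω| ^ p ∂μ) * ∑ v ∈ F, branchMoment μ T p v) ^ p⁻¹) := by
  have hp0 : 0 < p := by linarith
  have hpE : (ENNReal.ofReal p).toReal = p := ENNReal.toReal_ofReal hp0.le
  have hpne : ENNReal.ofReal p ≠ 0 := by simpa using hp0
  have hSL : MemLp (fun ω => ∑ u ∈ F, branchWeight T u ω * C u ω) (ENNReal.ofReal p) μ :=
    memLp_finsetSum F fun u _ => (memLp_branchWeight_mul hp h u).1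
  refine (eLpNorm_le_eLpNorm_of_exponent_le (q := ENNReal.ofReal p) (by simpa using hp)
    hSL.aestronglyMeasurable).trans ?_
  rw [hSL.eLpNorm_eq_integral_rpow_norm hpne ENNReal.ofReal_ne_top, hpE]
  refine ENNReal.ofReal_le_ofReal ?_
  exact Real.rpow_le_rpow (by positivity) (integral_sum_rpow_le hp hp2 h F) (by positivity)

/-- Appending a new generation at the top of a list. -/
def consEquiv (n : ℕ) : ℕ × {v : List ℕ // v.length = n} ≃ {v : List ℕ // v.length = n + 1} where
  toFun q := ⟨q.1 :: q.2.1, by simp [q.2.2]⟩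
  invFun v := (v.1.head (by rintro h; have := v.2; simp [h] at this), ⟨v.1.tail, by simp [v.2]⟩)
  left_inv q := by simp
  right_inv v := by simp

lemma hasSum_mul_of_nonneg {ι κ : Type*} {f : ι → ℝ} {g : κ → ℝ} {s t : ℝ} (hf : HasSum f s)
    (hg : HasSum g t) (hf0 : 0 ≤ f) (hg0 : 0 ≤ g) :
    HasSum (fun q : ι × κ => f q.1 * g q.2) (s * t) :=
  hf.mul hg (hf.summable.mul_of_nonneg hg.summable hf0 hg0)

lemma hasSum_branchMoment (h : IsContractiveTree μ C T p) (n : ℕ) :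
    HasSum (fun v : {v : List ℕ // v.length = n} => branchMoment μ T p v.1)
      ((∑' k, ∫ ω, |T [] k ω| ^ p ∂μ) ^ n) := by
  induction n with
  | zero =>
    have : Unique {v : List ℕ // v.length = 0} :=
      ⟨⟨⟨[], rfl⟩⟩, fun v => Subtype.ext (List.length_eq_zero_iff.mp v.2)⟩
    have h1 := hasSum_unique (fun v : {v : List ℕ // v.length = 0} => branchMoment μ T p v.1)
    have h2 : branchMoment μ T p (default : {v : List ℕ // v.length = 0}).1 = 1 := by
      rw [List.length_eq_zero_iff.mp (default : {v : List ℕ // v.length = 0}).2]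
      simp [branchMoment]
    simpa [h2] using h1
  | succ n ih =>
    have hf : 0 ≤ fun k => ∫ ω, |T [] k ω| ^ p ∂μ := fun k => by positivity
    have hg : 0 ≤ fun v : {v : List ℕ // v.length = n} => branchMoment μ T p v.1 :=
      fun v => branchMoment_nonneg p v.1
    have h1 := hasSum_mul_of_nonneg h.summable.hasSum ih hf hg
    have he : ((fun v : {v : List ℕ // v.length = n + 1} => branchMoment μ T p v.1) ∘
        consEquiv n) = fun q : ℕ × {v : List ℕ // v.length = n} =>
          (∫ ω, |T [] q.1 ω| ^ p ∂μ) * branchMoment μ T p q.2.1 := by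
      funext q
      simp [consEquiv, branchMoment]
    rw [← (consEquiv n).hasSum_iff, he, pow_succ']
    exact h1

end

/-! ### Almost sure convergence of `partialW` and integrability of the limit. -/

section

variable {Ω : Type*} [mΩ : MeasurableSpace Ω] {μ : Measure Ω} [IsProbabilityMeasure μ]
  {C : List ℕ → Ω → ℝ} {T : List ℕ → ℕ → Ω → ℝ} {p : ℝ}

lemma measurableSet_eventually_zero :
    MeasurableSet {q : ℝ × (ℕ → ℝ) | ∃ N, ∀ k, N ≤ k → q.2 k = 0} := by
  simp only [ofPred_exists, ofPred_forall]
  refine MeasurableSet.iUnion fun N => MeasurableSet.iInter fun k => MeasurableSet.iInter fun _ => ?_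
  exact measurableSet_eq_fun ((measurable_pi_apply k).comp measurable_snd) measurable_const

lemma ae_forall_weights_eventually_zero (h : IsContractiveTree μ C T p) :
    ∀ᵐ ω ∂μ, ∀ v, ∃ N, ∀ k, N ≤ k → T v k ω = 0 := by
  rw [ae_all_iff]
  intro v
  exact (h.iid.ident v).symm.ae_snd (p := fun q => ∃ N, ∀ k, N ≤ k → q.2 k = 0)
    measurableSet_eventually_zero h.finite

lemma finite_branchWeight_ne_zero {ω : Ω} (h : ∀ v, ∃ N, ∀ k, N ≤ k → T v k ω = 0) (n : ℕ) :
    {v : List ℕ | v.length = n ∧ branchWeight T v ω ≠ 0}.Finite := by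
  choose N hN using h
  induction n with
  | zero =>
    refine (finite_singleton []).subset ?_
    rintro v ⟨hv, -⟩
    simpa using hv
  | succ n ih =>
    refine (ih.biUnion (t := fun v => (fun k => k :: v) '' Iio (N v))
      fun v _ => (finite_Iio (N v)).image _).subset ?_
    rintro v ⟨hv, hne⟩
    cases v with
    | nil => simp at hv
    | cons k v =>
      simp only [branchWeight, ne_eq, mul_eq_zero, not_or] at hne
      refine mem_biUnion (x := v) ⟨by simpa using hv, hne.1⟩ ⟨k, ?_, rfl⟩
      by_contra hk
      exact hne.2 (hN v k (by simpa using hk))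

lemma hasSum_levelSum {ω : Ω} (h : ∀ v, ∃ N, ∀ k, N ≤ k → T v k ω = 0) (n : ℕ) :
    HasSum (fun v : {v : List ℕ // v.length = n} => branchWeight T v ω * C v ω)
      (levelSum C T n ω) := by
  refine (summable_of_hasFiniteSupport ?_).hasSum
  refine ((finite_branchWeight_ne_zero h n).preimage
    (f := ((↑) : {v : List ℕ // v.length = n} → List ℕ)) Subtype.val_injective.injOn).subset ?_
  intro v hv
  exact ⟨v.2, left_ne_zero_of_mul hv⟩

lemma ae_hasSum_levelSum (h : IsContractiveTree μ C T p) (n : ℕ) :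
    ∀ᵐ ω ∂μ, HasSum (fun v : {v : List ℕ // v.length = n} => branchWeight T v ω * C v ω)
      (levelSum C T n ω) := by
  filter_upwards [ae_forall_weights_eventually_zero h] with ω hω using hasSum_levelSum hω n

lemma aemeasurable_levelSum (h : IsContractiveTree μ C T p) (n : ℕ) :
    AEMeasurable (levelSum C T n) μ := by
  refine aemeasurable_of_tendsto_metrizable_ae (atTop : Filter (Finset {v : List ℕ // v.length = n}))
    (f := fun F ω => ∑ v ∈ F, branchWeight T v.1 ω * C v.1 ω) (fun F => ?_) ?_
  · exact (Finset.measurable_fun_sum F fun v _ =>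
      (measurable_branchWeight h.iid v.1).mul (h.iid.measurable_C v.1)).aemeasurable
  · exact ae_hasSum_levelSum h n

/-- Lower semicontinuity of the norm along finite sets G ⊇ F: the difference of the two sums runs
over G \ F, whose total branch moment is at most the part of the generation not exhausted by F. -/
lemma eLpNorm_levelSum_sub_le (hp : 1 ≤ p) (hp2 : p ≤ 2) (h : IsContractiveTree μ C T p) (n : ℕ)
    (F : Finset {v : List ℕ // v.length = n}) :
    eLpNorm (fun ω => levelSum C T n ω - ∑ v ∈ F, branchWeight T v.1 ω * C v.1 ω) 1 μ
      ≤ ENNReal.ofReal ((4 * (∫ ω, |C [] ω| ^ p ∂μ) *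
        ((∑' k, ∫ ω, |T [] k ω| ^ p ∂μ) ^ n - ∑ v ∈ F, branchMoment μ T p v.1)) ^ p⁻¹) := by
  classical
  have hmeas : ∀ G : Finset {v : List ℕ // v.length = n},
      Measurable fun ω => ∑ v ∈ G, branchWeight T v.1 ω * C v.1 ω := fun G =>
    Finset.measurable_fun_sum G fun v _ =>
      (measurable_branchWeight h.iid v.1).mul (h.iid.measurable_C v.1)
  refine Lp.eLpNorm_le_of_ae_tendsto (u := atTop)
    (f := fun (G : Finset {v : List ℕ // v.length = n}) ω =>
      ∑ v ∈ G, branchWeight T v.1 ω * C v.1 ω - ∑ v ∈ F, branchWeight T v.1 ω * C v.1 ω)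
    ?_ (fun G => ((hmeas G).sub (hmeas F)).aestronglyMeasurable) ?_
  · filter_upwards [eventually_ge_atTop F] with G hG
    have h1 : (fun ω => ∑ v ∈ G, branchWeight T v.1 ω * C v.1 ω
        - ∑ v ∈ F, branchWeight T v.1 ω * C v.1 ω) = fun ω =>
        ∑ v ∈ (G \ F).map (Function.Embedding.subtype _), branchWeight T v ω * C v ω := by
      ext ω
      rw [Finset.sum_map, ← Finset.sum_sdiff hG]
      simp
    rw [h1]
    refine (eLpNorm_branchSum_le hp hp2 h _).trans (ENNReal.ofReal_le_ofReal ?_)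
    have h2 : 0 ≤ ∑ v ∈ (G \ F).map (Function.Embedding.subtype _), branchMoment μ T p v :=
      Finset.sum_nonneg fun v _ => branchMoment_nonneg p v
    have h3 : ∑ v ∈ (G \ F).map (Function.Embedding.subtype _), branchMoment μ T p v
        ≤ (∑' k, ∫ ω, |T [] k ω| ^ p ∂μ) ^ n - ∑ v ∈ F, branchMoment μ T p v.1 := by
      rw [Finset.sum_map, le_sub_iff_add_le]
      have := sum_le_hasSum G (fun v _ => branchMoment_nonneg p v.1) (hasSum_branchMoment h n)
      rw [← Finset.sum_sdiff hG] at this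
      exact this
    have h0 : 0 ≤ ∫ ω, |C [] ω| ^ p ∂μ := by positivity
    refine Real.rpow_le_rpow (by positivity) ?_ (by positivity)
    gcongr
  · filter_upwards [ae_hasSum_levelSum h n] with ω hω
    exact hω.sub_const _

lemma integrable_levelSum (hp : 1 ≤ p) (hp2 : p ≤ 2) (h : IsContractiveTree μ C T p) (n : ℕ) :
    Integrable (levelSum C T n) μ ∧
      ∫ ω, |levelSum C T n ω| ∂μ ≤ (4 * (∫ ω, |C [] ω| ^ p ∂μ) *
        (∑' k, ∫ ω, |T [] k ω| ^ p ∂μ) ^ n) ^ p⁻¹ := by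
  have h1 := eLpNorm_levelSum_sub_le hp hp2 h n ∅
  simp only [Finset.sum_empty, sub_zero] at h1
  have hi : Integrable (levelSum C T n) μ := memLp_one_iff_integrable.mp
    ⟨(aemeasurable_levelSum h n).aestronglyMeasurable, h1.trans_lt ENNReal.ofReal_lt_top⟩
  refine ⟨hi, ?_⟩
  have h2 := integral_norm_eq_lintegral_enorm hi.aestronglyMeasurable
  simp only [Real.norm_eq_abs] at h2
  rw [h2, ← eLpNorm_one_eq_lintegral_enorm]
  refine ENNReal.toReal_le_of_le_ofReal ?_ h1
  have : 0 ≤ ∑' k, ∫ ω, |T [] k ω| ^ p ∂μ := tsum_nonneg fun k => by positivity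
  positivity

/-- Finite sums are centred and approximate the generation in L¹, with an error bound that vanishes
as the finite set grows. -/
lemma integral_levelSum (hp : 1 ≤ p) (hp2 : p ≤ 2) (h : IsContractiveTree μ C T p) (n : ℕ) :
    ∫ ω, levelSum C T n ω ∂μ = 0 := by
  have hb : ∀ F : Finset {v : List ℕ // v.length = n}, |∫ ω, levelSum C T n ω ∂μ|
      ≤ (4 * (∫ ω, |C [] ω| ^ p ∂μ) *
        ((∑' k, ∫ ω, |T [] k ω| ^ p ∂μ) ^ n - ∑ v ∈ F, branchMoment μ T p v.1)) ^ p⁻¹ := by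
    intro F
    have hi := (integrable_levelSum hp hp2 h n).1
    have hv : ∀ v ∈ F, Integrable (fun ω => branchWeight T v.1 ω * C v.1 ω) μ := fun v _ =>
      (memLp_branchWeight_mul hp h v.1).1.integrable (by simpa using hp)
    have hs : Integrable (fun ω => ∑ v ∈ F, branchWeight T v.1 ω * C v.1 ω) μ :=
      integrable_finsetSum F hv
    have h0 : ∫ ω, ∑ v ∈ F, branchWeight T v.1 ω * C v.1 ω ∂μ = 0 := by
      rw [integral_finsetSum F hv]
      exact Finset.sum_eq_zero fun v _ => (memLp_branchWeight_mul hp h v.1).2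
    have h1 : ∫ ω, levelSum C T n ω ∂μ
        = ∫ ω, (levelSum C T n ω - ∑ v ∈ F, branchWeight T v.1 ω * C v.1 ω) ∂μ := by
      rw [integral_sub hi hs, h0, sub_zero]
    rw [h1]
    refine (norm_integral_le_integral_norm
      (fun ω => levelSum C T n ω - ∑ v ∈ F, branchWeight T v.1 ω * C v.1 ω)).trans ?_
    rw [integral_norm_eq_lintegral_enorm
      (f := fun ω => levelSum C T n ω - ∑ v ∈ F, branchWeight T v.1 ω * C v.1 ω)
      (hi.sub hs).aestronglyMeasurable,
      ← eLpNorm_one_eq_lintegral_enorm]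
    refine ENNReal.toReal_le_of_le_ofReal ?_ (eLpNorm_levelSum_sub_le hp hp2 h n F)
    have : 0 ≤ (∑' k, ∫ ω, |T [] k ω| ^ p ∂μ) ^ n - ∑ v ∈ F, branchMoment μ T p v.1 :=
      sub_nonneg.mpr
        (sum_le_hasSum F (fun v _ => branchMoment_nonneg p v.1) (hasSum_branchMoment h n))
    positivity
  have hp' : p⁻¹ ≠ 0 := by positivity
  have hlim : Tendsto (fun F : Finset {v : List ℕ // v.length = n} => (4 * (∫ ω, |C [] ω| ^ p ∂μ) *
        ((∑' k, ∫ ω, |T [] k ω| ^ p ∂μ) ^ n - ∑ v ∈ F, branchMoment μ T p v.1)) ^ p⁻¹)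
      atTop (𝓝 0) := by
    have h1 : Tendsto (fun F : Finset {v : List ℕ // v.length = n} =>
        ∑ v ∈ F, branchMoment μ T p v.1) atTop (𝓝 ((∑' k, ∫ ω, |T [] k ω| ^ p ∂μ) ^ n)) :=
      hasSum_branchMoment h n
    have h2 := ((h1.const_sub ((∑' k, ∫ ω, |T [] k ω| ^ p ∂μ) ^ n)).const_mul
      (4 * (∫ ω, |C [] ω| ^ p ∂μ))).rpow_const (p := p⁻¹) (Or.inr (by positivity))
    simpa [Real.zero_rpow hp'] using h2
  exact abs_nonpos_iff.mp (ge_of_tendsto' hlim hb)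

/-- Comparison with a geometric series of ratio (E Σ_p)^{1/p}. -/
lemma summable_integral_abs_levelSum (hp : 1 ≤ p) (hp2 : p ≤ 2) (h : IsContractiveTree μ C T p) :
    Summable fun n => ∫ ω, |levelSum C T n ω| ∂μ := by
  set r := ∑' k, ∫ ω, |T [] k ω| ^ p ∂μ with hr
  have hr0 : 0 ≤ r := tsum_nonneg fun k => by positivity
  have hp' : 0 < p⁻¹ := by positivity
  have hC : 0 ≤ ∫ ω, |C [] ω| ^ p ∂μ := by positivity
  refine Summable.of_nonneg_of_le (fun n => by positivity)
    (fun n => (integrable_levelSum hp hp2 h n).2) ?_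
  have h1 : ∀ n : ℕ, (4 * (∫ ω, |C [] ω| ^ p ∂μ) * r ^ n) ^ p⁻¹
      = (4 * (∫ ω, |C [] ω| ^ p ∂μ)) ^ p⁻¹ * (r ^ p⁻¹) ^ n := by
    intro n
    rw [Real.mul_rpow (by positivity) (by positivity), ← Real.rpow_natCast, ← Real.rpow_natCast,
      ← Real.rpow_mul hr0, ← Real.rpow_mul hr0, mul_comm (n : ℝ)]
  simp only [← hr, h1]
  exact (summable_geometric_of_lt_one (by positivity)
    (Real.rpow_lt_one hr0 h.lt_one hp')).mul_left _

theorem ae_summable_levelSum (hp : 1 ≤ p) (hp2 : p ≤ 2) (h : IsContractiveTree μ C T p) :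
    ∀ᵐ ω ∂μ, Summable fun n => levelSum C T n ω := by
  have hi := fun n => (integrable_levelSum hp hp2 h n).1
  have h1 : ∑' n, ∫⁻ ω, ‖levelSum C T n ω‖ₑ ∂μ ≠ ∞ := by
    have h2 : ∀ n, ∫⁻ ω, ‖levelSum C T n ω‖ₑ ∂μ
        = ENNReal.ofReal (∫ ω, |levelSum C T n ω| ∂μ) := fun n =>
      (ofReal_integral_norm_eq_lintegral_enorm (hi n)).symm
    simp only [h2]
    rw [← ENNReal.ofReal_tsum_of_nonneg (fun n => by positivity)
      (summable_integral_abs_levelSum hp hp2 h)]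
    exact ENNReal.ofReal_ne_top
  rw [← lintegral_tsum fun n => (hi n).aestronglyMeasurable.enorm] at h1
  filter_upwards [ae_lt_top' (AEMeasurable.tsum fun n => (hi n).aestronglyMeasurable.enorm) h1]
    with ω hω
  have h3 : Summable fun n => ‖levelSum C T n ω‖₊ := by
    rw [← ENNReal.tsum_coe_ne_top_iff_summable]
    exact hω.ne
  exact h3.of_nnnorm

theorem ae_tendsto_canonicalW (hp : 1 ≤ p) (hp2 : p ≤ 2) (h : IsContractiveTree μ C T p) :
    ∀ᵐ ω ∂μ, Tendsto (fun n => partialW C T n ω) atTop (𝓝 (canonicalW C T ω)) := by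
  filter_upwards [ae_summable_levelSum hp hp2 h] with ω hω
  -- `partialW` at n sums n + 1 generations, hence the shift by one.
  exact tendsto_nhds_limUnder ⟨_, hω.hasSum.tendsto_sum_nat.comp (tendsto_add_atTop_nat 1)⟩

lemma aemeasurable_partialW (h : IsContractiveTree μ C T p) (n : ℕ) :
    AEMeasurable (fun ω => partialW C T n ω) μ :=
  Finset.aemeasurable_fun_sum _ fun k _ => aemeasurable_levelSum h k

lemma aemeasurable_canonicalW (hp : 1 ≤ p) (hp2 : p ≤ 2) (h : IsContractiveTree μ C T p) :
    AEMeasurable (canonicalW C T) μ :=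
  aemeasurable_of_tendsto_metrizable_ae atTop (aemeasurable_partialW h)
    (ae_tendsto_canonicalW hp hp2 h)

lemma integrable_canonicalW (hp : 1 ≤ p) (hp2 : p ≤ 2) (h : IsContractiveTree μ C T p) :
    Integrable (canonicalW C T) μ ∧ ∫ ω, canonicalW C T ω ∂μ = 0 := by
  have hi := fun n => (integrable_levelSum hp hp2 h n).1
  have hs := summable_integral_abs_levelSum hp hp2 h
  have he : canonicalW C T =ᵐ[μ] fun ω => ∑' n, levelSum C T n ω := by
    filter_upwards [ae_summable_levelSum hp hp2 h, ae_tendsto_canonicalW hp hp2 h] with ω h1 h2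
    exact tendsto_nhds_unique h2 (h1.hasSum.tendsto_sum_nat.comp (tendsto_add_atTop_nat 1))
  constructor
  · rw [← memLp_one_iff_integrable]
    refine ⟨(aemeasurable_canonicalW hp hp2 h).aestronglyMeasurable, ?_⟩
    refine (Lp.eLpNorm_le_of_ae_tendsto (u := atTop) (f := fun n ω => partialW C T n ω)
      (C := ENNReal.ofReal (∑' n, ∫ ω, |levelSum C T n ω| ∂μ)) (Eventually.of_forall fun n => ?_)
      (fun n => (aemeasurable_partialW h n).aestronglyMeasurable)
      (ae_tendsto_canonicalW hp hp2 h)).trans_lt ENNReal.ofReal_lt_top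
    have h1 : (fun ω => partialW C T n ω) = ∑ k ∈ Finset.range (n + 1), levelSum C T k := by
      ext ω; simp [partialW]
    rw [h1]
    refine (eLpNorm_sum_le (fun k _ => (hi k).aestronglyMeasurable) le_rfl).trans ?_
    have h2 : ∀ k, eLpNorm (levelSum C T k) 1 μ = ENNReal.ofReal (∫ ω, |levelSum C T k ω| ∂μ) :=
      fun k => by
        rw [eLpNorm_one_eq_lintegral_enorm]
        exact (ofReal_integral_norm_eq_lintegral_enorm (hi k)).symm
    simp only [h2]
    rw [← ENNReal.ofReal_sum_of_nonneg fun k _ => by positivity]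
    exact ENNReal.ofReal_le_ofReal (hs.sum_le_tsum _ fun k _ => by positivity)
  · rw [integral_congr_ae he, ← (hasSum_integral_of_summable_integral_norm hi hs).tsum_eq]
    simp [integral_levelSum hp hp2 h]

end

/-! ### Exponential moments and the smoothing equation. -/

/-- The exponential moment `E exp(θ X)`, as an extended nonnegative number. -/
noncomputable def expMoment {Ω : Type*} [MeasurableSpace Ω] (μ : Measure Ω) (X : Ω → ℝ) (θ : ℝ) :
    ℝ≥0∞ :=
  ∫⁻ ω, ENNReal.ofReal (Real.exp (θ * X ω)) ∂μ

lemma expMoment_zero {Ω : Type*} [MeasurableSpace Ω] (μ : Measure Ω) [IsProbabilityMeasure μ]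
    (X : Ω → ℝ) : expMoment μ X 0 = 1 := by
  simp [expMoment]

lemma expMoment_congr {Ω : Type*} [MeasurableSpace Ω] {μ : Measure Ω} {X Y : Ω → ℝ}
    (h : X =ᵐ[μ] Y) : expMoment μ X = expMoment μ Y := by
  ext θ
  refine lintegral_congr_ae ?_
  filter_upwards [h] with ω hω
  rw [hω]

lemma expMoment_map {Ω Ω' : Type*} [MeasurableSpace Ω] [MeasurableSpace Ω'] {μ : Measure Ω}
    {g : Ω → Ω'} (hg : AEMeasurable g μ) {X : Ω' → ℝ} (hX : AEMeasurable X (μ.map g)) (θ : ℝ) :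
    expMoment (μ.map g) X θ = expMoment μ (fun ω => X (g ω)) θ := by
  unfold expMoment
  rw [lintegral_map' (by fun_prop) hg]

lemma finprod_eq_prod_range {M : Type*} [CommMonoid M] {f : ℕ → M} {N : ℕ}
    (hf : ∀ k, N ≤ k → f k = 1) : ∏ᶠ k, f k = ∏ k ∈ Finset.range N, f k := by
  refine finprod_eq_prod_of_mulSupport_subset f fun k hk => ?_
  simp only [Finset.coe_range, mem_Iio]
  by_contra h
  exact hk (hf k (by omega))

section

variable {Ω : Type*} [mΩ : MeasurableSpace Ω] {μ : Measure Ω} [IsProbabilityMeasure μ]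

lemma lintegral_indep {α β : Type*} [MeasurableSpace α] [MeasurableSpace β] {Z : Ω → α} {X : Ω → β}
    (hZ : Measurable Z) (hX : Measurable X) (hind : IndepFun Z X μ) {g : α × β → ℝ≥0∞}
    (hg : Measurable g) :
    ∫⁻ ω, g (Z ω, X ω) ∂μ = ∫⁻ ω, ∫⁻ ω', g (Z ω, X ω') ∂μ ∂μ := by
  have h1 : ∫⁻ ω, g (Z ω, X ω) ∂μ = ∫⁻ q, g q ∂(μ.map fun ω => (Z ω, X ω)) :=
    (lintegral_map hg (hZ.prodMk hX)).symm
  have := Measure.isProbabilityMeasure_map (μ := μ) hX.aemeasurable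
  have := Measure.isProbabilityMeasure_map (μ := μ) hZ.aemeasurable
  rw [h1, (indepFun_iff_map_prod_eq_prod_map_map hZ.aemeasurable hX.aemeasurable).mp hind,
    lintegral_prod _ hg.aemeasurable, lintegral_map (by fun_prop) hZ]
  refine lintegral_congr fun ω => ?_
  rw [lintegral_map (by fun_prop) hX]

/-- Given (C, T), the X_k are still independent with transform Ψ, so the conditional exponential
moment factorises. -/
lemma expMoment_smoothing {C : Ω → ℝ} {T X : ℕ → Ω → ℝ} {Y : Ω → ℝ} {Ψ : ℝ → ℝ≥0∞}
    (hC : Measurable C) (hT : ∀ k, Measurable (T k)) (hX : ∀ k, Measurable (X k))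
    (hΨ : ∀ k θ, expMoment μ (X k) θ = Ψ θ) (hXi : iIndepFun X μ)
    (hind : IndepFun (fun ω => ((C ω, fun k => T k ω) : ℝ × (ℕ → ℝ))) (fun ω k => X k ω) μ)
    (hfin : ∀ᵐ ω ∂μ, ∃ N, ∀ k, N ≤ k → T k ω = 0)
    (hY : ∀ᵐ ω ∂μ, ∀ N, (∀ k, N ≤ k → T k ω = 0) →
      Y ω = C ω + ∑ k ∈ Finset.range N, T k ω * X k ω) (θ : ℝ) :
    expMoment μ Y θ = ∫⁻ ω, ENNReal.ofReal (Real.exp (θ * C ω)) * ∏ᶠ k, Ψ (θ * T k ω) ∂μ := by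
  have hΨ0 : Ψ 0 = 1 := by rw [← hΨ 0, expMoment_zero]
  -- On `A M` only the first M weights matter, and Ψ 0 = 1 makes the `finprod` an honest product
  -- over them. These sets increase to almost the whole space.
  set A : ℕ → Set Ω := fun M => {ω | ∀ k, M ≤ k → T k ω = 0} with hA
  have hAm : ∀ M, MeasurableSet (A M) := by
    intro M
    simp only [hA, ofPred_forall]
    exact MeasurableSet.iInter fun k => MeasurableSet.iInter fun _ =>
      measurableSet_eq_fun (hT k) measurable_const
  have hAmono : Monotone A := fun M M' h ω hω k hk => hω k (h.trans hk)
  have hres : μ.restrict (⋃ M, A M) = μ := by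
    refine Measure.restrict_eq_self_of_ae_mem ?_
    filter_upwards [hfin] with ω hω
    simpa [hA] using hω
  have hsup : ∀ f : Ω → ℝ≥0∞, ∫⁻ ω, f ω ∂μ = ⨆ M, ∫⁻ ω in A M, f ω ∂μ := by
    intro f
    conv_lhs => rw [← hres]
    exact setLIntegral_iUnion_of_directed f hAmono.directed_le
  unfold expMoment
  rw [hsup, hsup]
  congr 1
  ext M
  set g : (ℝ × (ℕ → ℝ)) × (ℕ → ℝ) → ℝ≥0∞ := fun q =>
    {z : ℝ × (ℕ → ℝ) | ∀ k, M ≤ k → z.2 k = 0}.indicator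
      (fun z => ENNReal.ofReal (Real.exp (θ * z.1))) q.1 *
      ∏ k ∈ Finset.range M, ENNReal.ofReal (Real.exp (θ * q.1.2 k * q.2 k)) with hg
  have hBm : MeasurableSet {z : ℝ × (ℕ → ℝ) | ∀ k, M ≤ k → z.2 k = 0} := by
    simp only [ofPred_forall]
    exact MeasurableSet.iInter fun k => MeasurableSet.iInter fun _ =>
      measurableSet_eq_fun ((measurable_pi_apply k).comp measurable_snd) measurable_const
  have hgm : Measurable g := by
    refine Measurable.mul ?_ (Finset.measurable_fun_prod _ fun k _ => by fun_prop)
    exact (Measurable.indicator (by fun_prop) hBm).comp measurable_fst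
  have key := lintegral_indep (hC.prodMk (measurable_pi_lambda _ hT)) (measurable_pi_lambda _ hX)
    hind hgm
  rw [← lintegral_indicator (hAm M), ← lintegral_indicator (hAm M)]
  convert key using 1
  · refine lintegral_congr_ae ?_
    filter_upwards [hY] with ω hω
    by_cases h : ∀ k, M ≤ k → T k ω = 0
    · have h1 : ω ∈ A M := h
      have h2 : ((C ω, fun k => T k ω) : ℝ × (ℕ → ℝ)) ∈
        {z : ℝ × (ℕ → ℝ) | ∀ k, M ≤ k → z.2 k = 0} := h
      simp only [hg]
      rw [indicator_of_mem h1, indicator_of_mem h2, hω M h,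
        ← ENNReal.ofReal_prod_of_nonneg fun _ _ => (Real.exp_pos _).le,
        ← ENNReal.ofReal_mul (Real.exp_pos _).le, ← Real.exp_sum, ← Real.exp_add, mul_add,
        Finset.mul_sum]
      simp only [mul_assoc]
    · have h1 : ω ∉ A M := h
      have h2 : ((C ω, fun k => T k ω) : ℝ × (ℕ → ℝ)) ∉
        {z : ℝ × (ℕ → ℝ) | ∀ k, M ≤ k → z.2 k = 0} := h
      simp only [hg]
      rw [indicator_of_notMem h1, indicator_of_notMem h2, zero_mul]
  · refine lintegral_congr fun ω => ?_
    simp only [hg]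
    rw [lintegral_const_mul _ (Finset.measurable_fun_prod _ fun k _ => by fun_prop)]
    by_cases h : ∀ k, M ≤ k → T k ω = 0
    · have h1 : ω ∈ A M := h
      have h2 : ((C ω, fun k => T k ω) : ℝ × (ℕ → ℝ)) ∈
        {z : ℝ × (ℕ → ℝ) | ∀ k, M ≤ k → z.2 k = 0} := h
      rw [indicator_of_mem h1, indicator_of_mem h2]
      congr 1
      rw [finprod_eq_prod_range (N := M) (fun k hk => by rw [h k hk, mul_zero, hΨ0])]
      have h3 := lintegral_prod_eq_prod_lintegral_of_indepFun (μ := μ) (Finset.range M)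
        (fun k ω' => ENNReal.ofReal (Real.exp (θ * T k ω * X k ω')))
        (hXi.comp (fun k x => ENNReal.ofReal (Real.exp (θ * T k ω * x))) (fun k => by fun_prop))
        (fun k => by fun_prop)
      rw [h3]
      exact Finset.prod_congr rfl fun k _ => (hΨ k _).symm
    · have h1 : ω ∉ A M := h
      have h2 : ((C ω, fun k => T k ω) : ℝ × (ℕ → ℝ)) ∉
        {z : ℝ × (ℕ → ℝ) | ∀ k, M ≤ k → z.2 k = 0} := h
      rw [indicator_of_notMem h1, indicator_of_notMem h2, zero_mul]

end

/-! ### Self-similarity of the tree: subtrees at the children of the root. -/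

/-- The space of realisations of a weighted Ulam-Harris tree. -/
abbrev TreeSpace : Type := List ℕ → ℝ × (ℕ → ℝ)

/-- The coordinate process `C` on the space of trees. -/
def coordC (v : List ℕ) (x : TreeSpace) : ℝ := (x v).1

/-- The coordinate process `T` on the space of trees. -/
def coordT (v : List ℕ) (k : ℕ) (x : TreeSpace) : ℝ := (x v).2 k

/-- The realisation of the whole tree. -/
def wholeTree {Ω : Type*} (C : List ℕ → Ω → ℝ) (T : List ℕ → ℕ → Ω → ℝ) (ω : Ω) : TreeSpace :=
  fun v => (C v ω, fun j => T v j ω)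

/-- The realisation of the subtree rooted at child `k` of the root. -/
def subtree {Ω : Type*} (C : List ℕ → Ω → ℝ) (T : List ℕ → ℕ → Ω → ℝ) (k : ℕ) (ω : Ω) :
    TreeSpace :=
  fun v => (C (v ++ [k]) ω, fun j => T (v ++ [k]) j ω)

lemma measurable_subtrees {Ω : Type*} [MeasurableSpace Ω] {C : List ℕ → Ω → ℝ}
    {T : List ℕ → ℕ → Ω → ℝ} (hC : ∀ v k, Measurable (C (v ++ [k])))
    (hT : ∀ v k j, Measurable (T (v ++ [k]) j)) : Measurable fun ω k => subtree C T k ω :=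
  measurable_pi_lambda _ fun k => measurable_pi_lambda _ fun v =>
    (hC v k).prodMk (measurable_pi_lambda _ (hT v k))

section

variable {Ω : Type*} [mΩ : MeasurableSpace Ω] {μ : Measure Ω} [IsProbabilityMeasure μ]
  {C : List ℕ → Ω → ℝ} {T : List ℕ → ℕ → Ω → ℝ} {p : ℝ}

lemma measurable_vertex (h : IsIIDTree μ C T) (v : List ℕ) :
    Measurable fun ω => ((C v ω, fun k => T v k ω) : ℝ × (ℕ → ℝ)) :=
  (h.measurable_C v).prodMk (measurable_pi_lambda _ (h.measurable_T v))

lemma measurable_wholeTree (h : IsIIDTree μ C T) : Measurable (wholeTree C T) :=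
  measurable_pi_lambda _ (measurable_vertex h)

lemma measurable_subtree (h : IsIIDTree μ C T) (k : ℕ) : Measurable (subtree C T k) :=
  measurable_pi_lambda _ fun v => measurable_vertex h (v ++ [k])

/-- Any injective relabelling of vertices gives an i.i.d. family with the same product law; this
yields both the law of a subtree and the independence of the subtrees. -/
lemma map_reindex (h : IsIIDTree μ C T) {ι : Type*} {e : ι → List ℕ} (he : Function.Injective e) :
    μ.map (fun ω i => ((C (e i) ω, fun k => T (e i) k ω) : ℝ × (ℕ → ℝ))) =
      Measure.infinitePi fun _ : ι => μ.map fun ω => ((C [] ω, fun k => T [] k ω) : ℝ × (ℕ → ℝ)) := by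
  have h1 : iIndepFun (fun (i : ι) ω => ((C (e i) ω, fun k => T (e i) k ω) : ℝ × (ℕ → ℝ))) μ :=
    h.indep.precomp he
  rw [(iIndepFun_iff_map_fun_eq_infinitePi_map fun i => measurable_vertex h (e i)).mp h1]
  congr 1
  ext1 i
  exact (h.ident (e i)).map_eq

lemma map_subtree (h : IsIIDTree μ C T) (k : ℕ) :
    μ.map (subtree C T k) = μ.map (wholeTree C T) := by
  have h1 := map_reindex h (e := fun v : List ℕ => v ++ [k]) (List.append_left_injective [k])
  have h2 := map_reindex h (e := fun v : List ℕ => v) Function.injective_id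
  exact h1.trans h2.symm

lemma iIndepFun_subtree (h : IsIIDTree μ C T) : iIndepFun (fun k => subtree C T k) μ := by
  rw [iIndepFun_iff_map_fun_eq_infinitePi_map (measurable_subtree h)]
  have := Measure.isProbabilityMeasure_map (μ := μ) (measurable_vertex h []).aemeasurable
  have hinj : Function.Injective fun q : ℕ × List ℕ => q.2 ++ [q.1] := by
    rintro ⟨k, v⟩ ⟨k', v'⟩ hq
    have := List.append_inj' hq rfl
    simp_all
  have h1 := map_reindex h hinj
  have h2 := Measure.infinitePi_map_curry (ι := ℕ) (κ := List ℕ)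
    fun _ _ => μ.map fun ω => ((C [] ω, fun k => T [] k ω) : ℝ × (ℕ → ℝ))
  rw [← h1, Measure.map_map (by fun_prop)
    (measurable_pi_lambda _ fun q => measurable_vertex h _)] at h2
  have h3 : ∀ k, μ.map (subtree C T k) = Measure.infinitePi fun _ : List ℕ =>
      μ.map fun ω => ((C [] ω, fun k => T [] k ω) : ℝ × (ℕ → ℝ)) := fun k =>
    map_reindex h (e := fun v : List ℕ => v ++ [k]) (List.append_left_injective [k])
  simp only [h3]
  exact h2

lemma indepFun_root_subtree (h : IsIIDTree μ C T) :
    IndepFun (fun ω => ((C [] ω, fun k => T [] k ω) : ℝ × (ℕ → ℝ)))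
      (fun ω k => subtree C T k ω) μ := by
  have hne : ∀ (v : List ℕ) (k : ℕ), v ++ [k] ≠ [] := by simp
  exact (indepFun_of_sigmaOff h [] (@measurable_subtrees Ω (sigmaOff C T []) C T
    (fun v k => measurable_sigmaOff_C (hne v k)) fun v k => measurable_sigmaOff_T (hne v k))).symm

/-- On the canonical space W becomes a functional of a realisation, which can then be evaluated on
subtrees too. -/
lemma isContractiveTree_coord (h : IsContractiveTree μ C T p) :
    IsContractiveTree (μ.map (wholeTree C T)) coordC coordT p := by
  have hm := measurable_wholeTree h.iid
  have hprob := Measure.isProbabilityMeasure_map (μ := μ) hm.aemeasurable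
  have := Measure.isProbabilityMeasure_map (μ := μ) (measurable_vertex h.iid []).aemeasurable
  have hlaw : μ.map (wholeTree C T) = Measure.infinitePi fun _ : List ℕ =>
      μ.map fun ω => ((C [] ω, fun k => T [] k ω) : ℝ × (ℕ → ℝ)) :=
    map_reindex h.iid (e := fun v : List ℕ => v) Function.injective_id
  have hCm : Measurable (coordC []) := measurable_fst.comp (measurable_pi_apply _)
  have hTm : ∀ k, Measurable (coordT [] k) := fun k =>
    (measurable_pi_apply k).comp (measurable_snd.comp (measurable_pi_apply _))
  have hT : ∀ k, ∫ x, |coordT [] k x| ^ p ∂(μ.map (wholeTree C T)) = ∫ ω, |T [] k ω| ^ p ∂μ := by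
    intro k
    exact integral_map hm.aemeasurable
      ((show Measurable (fun x : ℝ => |x| ^ p) by fun_prop).comp (hTm k)).aestronglyMeasurable
  refine ⟨⟨fun v => measurable_fst.comp (measurable_pi_apply _), fun v k =>
    (measurable_pi_apply k).comp (measurable_snd.comp (measurable_pi_apply _)), ?_, ?_⟩,
    ?_, ?_, ?_, ?_, ?_, ?_⟩
  · rw [hlaw]
    exact iIndepFun_infinitePi (X := fun _ x => x) fun _ => measurable_id
  · intro v
    refine ⟨(measurable_pi_apply v).aemeasurable, (measurable_pi_apply []).aemeasurable, ?_⟩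
    rw [hlaw]
    exact (Measure.infinitePi_map_eval (fun _ : List ℕ => μ.map fun ω =>
        ((C [] ω, fun k => T [] k ω) : ℝ × (ℕ → ℝ))) v).trans
      (Measure.infinitePi_map_eval (fun _ : List ℕ => μ.map fun ω =>
        ((C [] ω, fun k => T [] k ω) : ℝ × (ℕ → ℝ))) []).symm
  · refine (ae_map_iff hm.aemeasurable ?_).mpr h.finite
    exact measurableSet_eventually_zero.preimage
      (measurable_pi_apply ([] : List ℕ) : Measurable fun x : TreeSpace => x [])
  · rw [integral_map hm.aemeasurable hCm.aestronglyMeasurable]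
    exact h.centered
  · exact (memLp_map_measure_iff hCm.aestronglyMeasurable hm.aemeasurable).mpr h.memLp_C
  · exact fun k => (memLp_map_measure_iff (hTm k).aestronglyMeasurable hm.aemeasurable).mpr
      (h.memLp_T k)
  · simp only [hT]; exact h.summable
  · simp only [hT]; exact h.lt_one

/-- F is replaced by a measurable version. All subtrees have the law of the whole tree, so the
replacement is harmless simultaneously for every child. -/
lemma expMoment_tree (h : IsIIDTree μ C T) (hfin : ∀ᵐ ω ∂μ, ∃ N, ∀ k, N ≤ k → T [] k ω = 0)
    {F : TreeSpace → ℝ} (hF : AEMeasurable F (μ.map (wholeTree C T))) {Y : Ω → ℝ}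
    (hY : ∀ᵐ ω ∂μ, ∀ N, (∀ k, N ≤ k → T [] k ω = 0) →
      Y ω = C [] ω + ∑ k ∈ Finset.range N, T [] k ω * F (subtree C T k ω)) (θ : ℝ) :
    expMoment μ Y θ = ∫⁻ ω, ENNReal.ofReal (Real.exp (θ * C [] ω)) *
      ∏ᶠ k, expMoment μ (fun ω => F (wholeTree C T ω)) (θ * T [] k ω) ∂μ := by
  have hw := measurable_wholeTree h
  refine expMoment_smoothing (X := fun k ω => hF.mk F (subtree C T k ω))
    (h.measurable_C []) (h.measurable_T [])
    (fun k => hF.measurable_mk.comp (measurable_subtree h k)) (fun k θ => ?_)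
    ((iIndepFun_subtree h).comp (fun _ => hF.mk F) fun _ => hF.measurable_mk)
    ((indepFun_root_subtree h).comp measurable_id
      (measurable_pi_lambda _ fun k => hF.measurable_mk.comp (measurable_pi_apply k)))
    hfin ?_ θ
  · rw [← expMoment_map (measurable_subtree h k).aemeasurable hF.measurable_mk.aemeasurable,
      map_subtree h, ← expMoment_map hw.aemeasurable hF, expMoment_congr hF.ae_eq_mk]
  · have h1 : ∀ᵐ ω ∂μ, ∀ k, F (subtree C T k ω) = hF.mk F (subtree C T k ω) := by
      rw [ae_all_iff]
      intro k
      refine ae_of_ae_map (measurable_subtree h k).aemeasurable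
        (p := fun x => F x = hF.mk F x) ?_
      rw [map_subtree h]
      exact hF.ae_eq_mk
    filter_upwards [hY, h1] with ω h2 h3 N hN
    rw [h2 N hN]
    simp only [h3]

/-- Lists run from the vertex back to the root, so appending k at the end places v below child k of
the root. -/
lemma branchWeight_append (v : List ℕ) (k : ℕ) (ω : Ω) :
    branchWeight T (v ++ [k]) ω = T [] k ω * branchWeight coordT v (subtree C T k ω) := by
  induction v with
  | nil => simp [branchWeight]
  | cons j v ih =>
    simp only [List.cons_append, branchWeight, ih]
    simp only [coordT, subtree]
    ring

lemma branchWeight_wholeTree (v : List ℕ) (ω : Ω) :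
    branchWeight coordT v (wholeTree C T ω) = branchWeight T v ω := by
  induction v with
  | nil => rfl
  | cons k v ih =>
    simp only [branchWeight, ih]
    rfl

lemma partialW_wholeTree (n : ℕ) (ω : Ω) :
    partialW coordC coordT n (wholeTree C T ω) = partialW C T n ω := by
  simp only [partialW, levelSum, branchWeight_wholeTree]
  rfl

lemma canonicalW_wholeTree (ω : Ω) :
    canonicalW coordC coordT (wholeTree C T ω) = canonicalW C T ω := by
  simp only [canonicalW, partialW_wholeTree]

/-- Appending a new generation at the root. -/
def snocEquiv (n : ℕ) : ℕ × {v : List ℕ // v.length = n} ≃ {v : List ℕ // v.length = n + 1} where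
  toFun q := ⟨q.2.1 ++ [q.1], by simp [q.2.2]⟩
  invFun v := (v.1.getLast (by rintro h; have := v.2; simp [h] at this),
    ⟨v.1.dropLast, by simp [v.2]⟩)
  left_inv q := by simp
  right_inv v := Subtype.ext (List.dropLast_append_getLast _)

lemma levelSum_succ {ω : Ω} (h : ∀ v, ∃ N, ∀ k, N ≤ k → T v k ω = 0) (n : ℕ) {N : ℕ}
    (hN : ∀ k, N ≤ k → T [] k ω = 0) :
    levelSum C T (n + 1) ω =
      ∑ k ∈ Finset.range N, T [] k ω * levelSum coordC coordT n (subtree C T k ω) := by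
  have h1 := hasSum_levelSum (C := C) h (n + 1)
  rw [← (snocEquiv n).hasSum_iff] at h1
  have h2 := h1.prod_fiberwise (g := fun k =>
    T [] k ω * levelSum coordC coordT n (subtree C T k ω)) fun k => by
      have h3 := (hasSum_levelSum (C := coordC) (T := coordT) (ω := subtree C T k ω)
        (fun v => h (v ++ [k])) n).mul_left (T [] k ω)
      refine h3.congr_fun fun v => ?_
      change branchWeight T (v.1 ++ [k]) ω * C (v.1 ++ [k]) ω = _
      rw [branchWeight_append (C := C), mul_assoc]
      rfl
  refine h2.unique (hasSum_sum_of_ne_finset_zero fun k hk => ?_)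
  rw [hN k (by simpa using hk), zero_mul]

lemma levelSum_zero (ω : Ω) : levelSum C T 0 ω = C [] ω := by
  have : Unique {v : List ℕ // v.length = 0} :=
    ⟨⟨⟨[], rfl⟩⟩, fun v => Subtype.ext (List.length_eq_zero_iff.mp v.2)⟩
  have h2 : (default : {v : List ℕ // v.length = 0}).1 = [] :=
    List.length_eq_zero_iff.mp (default : {v : List ℕ // v.length = 0}).2
  rw [levelSum, tsum_fintype, Fintype.sum_unique, h2]
  simp [branchWeight]

lemma partialW_succ {ω : Ω} (h : ∀ v, ∃ N, ∀ k, N ≤ k → T v k ω = 0) (n : ℕ) {N : ℕ}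
    (hN : ∀ k, N ≤ k → T [] k ω = 0) :
    partialW C T (n + 1) ω = C [] ω +
      ∑ k ∈ Finset.range N, T [] k ω * partialW coordC coordT n (subtree C T k ω) := by
  unfold partialW
  rw [Finset.sum_range_succ' (fun k => levelSum C T k ω), levelSum_zero, add_comm]
  congr 1
  simp only [levelSum_succ h _ hN, Finset.mul_sum]
  exact Finset.sum_comm

end

/-! ### The canonical solution is the minimal solution. -/

/-- The distributional properties of the canonical solution `W` of `W = C + ∑ T_k W_k`. -/
structure IsMinimalSolution {Ω : Type*} [MeasurableSpace Ω] (μ : Measure Ω) (C : Ω → ℝ)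
    (T : ℕ → Ω → ℝ) (W : Ω → ℝ) : Prop where
  measurable_C : Measurable C
  measurable_T : ∀ k, Measurable (T k)
  integrable_C : Integrable C μ
  integral_C : ∫ ω, C ω ∂μ = 0
  integrable_W : Integrable W μ
  integral_W : ∫ ω, W ω ∂μ = 0
  not_ae_zero : ¬ W =ᵐ[μ] 0
  finite : ∀ᵐ ω ∂μ, ∃ N, ∀ k, N ≤ k → T k ω = 0
  expMoment_eq : ∀ θ, expMoment μ W θ =
    ∫⁻ ω, ENNReal.ofReal (Real.exp (θ * C ω)) * ∏ᶠ k, expMoment μ W (θ * T k ω) ∂μ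
  expMoment_le : ∀ G : ℝ → ℝ≥0∞, G 0 = 1 → (∀ θ, 1 ≤ G θ) →
    (∀ θ, ∫⁻ ω, ENNReal.ofReal (Real.exp (θ * C ω)) * ∏ᶠ k, G (θ * T k ω) ∂μ ≤ G θ) →
    ∀ θ, expMoment μ W θ ≤ G θ

section

variable {Ω : Type*} [mΩ : MeasurableSpace Ω] {μ : Measure Ω} [IsProbabilityMeasure μ]
  {C : List ℕ → Ω → ℝ} {T : List ℕ → ℕ → Ω → ℝ} {p : ℝ}

lemma ae_canonicalW_eq (hp : 1 ≤ p) (hp2 : p ≤ 2) (h : IsContractiveTree μ C T p) :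
    ∀ᵐ ω ∂μ, ∀ N, (∀ k, N ≤ k → T [] k ω = 0) → canonicalW C T ω = C [] ω +
      ∑ k ∈ Finset.range N, T [] k ω * canonicalW coordC coordT (subtree C T k ω) := by
  have hm := measurable_wholeTree h.iid
  have hprob := Measure.isProbabilityMeasure_map (μ := μ) hm.aemeasurable
  have hsub : ∀ᵐ ω ∂μ, ∀ k, Tendsto (fun n => partialW coordC coordT n (subtree C T k ω)) atTop
      (𝓝 (canonicalW coordC coordT (subtree C T k ω))) := by
    rw [ae_all_iff]
    intro k
    refine ae_of_ae_map (measurable_subtree h.iid k).aemeasurable (p := fun x =>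
      Tendsto (fun n => partialW coordC coordT n x) atTop (𝓝 (canonicalW coordC coordT x))) ?_
    rw [map_subtree h.iid]
    exact ae_tendsto_canonicalW hp hp2 (isContractiveTree_coord h)
  filter_upwards [ae_tendsto_canonicalW hp hp2 h, hsub, ae_forall_weights_eventually_zero h]
    with ω h1 h2 h3 N hN
  have h4 : Tendsto (fun n => partialW C T (n + 1) ω) atTop (𝓝 (C [] ω +
      ∑ k ∈ Finset.range N, T [] k ω * canonicalW coordC coordT (subtree C T k ω))) := by
    simp only [partialW_succ h3 _ hN]
    exact (tendsto_finsetSum _ fun k _ => (h2 k).const_mul _).const_add _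
  exact tendsto_nhds_unique (h1.comp (tendsto_add_atTop_nat 1)) h4

lemma lintegral_finprod_mono {C : Ω → ℝ} {T : ℕ → Ω → ℝ}
    (hfin : ∀ᵐ ω ∂μ, ∃ N, ∀ k, N ≤ k → T k ω = 0) {F G : ℝ → ℝ≥0∞} (hF : F 0 = 1) (hG : G 0 = 1)
    (hFG : ∀ θ, F θ ≤ G θ) (θ : ℝ) :
    ∫⁻ ω, ENNReal.ofReal (Real.exp (θ * C ω)) * ∏ᶠ k, F (θ * T k ω) ∂μ
      ≤ ∫⁻ ω, ENNReal.ofReal (Real.exp (θ * C ω)) * ∏ᶠ k, G (θ * T k ω) ∂μ := by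
  refine lintegral_mono_ae ?_
  filter_upwards [hfin] with ω ⟨N, hN⟩
  rw [finprod_eq_prod_range (N := N) (fun k hk => by rw [hN k hk, mul_zero, hF]),
    finprod_eq_prod_range (N := N) (fun k hk => by rw [hN k hk, mul_zero, hG])]
  gcongr
  exact hFG _

theorem isMinimalSolution_canonicalW (hp : 1 ≤ p) (hp2 : p ≤ 2) (h : IsContractiveTree μ C T p)
    (hC : 0 < μ {ω | C [] ω ≠ 0}) :
    IsMinimalSolution μ (C []) (T []) (canonicalW C T) := by
  have hm := measurable_wholeTree h.iid
  have hprob := Measure.isProbabilityMeasure_map (μ := μ) hm.aemeasurable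
  have hcoord := isContractiveTree_coord h
  refine ⟨h.iid.measurable_C [], h.iid.measurable_T [], h.memLp_C.integrable (by simpa using hp),
    h.centered, (integrable_canonicalW hp hp2 h).1, (integrable_canonicalW hp hp2 h).2, ?_,
    h.finite, ?_, ?_⟩
  -- If W vanished almost surely, so would its copies on the subtrees, and the recursion would leave
  -- C = 0.
  · intro h0
    have hw : ∀ᵐ x ∂(μ.map (wholeTree C T)), canonicalW coordC coordT x = 0 := by
      have hae := aemeasurable_canonicalW hp hp2 hcoord
      have h1 : ∀ᵐ x ∂(μ.map (wholeTree C T)), hae.mk _ x = 0 := by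
        refine (ae_map_iff hm.aemeasurable
          (measurableSet_eq_fun hae.measurable_mk measurable_const)).mpr ?_
        filter_upwards [ae_of_ae_map hm.aemeasurable hae.ae_eq_mk, h0] with ω h2 h3
        rw [← h2, canonicalW_wholeTree]
        exact h3
      filter_upwards [hae.ae_eq_mk, h1] with x h2 h3
      rw [h2, h3]
    have hsub : ∀ᵐ ω ∂μ, ∀ k, canonicalW coordC coordT (subtree C T k ω) = 0 := by
      rw [ae_all_iff]
      intro k
      refine ae_of_ae_map (measurable_subtree h.iid k).aemeasurable
        (p := fun x => canonicalW coordC coordT x = 0) ?_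
      rwa [map_subtree h.iid]
    refine hC.ne' ?_
    have : ∀ᵐ ω ∂μ, C [] ω = 0 := by
      filter_upwards [h0, hsub, ae_canonicalW_eq hp hp2 h, h.finite] with ω h1 h2 h3 ⟨N, hN⟩
      have := h3 N hN
      simp only [h2, mul_zero, Finset.sum_const_zero, add_zero] at this
      rw [← this]
      exact h1
    exact this
  · intro θ
    have := expMoment_tree h.iid h.finite (aemeasurable_canonicalW hp hp2 hcoord)
      (ae_canonicalW_eq hp hp2 h) θ
    simpa only [canonicalW_wholeTree] using this
  -- Induction on n bounds the transform of W_n by G: G ≥ 1 starts it, monotonicity of the smoothing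
  -- operator continues it. Fatou then passes to W.
  · intro G hG0 hG1 hG θ
    have hn : ∀ n θ, expMoment μ (fun ω => partialW C T n ω) θ ≤ G θ := by
      intro n
      induction n with
      | zero =>
        intro θ
        refine le_trans ?_ (hG θ)
        refine lintegral_mono_ae ?_
        filter_upwards [h.finite] with ω ⟨N, hN⟩
        rw [finprod_eq_prod_range (N := N) (fun k hk => by rw [hN k hk, mul_zero, hG0])]
        simp only [partialW, zero_add, Finset.range_one, Finset.sum_singleton, levelSum_zero]
        exact le_mul_of_one_le_right' (Finset.one_le_prod' fun k _ => hG1 _)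
      | succ n ih =>
        intro θ
        rw [expMoment_tree h.iid h.finite (aemeasurable_partialW hcoord n) (Y := fun ω =>
          partialW C T (n + 1) ω) ?_ θ]
        · simp only [partialW_wholeTree]
          exact (lintegral_finprod_mono h.finite (expMoment_zero μ _) hG0 ih θ).trans (hG θ)
        · filter_upwards [ae_forall_weights_eventually_zero h] with ω hω N hN
          exact partialW_succ hω n hN
    calc expMoment μ (canonicalW C T) θ
        ≤ ∫⁻ ω, liminf (fun n => ENNReal.ofReal (Real.exp (θ * partialW C T n ω))) atTop ∂μ := by
          refine lintegral_mono_ae ?_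
          filter_upwards [ae_tendsto_canonicalW hp hp2 h] with ω hω
          have h1 : Tendsto (fun n => ENNReal.ofReal (Real.exp (θ * partialW C T n ω))) atTop
              (𝓝 (ENNReal.ofReal (Real.exp (θ * canonicalW C T ω)))) :=
            (ENNReal.continuous_ofReal.comp Real.continuous_exp).continuousAt.tendsto.comp
              (hω.const_mul θ)
          exact h1.liminf_eq.ge
      _ ≤ liminf (fun n => ∫⁻ ω, ENNReal.ofReal (Real.exp (θ * partialW C T n ω)) ∂μ) atTop :=
          lintegral_liminf_le' fun n =>
            (Real.measurable_exp.comp_aemeasurable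
              ((aemeasurable_partialW h n).const_mul θ)).ennreal_ofReal
      _ ≤ G θ := by
          refine (liminf_le_liminf (v := fun _ => G θ) (Eventually.of_forall fun n => hn n θ)).trans ?_
          simp

end

/-! ### Moment generating functions of centred variables. -/

section

variable {Ω : Type*} [mΩ : MeasurableSpace Ω] {μ : Measure Ω} [IsProbabilityMeasure μ]

lemma mem_integrableExpSet_iff {X : Ω → ℝ} (hX : AEMeasurable X μ) {θ : ℝ} :
    θ ∈ integrableExpSet X μ ↔ expMoment μ X θ < ∞ := by
  have h1 : AEStronglyMeasurable (fun ω => Real.exp (θ * X ω)) μ :=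
    (Real.measurable_exp.comp_aemeasurable (hX.const_mul θ)).aestronglyMeasurable
  have h2 := hasFiniteIntegral_iff_ofReal (μ := μ) (f := fun ω => Real.exp (θ * X ω))
    (ae_of_all _ fun ω => (Real.exp_pos _).le)
  exact ⟨fun h => h2.mp h.2, fun h => ⟨h1, h2.mpr h⟩⟩

lemma expMoment_neg (X : Ω → ℝ) (θ : ℝ) :
    expMoment μ (fun ω => -X ω) θ = expMoment μ X (-θ) := by
  simp [expMoment]

lemma mem_integrableExpSet_neg {X : Ω → ℝ} {θ : ℝ} :
    θ ∈ integrableExpSet (fun ω => -X ω) μ ↔ -θ ∈ integrableExpSet X μ := by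
  simp [integrableExpSet]

lemma expMoment_eq_ofReal {X : Ω → ℝ} {θ : ℝ} (h : θ ∈ integrableExpSet X μ) :
    expMoment μ X θ = ENNReal.ofReal (∫ ω, Real.exp (θ * X ω) ∂μ) :=
  (ofReal_integral_eq_lintegral_ofReal h (ae_of_all _ fun _ => (Real.exp_pos _).le)).symm

lemma one_le_expMoment {X : Ω → ℝ} (hX : Integrable X μ) (h0 : ∫ ω, X ω ∂μ = 0) (θ : ℝ) :
    1 ≤ expMoment μ X θ := by
  rcases eq_or_lt_of_le (le_top : expMoment μ X θ ≤ ∞) with h | h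
  · simp [h]
  have h1 := (mem_integrableExpSet_iff hX.aemeasurable).mpr h
  rw [expMoment_eq_ofReal h1, ENNReal.one_le_ofReal]
  have h2 : ∫ ω, (1 + θ * X ω) ∂μ = 1 := by
    rw [integral_add (integrable_const _) (hX.const_mul θ), integral_const_mul, h0]; simp
  rw [← h2]
  exact integral_mono ((integrable_const _).add (hX.const_mul θ)) h1 fun ω => by
    have := Real.add_one_le_exp (θ * X ω); simpa [add_comm] using this

/-- The subtracted linear term has mean zero for a centred variable, so this pointwise bound makes
its exponential moment nondecreasing along rays from 0. -/
lemma exp_le_exp_mul_sub {a : ℝ} (ha : 1 ≤ a) (y : ℝ) :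
    Real.exp y ≤ Real.exp (a * y) - (a - 1) * y := by
  have h1 : Real.exp (a * y) = Real.exp y * Real.exp ((a - 1) * y) := by
    rw [← Real.exp_add]; ring_nf
  have h2 := mul_le_mul_of_nonneg_left (Real.add_one_le_exp ((a - 1) * y)) (Real.exp_pos y).le
  have h3 : 0 ≤ y * (Real.exp y - 1) := by
    rcases le_total 0 y with hy | hy
    · exact mul_nonneg hy (by linarith [Real.one_le_exp hy])
    · exact mul_nonneg_of_nonpos_of_nonpos hy (by linarith [Real.exp_le_one_iff.mpr hy])
  have h4 : 0 ≤ (a - 1) * (y * (Real.exp y - 1)) := mul_nonneg (by linarith) h3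
  rw [h1]
  nlinarith

lemma expMoment_le_scale {X : Ω → ℝ} (hX : Integrable X μ) (h0 : ∫ ω, X ω ∂μ = 0) {a : ℝ}
    (ha : 1 ≤ a) (θ : ℝ) : expMoment μ X θ ≤ expMoment μ X (a * θ) := by
  rcases eq_or_lt_of_le (le_top : expMoment μ X (a * θ) ≤ ∞) with h | h
  · simp [h]
  have h1 : Integrable (fun ω => Real.exp (a * θ * X ω)) μ :=
    (mem_integrableExpSet_iff hX.aemeasurable).mpr h
  have h2 : Integrable (fun ω => Real.exp (a * θ * X ω) - (a - 1) * (θ * X ω)) μ :=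
    h1.sub ((hX.const_mul θ).const_mul _)
  have hle : ∀ ω, Real.exp (θ * X ω) ≤ Real.exp (a * θ * X ω) - (a - 1) * (θ * X ω) := fun ω => by
    simpa [mul_assoc] using exp_le_exp_mul_sub ha (θ * X ω)
  have hm : AEStronglyMeasurable (fun ω => Real.exp (θ * X ω)) μ :=
    (Real.measurable_exp.comp_aemeasurable (hX.aemeasurable.const_mul θ)).aestronglyMeasurable
  have h3 : θ ∈ integrableExpSet X μ := h2.mono' hm (ae_of_all _ fun ω => by
    rw [Real.norm_eq_abs, abs_of_pos (Real.exp_pos _)]; exact hle ω)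
  rw [expMoment_eq_ofReal h3, expMoment_eq_ofReal (θ := a * θ) h1]
  refine ENNReal.ofReal_le_ofReal ((integral_mono h3 h2 hle).trans_eq ?_)
  rw [integral_sub h1 ((hX.const_mul θ).const_mul _), integral_const_mul, integral_const_mul, h0]
  simp

lemma measurable_expMoment {X : Ω → ℝ} (hX : AEMeasurable X μ) : Measurable (expMoment μ X) := by
  rw [expMoment_congr hX.ae_eq_mk]
  refine Measurable.lintegral_prod_right'
    (f := fun q : ℝ × Ω => ENNReal.ofReal (Real.exp (q.1 * hX.mk X q.2))) ?_
  have := hX.measurable_mk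
  fun_prop

lemma mul_exp_le_expMoment {X : Ω → ℝ} (hX : AEMeasurable X μ) {θ y : ℝ} :
    μ {ω | y ≤ θ * X ω} * ENNReal.ofReal (Real.exp y) ≤ expMoment μ X θ := by
  have h := mul_meas_ge_le_lintegral₀ (μ := μ) (f := fun ω => ENNReal.ofReal (Real.exp (θ * X ω)))
    (Real.measurable_exp.comp_aemeasurable (hX.const_mul θ)).ennreal_ofReal
    (ENNReal.ofReal (Real.exp y))
  rw [mul_comm]
  refine le_trans ?_ h
  gcongr with ω
  intro hy
  exact ENNReal.ofReal_le_ofReal (Real.exp_le_exp.mpr hy)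

lemma beta_eq_zero_iff {T : ℕ → Ω → ℝ} : beta μ T = 0 ↔ ∀ᵐ ω ∂μ, ∀ k, 0 ≤ T k ω := by
  unfold beta
  rw [ENNReal.essSup_eq_zero_iff]
  refine eventually_congr (ae_of_all _ fun ω => ?_)
  simp

lemma exists_weight_neg {T : ℕ → Ω → ℝ} (h : 0 < beta μ T) : ∃ k, 0 < μ {ω | T k ω < 0} := by
  by_contra! hc
  refine h.ne' (beta_eq_zero_iff.mpr ?_)
  rw [ae_all_iff]
  intro k
  have := hc k
  simp only [nonpos_iff_eq_zero] at this
  simpa [ae_iff] using this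

lemma powerSum_eq_sum {T : ℕ → Ω → ℝ} {α : ℝ} (hα : 0 < α) {ω : Ω} {N : ℕ}
    (hN : ∀ k, N ≤ k → T k ω = 0) : powerSum T α ω = ∑ k ∈ Finset.range N, |T k ω| ^ α := by
  refine tsum_eq_sum fun k hk => ?_
  rw [hN k (by simpa using hk), abs_zero, Real.zero_rpow hα.ne']

end

/-! ### Scaling of Ψ and one-sided boundedness of W. -/

namespace IsMinimalSolution

variable {Ω : Type*} [mΩ : MeasurableSpace Ω] {μ : Measure Ω} [IsProbabilityMeasure μ]
  {C : Ω → ℝ} {T : ℕ → Ω → ℝ} {W : Ω → ℝ}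

/-- Reflection (C, W) ↦ (-C, -W) exchanges the two half-lines of θ, so one-sided statements need
only one proof. -/
lemma neg (h : IsMinimalSolution μ C T W) :
    IsMinimalSolution μ (fun ω => -C ω) T (fun ω => -W ω) where
  measurable_C := h.measurable_C.neg
  measurable_T := h.measurable_T
  integrable_C := h.integrable_C.neg
  integral_C := by rw [integral_neg, h.integral_C, neg_zero]
  integrable_W := h.integrable_W.neg
  integral_W := by rw [integral_neg, h.integral_W, neg_zero]
  not_ae_zero h0 := h.not_ae_zero (h0.mono fun ω hω => by simpa using hω)
  finite := h.finite
  expMoment_eq θ := by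
    simp only [expMoment_neg]
    rw [h.expMoment_eq (-θ)]
    simp
  expMoment_le G hG0 hG1 hG θ := by
    rw [expMoment_neg]
    have := h.expMoment_le (fun t => G (-t)) (by simpa using hG0) (fun t => hG1 _)
      (fun t => by simpa using hG (-t)) (-θ)
    simpa using this

lemma one_le (h : IsMinimalSolution μ C T W) (θ : ℝ) : 1 ≤ expMoment μ W θ :=
  one_le_expMoment h.integrable_W h.integral_W θ

lemma mem_iff (h : IsMinimalSolution μ C T W) {θ : ℝ} :
    θ ∈ integrableExpSet W μ ↔ expMoment μ W θ < ∞ :=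
  mem_integrableExpSet_iff h.integrable_W.aemeasurable

lemma finprod_eq (_h : IsMinimalSolution μ C T W) (θ : ℝ) {ω : Ω} {N : ℕ}
    (hN : ∀ k, N ≤ k → T k ω = 0) : ∏ᶠ k, expMoment μ W (θ * T k ω) =
      ∏ k ∈ Finset.range N, expMoment μ W (θ * T k ω) :=
  finprod_eq_prod_range fun k hk => by rw [hN k hk, mul_zero, expMoment_zero]

lemma expMoment_C_le (h : IsMinimalSolution μ C T W) (θ : ℝ) :
    expMoment μ C θ ≤ expMoment μ W θ := by
  rw [h.expMoment_eq θ]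
  refine lintegral_mono_ae ?_
  filter_upwards [h.finite] with ω ⟨N, hN⟩
  rw [h.finprod_eq θ hN]
  exact le_mul_of_one_le_right' (Finset.one_le_prod' fun k _ => h.one_le _)

lemma integrableExpSet_subset (h : IsMinimalSolution μ C T W) :
    integrableExpSet W μ ⊆ integrableExpSet C μ := fun θ hθ =>
  (mem_integrableExpSet_iff h.measurable_C.aemeasurable).mpr
    ((h.expMoment_C_le θ).trans_lt (h.mem_iff.mp hθ))

lemma lintegral_single_le (h : IsMinimalSolution μ C T W) (θ : ℝ) (k : ℕ) :
    ∫⁻ ω, ENNReal.ofReal (Real.exp (θ * C ω)) * expMoment μ W (θ * T k ω) ∂μ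
      ≤ expMoment μ W θ := by
  rw [h.expMoment_eq θ]
  refine lintegral_mono_ae ?_
  filter_upwards [h.finite] with ω ⟨N, hN⟩
  rw [h.finprod_eq θ (N := max N (k + 1)) fun j hj => hN j ((le_max_left _ _).trans hj)]
  gcongr
  exact Finset.single_le_prod' (f := fun k => expMoment μ W (θ * T k ω)) (fun j _ => h.one_le _)
    (Finset.mem_range.mpr (lt_of_lt_of_le (Nat.lt_succ_self k) (le_max_right _ _)))

/-- Finiteness of E[e^{θC} Ψ(θT_k)] makes Ψ(θT_k) finite almost surely; an outcome with T_k < 0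
supplies the witness. -/
lemma exists_opposite_sign (h : IsMinimalSolution μ C T W) {θ : ℝ} (hθ0 : θ ≠ 0)
    (hθ : expMoment μ W θ < ∞) {k : ℕ} (hk : 0 < μ {ω | T k ω < 0}) :
    ∃ t, t * θ < 0 ∧ expMoment μ W t < ∞ := by
  have hm := measurable_expMoment h.integrable_W.aemeasurable
  have hC := h.measurable_C
  have hT := h.measurable_T k
  have h1 := ae_lt_top (μ := μ) (by fun_prop) ((h.lintegral_single_le θ k).trans_lt hθ).ne
  obtain ⟨ω, hω1, hω2⟩ := (Frequently.and_eventually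
    (frequently_ae_iff.mpr hk.ne') h1).exists
  refine ⟨θ * T k ω, ?_, ?_⟩
  · have : 0 < θ ^ 2 := by positivity
    nlinarith
  · by_contra hc
    rw [not_lt, top_le_iff] at hc
    rw [hc, ENNReal.mul_top (by simp [Real.exp_pos])] at hω2
    exact lt_irrefl _ hω2

/-- The expectation is restricted to the event a ≤ σT_k, |C| ≤ n, of positive probability q for some
n. There e^{θC} ≥ e^{-n|θ|}, and monotonicity of Ψ along rays replaces T_k by σa. -/
lemma exists_scaling (h : IsMinimalSolution μ C T W) {σ a : ℝ} (hσ : σ = 1 ∨ σ = -1) (ha : 1 < a)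
    {k : ℕ} (hk : 0 < μ {ω | a ≤ σ * T k ω}) :
    ∃ q : ℝ≥0∞, q ≠ 0 ∧ ∃ K : ℝ, 0 ≤ K ∧ ∀ θ,
      q * ENNReal.ofReal (Real.exp (-(K * |θ|))) * expMoment μ W (σ * a * θ)
        ≤ expMoment μ W θ := by
  have hC := h.measurable_C
  have hT := h.measurable_T k
  obtain ⟨n, hn⟩ : ∃ n : ℕ, 0 < μ ({ω | a ≤ σ * T k ω} ∩ {ω | |C ω| ≤ n}) := by
    by_contra! hc
    refine hk.ne' (measure_mono_null (t := ⋃ n : ℕ, {ω | a ≤ σ * T k ω} ∩ {ω | |C ω| ≤ n}) ?_ ?_)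
    · intro ω hω
      obtain ⟨n, hn⟩ := exists_nat_ge |C ω|
      exact mem_iUnion.mpr ⟨n, hω, hn⟩
    · exact measure_iUnion_null fun n => nonpos_iff_eq_zero.mp (hc n)
  refine ⟨_, hn.ne', n, by positivity, fun θ => ?_⟩
  refine le_trans ?_ (h.lintegral_single_le θ k)
  have hmeas : MeasurableSet ({ω | a ≤ σ * T k ω} ∩ {ω | |C ω| ≤ n}) :=
    (measurableSet_le measurable_const (by fun_prop)).inter
      (measurableSet_le (by fun_prop) measurable_const)
  refine le_trans ?_ (setLIntegral_le_lintegral ({ω | a ≤ σ * T k ω} ∩ {ω | |C ω| ≤ n}) _)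
  have h1 := setLIntegral_mono_ae' (μ := μ) (s := {ω | a ≤ σ * T k ω} ∩ {ω | |C ω| ≤ n})
    (f := fun _ => ENNReal.ofReal (Real.exp (-(n * |θ|))) * expMoment μ W (σ * a * θ))
    (g := fun ω => ENNReal.ofReal (Real.exp (θ * C ω)) * expMoment μ W (θ * T k ω)) hmeas
    (ae_of_all _ fun ω hω => ?_)
  · rw [setLIntegral_const] at h1
    calc _ = _ := by ring
      _ ≤ _ := h1
  · obtain ⟨hω1, hω2⟩ := hω
    simp only [mem_ofPred_eq] at hω1 hω2
    gcongr
    · have h2 : |θ * C ω| ≤ n * |θ| := by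
        rw [abs_mul, mul_comm]; gcongr
      exact (abs_le.mp h2).1
    · have h3 : θ * T k ω = (σ * T k ω / a) * (σ * a * θ) := by
        have : σ * σ = 1 := by rcases hσ with rfl | rfl <;> norm_num
        field_simp
        linear_combination (-(θ * T k ω)) * this
      rw [h3]
      exact expMoment_le_scale h.integrable_W h.integral_W
        ((one_le_div (by linarith)).mpr hω1) _

lemma tendsto_pow_mul_exp {q a θ : ℝ} (hq : 0 < q) (ha : 1 < a) (hθ : 0 < θ) :
    Tendsto (fun n : ℕ => q ^ n * Real.exp (θ * a ^ n)) atTop atTop := by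
  -- The j-th term of the exponential series already contributes (a^j)^n, which beats q^{-n} once q
  -- a^j ≥ 2.
  obtain ⟨j, hj⟩ := pow_unbounded_of_one_lt (2 / q) ha
  have hj' : 2 ≤ q * a ^ j := by
    rw [div_lt_iff₀ hq] at hj; linarith
  have h1 : ∀ n : ℕ, θ ^ j / (j.factorial : ℝ) * 2 ^ n ≤ q ^ n * Real.exp (θ * a ^ n) := by
    intro n
    have ha0 : 0 < a := by linarith
    have h2 := Real.pow_div_factorial_le_exp (θ * a ^ n) (by positivity) j
    calc θ ^ j / (j.factorial : ℝ) * 2 ^ n ≤ θ ^ j / (j.factorial : ℝ) * (q * a ^ j) ^ n := by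
          gcongr
      _ = q ^ n * ((θ * a ^ n) ^ j / (j.factorial : ℝ)) := by
          rw [mul_pow, mul_pow, ← pow_mul, ← pow_mul, mul_comm j n]; ring
      _ ≤ _ := by gcongr
  refine tendsto_atTop_mono h1 ?_
  exact (tendsto_pow_atTop_atTop_of_one_lt (by norm_num)).const_mul_atTop (by positivity)

/-- Iteration bounds Ψ(θaⁿ) by q^{-n} e^{K'θaⁿ} Ψ(θ). Mass of W beyond K' + 1 would make it grow
faster, by Chernoff. -/
lemma bddAbove_of_scaling (h : IsMinimalSolution μ C T W) {a : ℝ} (ha : 1 < a) {q : ℝ≥0∞}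
    (hq : q ≠ 0) {K : ℝ} (hK : 0 ≤ K) (hs : ∀ θ, q * ENNReal.ofReal (Real.exp (-(K * |θ|))) *
      expMoment μ W (a * θ) ≤ expMoment μ W θ) {θ : ℝ} (hθ0 : 0 < θ)
    (hθ : expMoment μ W θ < ∞) : ∃ B : ℝ, ∀ᵐ ω ∂μ, W ω ≤ B := by
  have ha0 : 0 < a := by linarith
  have ha1 : 0 < a - 1 := by linarith
  -- Chosen to solve K' + K = K'a, so that the induction on n closes.
  set K' := K / (a - 1) with hK'
  have hKa : K' + K = K' * a := by rw [hK']; field_simp; ring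
  have hiter : ∀ n : ℕ, q ^ n * ENNReal.ofReal (Real.exp (-(K' * (θ * a ^ n)))) *
      expMoment μ W (θ * a ^ n) ≤ expMoment μ W θ := by
    intro n
    induction n with
    | zero =>
      simp only [pow_zero, one_mul, mul_one]
      refine mul_le_of_le_one_left' ?_
      rw [ENNReal.ofReal_le_one, Real.exp_le_one_iff, neg_nonpos]
      positivity
    | succ n ih =>
      refine le_trans ?_ ih
      have h1 := hs (θ * a ^ n)
      rw [abs_of_pos (by positivity)] at h1
      have h2 : ENNReal.ofReal (Real.exp (-(K' * (θ * a ^ (n + 1))))) =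
          ENNReal.ofReal (Real.exp (-(K' * (θ * a ^ n)))) *
            ENNReal.ofReal (Real.exp (-(K * (θ * a ^ n)))) := by
        rw [← ENNReal.ofReal_mul (Real.exp_pos _).le, ← Real.exp_add]
        congr 2
        rw [pow_succ]
        linear_combination (θ * a ^ n) * hKa
      have h3 : θ * a ^ (n + 1) = a * (θ * a ^ n) := by ring
      calc _ = q ^ n * ENNReal.ofReal (Real.exp (-(K' * (θ * a ^ n)))) *
            (q * ENNReal.ofReal (Real.exp (-(K * (θ * a ^ n)))) *
              expMoment μ W (a * (θ * a ^ n))) := by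
            rw [h2, h3, pow_succ q]; ring
        _ ≤ _ := by gcongr
  have hqtop : q ≠ ∞ := by
    rintro rfl
    have := hs θ
    rw [ENNReal.top_mul (by simp [Real.exp_pos]), ENNReal.top_mul
      (one_pos.trans_le (h.one_le _)).ne'] at this
    exact absurd (this.trans_lt hθ) (lt_irrefl _)
  have hq' : 0 < q.toReal := ENNReal.toReal_pos hq hqtop
  -- The excess 1 over K' leaves a factor e^{θaⁿ}, which overwhelms the loss qⁿ.
  refine ⟨K' + 1, ?_⟩
  set m := μ {ω | K' + 1 ≤ W ω} with hm
  have hmn : ∀ n : ℕ, ENNReal.ofReal (q.toReal ^ n * Real.exp (θ * a ^ n)) * m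
      ≤ expMoment μ W θ := by
    intro n
    refine le_trans ?_ (hiter n)
    have hpos : 0 < θ * a ^ n := by positivity
    have h1 := mul_exp_le_expMoment (μ := μ) h.integrable_W.aemeasurable (θ := θ * a ^ n)
      (y := θ * a ^ n * (K' + 1))
    have h2 : {ω | θ * a ^ n * (K' + 1) ≤ θ * a ^ n * W ω} = {ω | K' + 1 ≤ W ω} := by
      ext ω
      exact mul_le_mul_iff_right₀ hpos
    rw [h2, ← hm] at h1
    have h3 : Real.exp (θ * a ^ n) =
        Real.exp (-(K' * (θ * a ^ n))) * Real.exp (θ * a ^ n * (K' + 1)) := by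
      rw [← Real.exp_add]; congr 1; ring
    calc _ = q ^ n * ENNReal.ofReal (Real.exp (-(K' * (θ * a ^ n)))) *
          (m * ENNReal.ofReal (Real.exp (θ * a ^ n * (K' + 1)))) := by
          rw [h3, ENNReal.ofReal_mul (by positivity), ENNReal.ofReal_mul (by positivity),
            ENNReal.ofReal_pow ENNReal.toReal_nonneg, ENNReal.ofReal_toReal hqtop]
          ring
      _ ≤ _ := by gcongr
  have hm0 : m = 0 := by
    by_contra hne
    have hlim : Tendsto (fun n : ℕ => ENNReal.ofReal (q.toReal ^ n * Real.exp (θ * a ^ n)) * m)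
        atTop (𝓝 ∞) := by
      have := ENNReal.Tendsto.mul_const (b := m)
        (ENNReal.tendsto_ofReal_atTop.comp (tendsto_pow_mul_exp hq' ha hθ0)) (Or.inl (by simp))
      rwa [ENNReal.top_mul hne] at this
    exact absurd ((le_of_tendsto' hlim hmn).trans_lt hθ) (lt_irrefl _)
  have : ∀ᵐ ω ∂μ, ¬ (K' + 1 ≤ W ω) := by
    rw [ae_iff]; simpa using hm0
  filter_upwards [this] with ω hω
  exact (not_le.mp hω).le

end IsMinimalSolution

/-! ### Essential bounds of W and invariant half-lines. -/

namespace IsMinimalSolution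

variable {Ω : Type*} [mΩ : MeasurableSpace Ω] {μ : Measure Ω} [IsProbabilityMeasure μ]
  {C : Ω → ℝ} {T : ℕ → Ω → ℝ} {W : Ω → ℝ}

lemma nonneg_of_ae_le (h : IsMinimalSolution μ C T W) {x : ℝ} (hx : ∀ᵐ ω ∂μ, W ω ≤ x) : 0 ≤ x := by
  have := integral_mono_ae h.integrable_W (integrable_const x) hx
  simpa [h.integral_W] using this

lemma pos_of_ae_le (h : IsMinimalSolution μ C T W) {x : ℝ} (hx : ∀ᵐ ω ∂μ, W ω ≤ x) : 0 < x := by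
  refine lt_of_le_of_ne (h.nonneg_of_ae_le hx) fun h0 => h.not_ae_zero ?_
  have h1 : 0 ≤ᵐ[μ] fun ω => -W ω := by
    filter_upwards [hx] with ω hω
    simp only [Pi.zero_apply]; linarith
  have h2 := (integral_eq_zero_iff_of_nonneg_ae h1 h.integrable_W.neg).mp h.neg.integral_W
  filter_upwards [h2] with ω hω
  simpa using hω

lemma exists_ess_bound (h : IsMinimalSolution μ C T W) {B : ℝ} (hB : ∀ᵐ ω ∂μ, W ω ≤ B) :
    ∃ s, 0 < s ∧ (∀ᵐ ω ∂μ, W ω ≤ s) ∧ ∀ x < s, μ {ω | x ≤ W ω} ≠ 0 := by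
  set S := {x : ℝ | ∀ᵐ ω ∂μ, W ω ≤ x} with hS
  have hne : S.Nonempty := ⟨B, hB⟩
  have hbdd : BddBelow S := ⟨0, fun x hx => h.nonneg_of_ae_le hx⟩
  have hs : ∀ᵐ ω ∂μ, W ω ≤ sInf S := by
    have h1 : ∀ n : ℕ, ∀ᵐ ω ∂μ, W ω ≤ sInf S + 1 / ((n : ℝ) + 1) := by
      intro n
      obtain ⟨x, hx, hlt⟩ := exists_lt_of_csInf_lt hne
        (lt_add_of_pos_right (sInf S) (Nat.one_div_pos_of_nat (α := ℝ) (n := n)))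
      filter_upwards [hx] with ω hω using hω.trans hlt.le
    filter_upwards [ae_all_iff.mpr h1] with ω hω
    have h2 : Tendsto (fun n : ℕ => sInf S + 1 / ((n : ℝ) + 1)) atTop (𝓝 (sInf S + 0)) :=
      tendsto_one_div_add_atTop_nhds_zero_nat.const_add _
    rw [add_zero] at h2
    exact ge_of_tendsto' h2 hω
  refine ⟨sInf S, h.pos_of_ae_le hs, hs, fun x hx h0 => ?_⟩
  have h1 : x ∈ S := by
    have : ∀ᵐ ω ∂μ, ¬ x ≤ W ω := by rw [ae_iff]; simpa using h0
    filter_upwards [this] with ω hω using (not_le.mp hω).le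
  exact absurd (csInf_le hbdd h1) (not_le.mpr hx)

lemma measure_le_ne_zero (h : IsMinimalSolution μ C T W) {δ : ℝ} (hδ : 0 < δ) :
    μ {ω | W ω ≤ δ} ≠ 0 := by
  intro h0
  have : ∀ᵐ ω ∂μ, -W ω ≤ -δ := by
    have : ∀ᵐ ω ∂μ, ¬ W ω ≤ δ := by rw [ae_iff]; simpa using h0
    filter_upwards [this] with ω hω using neg_le_neg (not_le.mp hω).le
  have := h.neg.nonneg_of_ae_le this
  linarith

lemma expMoment_le_exp {X : Ω → ℝ} {s θ : ℝ} (hX : ∀ᵐ ω ∂μ, X ω ≤ s) (hθ : 0 ≤ θ) :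
    expMoment μ X θ ≤ ENNReal.ofReal (Real.exp (θ * s)) := by
  have h1 : expMoment μ X θ ≤ ∫⁻ _, ENNReal.ofReal (Real.exp (θ * s)) ∂μ := by
    refine lintegral_mono_ae ?_
    filter_upwards [hX] with ω hω
    gcongr
  simpa using h1

/-- In the recursion each W_k can be close to s or to i with positive probability, independently, so
W ≤ s constrains the worst combination. The argument uses only transforms, with θ = n → ∞. The
number i need not be a lower bound for W. -/
lemma ae_sum_le (h : IsMinimalSolution μ C T W) {s i : ℝ} (hs : ∀ᵐ ω ∂μ, W ω ≤ s)
    (hs' : ∀ x < s, μ {ω | x ≤ W ω} ≠ 0) (hi : ∀ x > i, μ {ω | W ω ≤ x} ≠ 0) :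
    ∀ᵐ ω ∂μ, ∀ N, (∀ k, N ≤ k → T k ω = 0) →
      C ω + ∑ k ∈ Finset.range N, (max (T k ω) 0 * s + min (T k ω) 0 * i) ≤ s := by
  have hWm := h.integrable_W.aemeasurable
  have hlow : ∀ δ > 0, ∃ q : ℝ≥0∞, q ≠ 0 ∧ ∀ θ, 0 ≤ θ → ∀ t, q * ENNReal.ofReal (Real.exp
      (θ * (max t 0 * (s - δ) + min t 0 * (i + δ)))) ≤ expMoment μ W (θ * t) := by
    intro δ hδ
    -- W lies near s, or below i + δ, with probability at least q; Chernoff turns this into a lower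
    -- bound for Ψ(θt) valid for both signs of t.
    refine ⟨min (μ {ω | s - δ ≤ W ω}) (μ {ω | W ω ≤ i + δ}), ?_, fun θ hθ t => ?_⟩
    · have h1 := pos_iff_ne_zero.mpr (hs' (s - δ) (by linarith))
      have h2 := pos_iff_ne_zero.mpr (hi (i + δ) (by linarith))
      exact (lt_min h1 h2).ne'
    · refine le_trans ?_ (mul_exp_le_expMoment hWm
        (y := θ * (max t 0 * (s - δ) + min t 0 * (i + δ))))
      gcongr
      rcases le_total 0 t with ht | ht
      · refine (min_le_left _ _).trans (measure_mono fun ω hω => ?_)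
        simp only [mem_ofPred_eq, max_eq_left ht, min_eq_right ht] at hω ⊢
        have := mul_le_mul_of_nonneg_left hω (mul_nonneg hθ ht)
        linarith
      · refine (min_le_right _ _).trans (measure_mono fun ω hω => ?_)
        simp only [mem_ofPred_eq, max_eq_right ht, min_eq_left ht] at hω ⊢
        have := mul_le_mul_of_nonpos_left hω (mul_nonpos_of_nonneg_of_nonpos hθ ht)
        linarith
  have key : ∀ N : ℕ, ∀ δ > 0, ∀ᵐ ω ∂μ, (∀ k, N ≤ k → T k ω = 0) → C ω + ∑ k ∈ Finset.range N,
      (max (T k ω) 0 * (s - δ) + min (T k ω) 0 * (i + δ)) < s + δ := by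
    intro N δ hδ
    obtain ⟨q, hq, hlow⟩ := hlow δ hδ
    have hT := h.measurable_T
    have hC := h.measurable_C
    set E : Set Ω := {ω | ∀ k, N ≤ k → T k ω = 0} ∩ {ω | s + δ ≤ C ω + ∑ k ∈ Finset.range N,
      (max (T k ω) 0 * (s - δ) + min (T k ω) 0 * (i + δ))} with hE
    have hEm : MeasurableSet E := by
      refine MeasurableSet.inter ?_ (measurableSet_le measurable_const (by fun_prop))
      simp only [ofPred_forall]
      exact MeasurableSet.iInter fun k => MeasurableSet.iInter fun _ =>
        measurableSet_eq_fun (hT k) measurable_const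
    -- The left side of the equation is at most e^{ns}, while E contributes at least q^N μ(E)
    -- e^{n(s+δ)}; n → ∞ forces μ(E) = 0.
    have hb : ∀ n : ℕ, q ^ N * μ E * ENNReal.ofReal (Real.exp (n * δ)) ≤ 1 := by
      intro n
      have h1 : q ^ N * ENNReal.ofReal (Real.exp (n * (s + δ))) * μ E ≤ expMoment μ W n := by
        rw [h.expMoment_eq n, ← setLIntegral_const]
        refine le_trans (setLIntegral_mono_ae' hEm (ae_of_all _ fun ω hω => ?_))
          (setLIntegral_le_lintegral E _)
        rw [h.finprod_eq _ hω.1]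
        have h2 : ∏ k ∈ Finset.range N, (q * ENNReal.ofReal (Real.exp (n *
            (max (T k ω) 0 * (s - δ) + min (T k ω) 0 * (i + δ)))))
            ≤ ∏ k ∈ Finset.range N, expMoment μ W (n * T k ω) :=
          Finset.prod_le_prod' fun k _ => hlow n (by positivity) (T k ω)
        rw [Finset.prod_mul_distrib, Finset.prod_const, Finset.card_range,
          ← ENNReal.ofReal_prod_of_nonneg fun _ _ => (Real.exp_pos _).le, ← Real.exp_sum,
          ← Finset.mul_sum] at h2
        calc q ^ N * ENNReal.ofReal (Real.exp (n * (s + δ)))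
            ≤ q ^ N * ENNReal.ofReal (Real.exp (n * C ω + n * ∑ k ∈ Finset.range N,
              (max (T k ω) 0 * (s - δ) + min (T k ω) 0 * (i + δ)))) := by
              rw [← mul_add]
              exact mul_le_mul' le_rfl (ENNReal.ofReal_le_ofReal (Real.exp_le_exp.mpr
                (mul_le_mul_of_nonneg_left hω.2 (Nat.cast_nonneg n))))
          _ = ENNReal.ofReal (Real.exp (n * C ω)) * (q ^ N * ENNReal.ofReal (Real.exp
              (n * ∑ k ∈ Finset.range N,
              (max (T k ω) 0 * (s - δ) + min (T k ω) 0 * (i + δ))))) := by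
              rw [Real.exp_add, ENNReal.ofReal_mul (Real.exp_pos _).le]; ring
          _ ≤ _ := by gcongr
      have h3 := h1.trans (expMoment_le_exp hs (Nat.cast_nonneg n))
      have h4 : ENNReal.ofReal (Real.exp (n * (s + δ))) =
          ENNReal.ofReal (Real.exp (n * δ)) * ENNReal.ofReal (Real.exp (n * s)) := by
        rw [← ENNReal.ofReal_mul (Real.exp_pos _).le, ← Real.exp_add]; congr 2; ring
      have h5 : ENNReal.ofReal (Real.exp (n * s)) ≠ 0 := by simp [Real.exp_pos]
      rw [← ENNReal.mul_le_mul_iff_left h5 ENNReal.ofReal_ne_top, one_mul]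
      refine le_trans (le_of_eq ?_) h3
      rw [h4]; ring
    have hE0 : μ E = 0 := by
      by_contra hne
      have hlim : Tendsto (fun n : ℕ => q ^ N * μ E * ENNReal.ofReal (Real.exp (n * δ))) atTop
          (𝓝 ∞) := by
        have := ENNReal.Tendsto.const_mul (a := q ^ N * μ E)
          (ENNReal.tendsto_ofReal_atTop.comp (Real.tendsto_exp_atTop.comp
            (tendsto_natCast_atTop_atTop.atTop_mul_const hδ))) (Or.inl (by simp))
        rwa [ENNReal.mul_top (mul_ne_zero (pow_ne_zero _ hq) hne)] at this
      exact absurd ((le_of_tendsto' hlim hb).trans_lt ENNReal.one_lt_top) (lt_irrefl _)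
    have : ∀ᵐ ω ∂μ, ω ∉ E := by rw [ae_iff]; simpa using hE0
    filter_upwards [this] with ω hω hN
    by_contra hc
    exact hω ⟨hN, not_lt.mp hc⟩
  have key' : ∀ᵐ ω ∂μ, ∀ N n : ℕ, (∀ k, N ≤ k → T k ω = 0) → C ω + ∑ k ∈ Finset.range N,
      (max (T k ω) 0 * (s - 1 / ((n : ℝ) + 1)) + min (T k ω) 0 * (i + 1 / ((n : ℝ) + 1)))
        < s + 1 / ((n : ℝ) + 1) := by
    rw [ae_all_iff]; intro N
    rw [ae_all_iff]; intro n
    exact key N _ Nat.one_div_pos_of_nat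
  filter_upwards [key'] with ω hω N hN
  have hd : Tendsto (fun n : ℕ => 1 / ((n : ℝ) + 1)) atTop (𝓝 0) :=
    tendsto_one_div_add_atTop_nhds_zero_nat
  have h1 : Tendsto (fun n : ℕ => C ω + ∑ k ∈ Finset.range N,
      (max (T k ω) 0 * (s - 1 / ((n : ℝ) + 1)) + min (T k ω) 0 * (i + 1 / ((n : ℝ) + 1)))) atTop
      (𝓝 (C ω + ∑ k ∈ Finset.range N, (max (T k ω) 0 * (s - 0) + min (T k ω) 0 * (i + 0)))) :=
    (tendsto_finsetSum _ fun k _ =>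
      ((hd.const_sub s).const_mul _).add ((hd.const_add i).const_mul _)).const_add _
  have h2 : Tendsto (fun n : ℕ => s + 1 / ((n : ℝ) + 1)) atTop (𝓝 (s + 0)) := hd.const_add s
  have := le_of_tendsto_of_tendsto' h1 h2 fun n => (hω N n hN).le
  simpa using this

/-- The extremal inequalities for W and -W are added: C cancels and Σ_1 (s + i) ≤ s + i remains,
with s and i positive. -/
lemma weightsLeOne_of_bounded (h : IsMinimalSolution μ C T W) {A B : ℝ}
    (hA : ∀ᵐ ω ∂μ, A ≤ W ω) (hB : ∀ᵐ ω ∂μ, W ω ≤ B) : WeightsLeOne μ T := by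
  obtain ⟨s, hs0, hs, hs'⟩ := h.exists_ess_bound hB
  obtain ⟨i, hi0, hi, hi'⟩ := h.neg.exists_ess_bound (B := -A)
    (hA.mono fun ω hω => neg_le_neg hω)
  have hi'' : ∀ x > -i, μ {ω | W ω ≤ x} ≠ 0 := fun x hx => by
    have := hi' (-x) (by linarith)
    simpa using this
  have hs'' : ∀ x > -s, μ {ω | -W ω ≤ x} ≠ 0 := fun x hx => by
    have := hs' (-x) (by linarith)
    simpa [neg_le] using this
  filter_upwards [h.ae_sum_le hs hs' hi'', h.neg.ae_sum_le hi hi' hs'', h.finite]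
    with ω h1 h2 ⟨N, hN⟩ k
  have h3 := add_le_add (h1 N hN) (h2 N hN)
  have h4 : ∑ k ∈ Finset.range N, (max (T k ω) 0 * s + min (T k ω) 0 * -i) +
      ∑ k ∈ Finset.range N, (max (T k ω) 0 * i + min (T k ω) 0 * -s) =
      (∑ k ∈ Finset.range N, |T k ω|) * (s + i) := by
    rw [← Finset.sum_add_distrib, Finset.sum_mul]
    refine Finset.sum_congr rfl fun k _ => ?_
    rcases le_total 0 (T k ω) with ht | ht
    · rw [max_eq_left ht, min_eq_right ht, abs_of_nonneg ht]; ring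
    · rw [max_eq_right ht, min_eq_left ht, abs_of_nonpos ht]; ring
  have h5 : (∑ k ∈ Finset.range N, |T k ω|) * (s + i) ≤ 1 * (s + i) := by linarith
  have h6 := le_of_mul_le_mul_right h5 (by linarith)
  rcases lt_or_ge k N with hk | hk
  · exact (Finset.single_le_sum (f := fun k => |T k ω|) (fun j _ => abs_nonneg _)
      (Finset.mem_range.mpr hk)).trans h6
  · rw [hN k hk]; simp

lemma exists_weight_gt_one {T : ℕ → Ω → ℝ} (hle : ¬ WeightsLeOne μ T) :
    ∃ σ : ℝ, (σ = 1 ∨ σ = -1) ∧ ∃ k, ∃ a > 1, 0 < μ {ω | a ≤ σ * T k ω} := by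
  by_contra! hc
  have h1 : ∀ σ : ℝ, (σ = 1 ∨ σ = -1) → ∀ᵐ ω ∂μ, ∀ (k n : ℕ),
      ¬ (1 + 1 / ((n : ℝ) + 1) ≤ σ * T k ω) := by
    intro σ hσ
    rw [ae_all_iff]; intro k
    rw [ae_all_iff]; intro n
    have h2 := hc σ hσ k (1 + 1 / ((n : ℝ) + 1))
      (lt_add_of_pos_right 1 Nat.one_div_pos_of_nat)
    rw [ae_iff]
    simpa using h2
  have h3 : ∀ x : ℝ, (∀ n : ℕ, ¬ (1 + 1 / ((n : ℝ) + 1) ≤ x)) → x ≤ 1 := by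
    intro x hx
    by_contra! h4
    obtain ⟨n, hn⟩ := exists_nat_one_div_lt (sub_pos.mpr h4)
    exact hx n (by linarith)
  refine hle ?_
  filter_upwards [h1 1 (Or.inl rfl), h1 (-1) (Or.inr rfl)] with ω hω1 hω2 k
  have h5 := h3 _ (hω1 k)
  have h6 := h3 _ (hω2 k)
  exact abs_le.mpr ⟨by linarith, by linarith⟩

lemma bddAbove_of_not_weightsLeOne (h : IsMinimalSolution μ C T W) (hle : ¬ WeightsLeOne μ T)
    {θ : ℝ} (hθ0 : 0 < θ) (hθ : expMoment μ W θ < ∞) : ∃ B : ℝ, ∀ᵐ ω ∂μ, W ω ≤ B := by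
  obtain ⟨σ, hσ, k, a, ha, hk⟩ := exists_weight_gt_one hle
  obtain ⟨q, hq, K, hK, hs⟩ := h.exists_scaling hσ ha hk
  rcases hσ with rfl | rfl
  · exact h.bddAbove_of_scaling ha hq hK (fun θ => by simpa using hs θ) hθ0 hθ
  -- For a weight below -1 two applications restore the sign: the scale becomes a², and the
  -- exponential losses K|θ| and Ka|θ| add up.
  · refine h.bddAbove_of_scaling (a := a * a) (q := q * q) (K := K * (1 + a)) (by nlinarith)
      (mul_ne_zero hq hq) (by positivity) (fun θ => ?_) hθ0 hθ
    refine le_trans ?_ (hs θ)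
    have h1 := hs (-1 * a * θ)
    have h2 : -1 * a * (-1 * a * θ) = a * a * θ := by ring
    have h3 : |-1 * a * θ| = a * |θ| := by
      rw [abs_mul, abs_mul, abs_neg, abs_one, one_mul, abs_of_pos (by linarith : 0 < a)]
    rw [h2, h3] at h1
    have h4 : ENNReal.ofReal (Real.exp (-(K * (1 + a) * |θ|))) =
        ENNReal.ofReal (Real.exp (-(K * |θ|))) * ENNReal.ofReal (Real.exp (-(K * (a * |θ|)))) := by
      rw [← ENNReal.ofReal_mul (Real.exp_pos _).le, ← Real.exp_add]; congr 2; ring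
    calc _ = q * ENNReal.ofReal (Real.exp (-(K * |θ|))) *
          (q * ENNReal.ofReal (Real.exp (-(K * (a * |θ|)))) * expMoment μ W (a * a * θ)) := by
          rw [h4]; ring
      _ ≤ _ := by gcongr

lemma bddBelow_of_not_weightsLeOne (h : IsMinimalSolution μ C T W) (hle : ¬ WeightsLeOne μ T)
    {θ : ℝ} (hθ0 : θ < 0) (hθ : expMoment μ W θ < ∞) : ∃ A : ℝ, ∀ᵐ ω ∂μ, A ≤ W ω := by
  obtain ⟨B, hB⟩ := h.neg.bddAbove_of_not_weightsLeOne hle (θ := -θ) (by linarith)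
    (by rwa [expMoment_neg, neg_neg])
  exact ⟨-B, hB.mono fun ω hω => neg_le.mp hω⟩

lemma weightsLeOne_of_expMoment (h : IsMinimalSolution μ C T W) {θ t : ℝ} (hθ : 0 < θ)
    (hθ' : expMoment μ W θ < ∞) (ht : t < 0) (ht' : expMoment μ W t < ∞) : WeightsLeOne μ T := by
  by_contra hle
  obtain ⟨B, hB⟩ := h.bddAbove_of_not_weightsLeOne hle hθ hθ'
  obtain ⟨A, hA⟩ := h.bddBelow_of_not_weightsLeOne hle ht ht'
  exact hle (h.weightsLeOne_of_bounded hA hB)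

lemma beta_eq_zero_of_not_weightsLeOne (h : IsMinimalSolution μ C T W)
    (hle : ¬ WeightsLeOne μ T) {θ : ℝ} (hθ0 : θ ≠ 0) (hθ : expMoment μ W θ < ∞) :
    beta μ T = 0 := by
  by_contra hb
  obtain ⟨k, hk⟩ := exists_weight_neg (pos_iff_ne_zero.mpr hb)
  obtain ⟨t, ht, ht'⟩ := h.exists_opposite_sign hθ0 hθ hk
  rcases lt_or_gt_of_ne hθ0 with h1 | h1
  · exact hle (h.weightsLeOne_of_expMoment (by nlinarith) ht' h1 hθ)
  · exact hle (h.weightsLeOne_of_expMoment h1 hθ (by nlinarith) ht')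

lemma powerSum_one_eq {T : ℕ → Ω → ℝ} {ω : Ω} {N : ℕ} (hN : ∀ k, N ≤ k → T k ω = 0)
    (h0 : ∀ k, 0 ≤ T k ω) : powerSum T 1 ω = ∑ k ∈ Finset.range N, T k ω := by
  rw [powerSum_eq_sum one_pos hN]
  exact Finset.sum_congr rfl fun k _ => by rw [Real.rpow_one, abs_of_nonneg (h0 k)]

/-- The extremal inequality applied to the essential supremum s of W. With nonnegative weights the
term in i drops out; i = 0 is admissible because W is centred. -/
lemma exists_tight_invariant_bound (h : IsMinimalSolution μ C T W) (hb : beta μ T = 0) {B : ℝ}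
    (hB : ∀ᵐ ω ∂μ, W ω ≤ B) : ∃ s, 0 < s ∧ (∀ᵐ ω ∂μ, W ω ≤ s) ∧
      (∀ x < s, μ {ω | x ≤ W ω} ≠ 0) ∧ ∀ᵐ ω ∂μ, s * powerSum T 1 ω + C ω ≤ s := by
  obtain ⟨s, hs0, hs, hs'⟩ := h.exists_ess_bound hB
  refine ⟨s, hs0, hs, hs', ?_⟩
  filter_upwards [h.ae_sum_le hs hs' (i := 0) fun x hx => h.measure_le_ne_zero hx,
    beta_eq_zero_iff.mp hb, h.finite] with ω h1 h2 ⟨N, hN⟩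
  have h3 := h1 N hN
  rw [powerSum_one_eq hN h2, Finset.mul_sum]
  have h4 : ∑ k ∈ Finset.range N, (max (T k ω) 0 * s + min (T k ω) 0 * 0) =
      ∑ k ∈ Finset.range N, s * T k ω := by
    refine Finset.sum_congr rfl fun k _ => ?_
    rw [max_eq_left (h2 k)]; ring
  linarith

lemma ae_le_of_expMoment_le {X : Ω → ℝ} (hX : AEMeasurable X μ) {w : ℝ}
    (h : ∀ θ, 0 ≤ θ → expMoment μ X θ ≤ ENNReal.ofReal (Real.exp (θ * w))) :
    ∀ᵐ ω ∂μ, X ω ≤ w := by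
  have key : ∀ δ > 0, μ {ω | w + δ ≤ X ω} = 0 := by
    intro δ hδ
    by_contra hne
    have hb : ∀ n : ℕ, μ {ω | w + δ ≤ X ω} * ENNReal.ofReal (Real.exp ((n + 1 : ℕ) * δ)) ≤ 1 := by
      intro n
      have hn : (0 : ℝ) < (n + 1 : ℕ) := by positivity
      have h1 := (mul_exp_le_expMoment hX (θ := (n + 1 : ℕ))
        (y := (n + 1 : ℕ) * (w + δ))).trans (h _ hn.le)
      have h2 : {ω | ((n + 1 : ℕ) : ℝ) * (w + δ) ≤ (n + 1 : ℕ) * X ω} = {ω | w + δ ≤ X ω} := by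
        ext ω
        exact mul_le_mul_iff_right₀ hn
      rw [h2] at h1
      have h5 : ENNReal.ofReal (Real.exp ((n + 1 : ℕ) * w)) ≠ 0 := by simp [Real.exp_pos]
      rw [← ENNReal.mul_le_mul_iff_left h5 ENNReal.ofReal_ne_top, one_mul, mul_assoc,
        ← ENNReal.ofReal_mul (Real.exp_pos _).le, ← Real.exp_add, ← mul_add, add_comm δ]
      exact h1
    have hlim : Tendsto (fun n : ℕ => μ {ω | w + δ ≤ X ω} *
        ENNReal.ofReal (Real.exp ((n + 1 : ℕ) * δ))) atTop (𝓝 ∞) := by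
      have h1 : Tendsto (fun n : ℕ => ((n + 1 : ℕ) : ℝ) * δ) atTop atTop :=
        (tendsto_natCast_atTop_atTop.comp (tendsto_add_atTop_nat 1)).atTop_mul_const hδ
      have := ENNReal.Tendsto.const_mul (a := μ {ω | w + δ ≤ X ω})
        (ENNReal.tendsto_ofReal_atTop.comp (Real.tendsto_exp_atTop.comp h1)) (Or.inl (by simp))
      rwa [ENNReal.mul_top hne] at this
    exact absurd ((le_of_tendsto' hlim hb).trans_lt ENNReal.one_lt_top) (lt_irrefl _)
  have h1 : ∀ᵐ ω ∂μ, ∀ n : ℕ, ¬ (w + 1 / ((n : ℝ) + 1) ≤ X ω) := by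
    rw [ae_all_iff]; intro n
    rw [ae_iff]
    simpa using key (1 / ((n : ℝ) + 1)) Nat.one_div_pos_of_nat
  filter_upwards [h1] with ω hω
  by_contra! h4
  obtain ⟨n, hn⟩ := exists_nat_one_div_lt (sub_pos.mpr h4)
  exact hω n (by linarith)

/-- The condition on w says exactly what makes e^{θw} a supersolution on θ ≥ 0. Minimality gives
Ψ(θ) ≤ e^{θw} there, hence W ≤ w. -/
lemma ae_le_of_invariant (h : IsMinimalSolution μ C T W) (hb : beta μ T = 0) {w : ℝ} (hw : 0 ≤ w)
    (hC : ∀ᵐ ω ∂μ, w * powerSum T 1 ω + C ω ≤ w) : ∀ᵐ ω ∂μ, W ω ≤ w := by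
  classical
  refine ae_le_of_expMoment_le h.integrable_W.aemeasurable ?_
  -- The value ∞ makes the supersolution property trivial for θ < 0; nonnegative weights never lead
  -- from θ ≥ 0 to that region.
  set G : ℝ → ℝ≥0∞ := fun θ => if 0 ≤ θ then ENNReal.ofReal (Real.exp (θ * w)) else ∞ with hG
  have hGnn : ∀ θ, 0 ≤ θ → G θ = ENNReal.ofReal (Real.exp (θ * w)) := fun θ hθ => if_pos hθ
  have hG0 : G 0 = 1 := by simp [hG]
  have key := h.expMoment_le G hG0 (fun θ => ?_) fun θ => ?_
  · intro θ hθ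
    rw [← hGnn θ hθ]
    exact key θ
  · rcases le_or_gt 0 θ with hθ | hθ
    · rw [hGnn θ hθ, ENNReal.one_le_ofReal]
      exact Real.one_le_exp (mul_nonneg hθ hw)
    · simp [hG, not_le.mpr hθ]
  · rcases le_or_gt 0 θ with hθ | hθ
    · rw [hGnn θ hθ]
      have h1 : ∀ᵐ ω ∂μ, ENNReal.ofReal (Real.exp (θ * C ω)) * ∏ᶠ k, G (θ * T k ω)
          ≤ ENNReal.ofReal (Real.exp (θ * w)) := by
        filter_upwards [hC, beta_eq_zero_iff.mp hb, h.finite] with ω h1 h2 ⟨N, hN⟩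
        rw [finprod_eq_prod_range (N := N) fun k hk => by rw [hN k hk, mul_zero, hG0],
          Finset.prod_congr rfl fun k _ => hGnn _ (mul_nonneg hθ (h2 k)),
          ← ENNReal.ofReal_prod_of_nonneg fun _ _ => (Real.exp_pos _).le, ← Real.exp_sum,
          ← ENNReal.ofReal_mul (Real.exp_pos _).le, ← Real.exp_add]
        refine ENNReal.ofReal_le_ofReal (Real.exp_le_exp.mpr ?_)
        rw [powerSum_one_eq hN h2] at h1
        have h3 : ∑ k ∈ Finset.range N, θ * T k ω * w = θ * (w * ∑ k ∈ Finset.range N, T k ω) := by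
          rw [Finset.mul_sum, Finset.mul_sum]
          exact Finset.sum_congr rfl fun k _ => by ring
        rw [h3, ← mul_add, add_comm]
        exact mul_le_mul_of_nonneg_left h1 hθ
      simpa using lintegral_mono_ae h1
    · simp [hG, not_le.mpr hθ]

end IsMinimalSolution

/-! ### Gaussian bounds for Ψ near the origin. -/

lemma exp_le_one_add_add_sq (x : ℝ) : Real.exp x ≤ 1 + x + x ^ 2 * Real.exp (max x 0) := by
  have h1 : Real.exp x - 1 ≤ x * Real.exp x := by
    have h := mul_le_mul_of_nonneg_left (Real.add_one_le_exp (-x)) (Real.exp_pos x).le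
    rw [← Real.exp_add, add_neg_cancel, Real.exp_zero] at h
    linarith
  have h2 : Real.exp x - 1 - x ≤ x * (Real.exp x - 1) := by linarith
  rcases le_total 0 x with hx | hx
  · rw [max_eq_left hx]
    have := mul_le_mul_of_nonneg_left h1 hx
    nlinarith
  · rw [max_eq_right hx, Real.exp_zero]
    have h3 := Real.add_one_le_exp x
    have := mul_le_mul_of_nonpos_left (show x ≤ Real.exp x - 1 by linarith) hx
    nlinarith

/-- Separates e^{θC}, whose linear term has mean zero, from the contribution of b = Kθ²Σ_2, already
of second order in θ. -/
lemma exp_add_le_exp_add_mul (a b : ℝ) :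
    Real.exp (a + b) ≤ Real.exp a + b * Real.exp (a + b) := by
  have h := mul_le_mul_of_nonneg_left (Real.add_one_le_exp (-b)) (Real.exp_pos (a + b)).le
  rw [← Real.exp_add, add_neg_cancel_right] at h
  linarith

lemma exp_add_le_exp_two_mul (a b : ℝ) :
    Real.exp (a + b) ≤ Real.exp (2 * a) + Real.exp (2 * b) := by
  rcases le_total a b with h | h
  · have : Real.exp (a + b) ≤ Real.exp (2 * b) := Real.exp_le_exp.mpr (by linarith)
    linarith [Real.exp_pos (2 * a)]
  · have : Real.exp (a + b) ≤ Real.exp (2 * a) := Real.exp_le_exp.mpr (by linarith)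
    linarith [Real.exp_pos (2 * b)]

lemma measurable_powerSum {Ω : Type*} [MeasurableSpace Ω] {T : ℕ → Ω → ℝ}
    (hT : ∀ k, Measurable (T k)) (α : ℝ) : Measurable (powerSum T α) :=
  Measurable.tsum fun k => by have := hT k; fun_prop

lemma powerSum_nonneg {Ω : Type*} (T : ℕ → Ω → ℝ) (α : ℝ) (ω : Ω) : 0 ≤ powerSum T α ω :=
  tsum_nonneg fun _ => by positivity

section

variable {Ω : Type*} [mΩ : MeasurableSpace Ω] {μ : Measure Ω} [IsProbabilityMeasure μ]

/-- A nonnegative `V` with an exponential moment and `E V < r` keeps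
`E[V exp(ε g + K ε² V)] < r` for small `ε`. -/
lemma eventually_integral_mul_exp_lt {g V : Ω → ℝ} (hg : Measurable g) (hV : Measurable V)
    (hg0 : ∀ ω, 0 ≤ g ω) (hV0 : ∀ ω, 0 ≤ V ω) {θ₀ θ' K r : ℝ} (hθ₀ : 0 < θ₀) (hθ' : 0 < θ')
    (hgi : Integrable (fun ω => Real.exp (θ₀ * g ω)) μ)
    (hVi : Integrable (fun ω => Real.exp (θ' * V ω)) μ) (hr : ∫ ω, V ω ∂μ < r) :
    ∀ᶠ ε in 𝓝[>] (0 : ℝ), Integrable (fun ω => V ω * Real.exp (ε * g ω + K * ε ^ 2 * V ω)) μ ∧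
      ∫ ω, V ω * Real.exp (ε * g ω + K * ε ^ 2 * V ω) ∂μ < r := by
  -- Dominating V costs one factor e^{κV}, the exponent another, and the splitting into two
  -- exponentials doubles the sum: 4κ = θ'. The same doubling is why 2ε ≤ θ₀ is required.
  set κ := θ' / 4 with hκ
  have hκ0 : 0 < κ := by positivity
  have hbi : Integrable (fun ω => κ⁻¹ * (Real.exp (θ₀ * g ω) + Real.exp (θ' * V ω))) μ :=
    (hgi.add hVi).const_mul _
  have hev : ∀ᶠ ε in 𝓝[>] (0 : ℝ), 0 < ε ∧ 2 * ε ≤ θ₀ ∧ K * ε ^ 2 ≤ κ := by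
    have h1 : ∀ᶠ ε in 𝓝[>] (0 : ℝ), 2 * ε ≤ θ₀ := by
      have : Tendsto (fun ε : ℝ => 2 * ε) (𝓝[>] 0) (𝓝 (2 * 0)) :=
        ((continuous_const.mul continuous_id).tendsto 0).mono_left nhdsWithin_le_nhds
      exact this.eventually_le_const (by simpa using hθ₀)
    have h2 : ∀ᶠ ε in 𝓝[>] (0 : ℝ), K * ε ^ 2 ≤ κ := by
      have : Tendsto (fun ε : ℝ => K * ε ^ 2) (𝓝[>] 0) (𝓝 (K * 0 ^ 2)) :=
        ((continuous_const.mul (continuous_id.pow 2)).tendsto 0).mono_left nhdsWithin_le_nhds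
      exact this.eventually_le_const (by simpa using hκ0)
    filter_upwards [self_mem_nhdsWithin, h1, h2] with ε h0 h1 h2 using ⟨h0, h1, h2⟩
  have hm : ∀ ε : ℝ, AEStronglyMeasurable
      (fun ω => V ω * Real.exp (ε * g ω + K * ε ^ 2 * V ω)) μ := fun ε => by fun_prop
  have hbound : ∀ᶠ ε in 𝓝[>] (0 : ℝ), ∀ ω, ‖V ω * Real.exp (ε * g ω + K * ε ^ 2 * V ω)‖
      ≤ κ⁻¹ * (Real.exp (θ₀ * g ω) + Real.exp (θ' * V ω)) := by
    filter_upwards [hev] with ε ⟨h0, h1, h2⟩ ω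
    rw [Real.norm_eq_abs, abs_of_nonneg (mul_nonneg (hV0 ω) (Real.exp_pos _).le)]
    have h3 : V ω ≤ κ⁻¹ * Real.exp (κ * V ω) := by
      have := Real.add_one_le_exp (κ * V ω)
      rw [← div_eq_inv_mul, le_div_iff₀ hκ0]
      linarith
    have h4 : ε * g ω + K * ε ^ 2 * V ω ≤ θ₀ / 2 * g ω + κ * V ω := by
      have := hg0 ω
      have := hV0 ω
      gcongr
      linarith
    calc V ω * Real.exp (ε * g ω + K * ε ^ 2 * V ω)
        ≤ κ⁻¹ * Real.exp (κ * V ω) * Real.exp (θ₀ / 2 * g ω + κ * V ω) := by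
          gcongr
      _ = κ⁻¹ * Real.exp (θ₀ / 2 * g ω + 2 * κ * V ω) := by
          rw [mul_assoc, ← Real.exp_add]; congr 2; ring
      _ ≤ κ⁻¹ * (Real.exp (2 * (θ₀ / 2 * g ω)) + Real.exp (2 * (2 * κ * V ω))) := by
          gcongr
          exact exp_add_le_exp_two_mul _ _
      _ = _ := by
          congr 3 <;> [ring_nf; (rw [hκ]; ring_nf)]
  have hlim : Tendsto (fun ε : ℝ => ∫ ω, V ω * Real.exp (ε * g ω + K * ε ^ 2 * V ω) ∂μ)
      (𝓝[>] 0) (𝓝 (∫ ω, V ω ∂μ)) := by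
    refine tendsto_integral_filter_of_dominated_convergence _ (Eventually.of_forall hm)
      (hbound.mono fun ε h => ae_of_all _ h) hbi (ae_of_all _ fun ω => ?_)
    have hc : Continuous fun ε : ℝ => V ω * Real.exp (ε * g ω + K * ε ^ 2 * V ω) := by fun_prop
    have := (hc.tendsto 0).mono_left (nhdsWithin_le_nhds (s := Ioi 0))
    simpa using this
  filter_upwards [hbound, hlim.eventually_lt_const hr] with ε h1 h2
  exact ⟨hbi.mono' (hm ε) (ae_of_all _ h1), h2⟩

end

namespace IsMinimalSolution

variable {Ω : Type*} [mΩ : MeasurableSpace Ω] {μ : Measure Ω} [IsProbabilityMeasure μ]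
  {C : Ω → ℝ} {T : ℕ → Ω → ℝ} {W : Ω → ℝ}

/-- A Gaussian supersolution: `E exp(θ W) < ∞` for small `θ` in a set `S` stable under
multiplication by the weights on which `θ C ≤ |θ| g` for some `g` with an exponential moment. -/
theorem exists_expMoment_lt_top (h : IsMinimalSolution μ C T W) {S : Set ℝ} {g : Ω → ℝ}
    (hg : Measurable g) (hg0 : ∀ ω, 0 ≤ g ω) (hgC : ∀ ω, g ω = 0 ∨ g ω = |C ω|)
    (hS0 : (0 : ℝ) ∈ S) (hSC : ∀ θ ∈ S, ∀ ω, θ * C ω ≤ |θ| * g ω)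
    (hST : ∀ᵐ ω ∂μ, ∀ k, ∀ θ ∈ S, θ * T k ω ∈ S) (hle : WeightsLeOne μ T)
    {θ₀ : ℝ} (hθ₀ : 0 < θ₀) (hgi : Integrable (fun ω => Real.exp (θ₀ * g ω)) μ)
    (hexp : ExpCondition μ C T) (hV : ∫ ω, powerSum T 2 ω ∂μ < 1) :
    ∃ ε > 0, ∀ θ ∈ S, |θ| ≤ ε → expMoment μ W θ < ∞ := by
  classical
  obtain ⟨hC2, θ', hθ', hVi⟩ := hexp
  have hCm := h.measurable_C
  have hVm := measurable_powerSum h.measurable_T 2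
  -- Any r strictly between E Σ_2 and 1 would do.
  set r := (1 + ∫ ω, powerSum T 2 ω ∂μ) / 2 with hr
  have hr1 : r < 1 := by linarith
  have hr2 : ∫ ω, powerSum T 2 ω ∂μ < r := by linarith
  set c := ∫ ω, C ω ^ 2 * Real.exp (θ₀ / 2 * g ω) ∂μ with hc
  -- Where g = 0 the square integrability of C suffices; where g = |C| the exponential moment of g
  -- absorbs C².
  have hci : Integrable (fun ω => C ω ^ 2 * Real.exp (θ₀ / 2 * g ω)) μ := by
    have hb : Integrable (fun ω => C ω ^ 2 + 2 * (θ₀ / 2)⁻¹ ^ 2 * Real.exp (θ₀ * g ω)) μ :=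
      hC2.integrable_sq.add (hgi.const_mul _)
    refine hb.mono' (by fun_prop) (ae_of_all _ fun ω => ?_)
    rw [Real.norm_eq_abs, abs_of_nonneg (by positivity)]
    rcases hgC ω with h0 | h0
    · rw [h0]
      simp only [mul_zero, Real.exp_zero, mul_one, le_add_iff_nonneg_right]
      positivity
    · have h1 : C ω ^ 2 = g ω ^ 2 := by rw [h0, sq_abs]
      have h2 := Real.pow_div_factorial_le_exp (θ₀ / 2 * g ω)
        (mul_nonneg (by positivity) (hg0 ω)) 2
      have h3 : g ω ^ 2 ≤ 2 * (θ₀ / 2)⁻¹ ^ 2 * Real.exp (θ₀ / 2 * g ω) := by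
        have h4 : g ω ^ 2 = 2 * (θ₀ / 2)⁻¹ ^ 2 * ((θ₀ / 2 * g ω) ^ 2 / (Nat.factorial 2 : ℝ)) := by
          simp only [Nat.factorial]
          field_simp
          norm_num
        rw [h4]
        gcongr
      have h5 : Real.exp (θ₀ * g ω) = Real.exp (θ₀ / 2 * g ω) * Real.exp (θ₀ / 2 * g ω) := by
        rw [← Real.exp_add]; congr 1; ring
      calc C ω ^ 2 * Real.exp (θ₀ / 2 * g ω)
          ≤ 2 * (θ₀ / 2)⁻¹ ^ 2 * Real.exp (θ₀ / 2 * g ω) * Real.exp (θ₀ / 2 * g ω) := by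
            rw [h1]; gcongr
        _ = 2 * (θ₀ / 2)⁻¹ ^ 2 * Real.exp (θ₀ * g ω) := by rw [h5]; ring
        _ ≤ _ := le_add_of_nonneg_left (sq_nonneg _)
  have hc0 : 0 ≤ c := by positivity
  -- K solves c + Kr = K: the quadratic terms then integrate to at most Kθ², and 1 + Kθ² ≤ e^{Kθ²}
  -- closes the estimate.
  set K := c / (1 - r) with hK
  have hr1' : 0 < 1 - r := by linarith
  have hK0 : 0 ≤ K := by positivity
  have hKc : c + K * r = K := by rw [hK]; field_simp; ring
  obtain ⟨ε, ⟨hεi, hεr⟩, hε2, hε0⟩ := ((eventually_integral_mul_exp_lt hg hVm hg0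
    (powerSum_nonneg T 2) hθ₀ hθ' hgi hVi hr2).and
    (((tendsto_id.mono_left nhdsWithin_le_nhds : Tendsto (fun ε : ℝ => ε) (𝓝[>] 0)
      (𝓝 0)).eventually_le_const (show (0 : ℝ) < θ₀ / 2 by positivity)).and
      (self_mem_nhdsWithin : Ioi (0 : ℝ) ∈ 𝓝[>] 0))).exists
  have hε0 : 0 < ε := hε0
  refine ⟨ε, hε0, ?_⟩
  -- Since |T_k| ≤ 1 and S is stable under the weights, the finite region is preserved by θ ↦ θT_k.
  set G : ℝ → ℝ≥0∞ := fun θ =>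
    if θ ∈ S ∧ |θ| ≤ ε then ENNReal.ofReal (Real.exp (K * θ ^ 2)) else ∞ with hG
  have hGin : ∀ θ, θ ∈ S → |θ| ≤ ε → G θ = ENNReal.ofReal (Real.exp (K * θ ^ 2)) :=
    fun θ h1 h2 => if_pos ⟨h1, h2⟩
  have hG0 : G 0 = 1 := by rw [hGin 0 hS0 (by simpa using hε0.le)]; simp
  suffices hle : ∀ θ, expMoment μ W θ ≤ G θ by
    intro θ hθ hθε
    refine (hle θ).trans_lt ?_
    rw [hGin θ hθ hθε]
    exact ENNReal.ofReal_lt_top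
  refine h.expMoment_le G hG0 (fun θ => ?_) fun θ => ?_
  · by_cases hθ : θ ∈ S ∧ |θ| ≤ ε
    · rw [hGin θ hθ.1 hθ.2, ENNReal.one_le_ofReal]
      exact Real.one_le_exp (by positivity)
    · simp [hG, hθ]
  by_cases hθ : θ ∈ S ∧ |θ| ≤ ε
  swap
  · simp [hG, hθ]
  obtain ⟨hθS, hθε⟩ := hθ
  rw [hGin θ hθS hθε]
  have hθsq : θ ^ 2 ≤ ε ^ 2 := by rw [← sq_abs θ]; gcongr
  have hpt : ∀ᵐ ω ∂μ, ENNReal.ofReal (Real.exp (θ * C ω)) * ∏ᶠ k, G (θ * T k ω) ≤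
      ENNReal.ofReal (1 + θ * C ω + θ ^ 2 * (C ω ^ 2 * Real.exp (θ₀ / 2 * g ω)) +
        K * θ ^ 2 * (powerSum T 2 ω * Real.exp (ε * g ω + K * ε ^ 2 * powerSum T 2 ω))) := by
    filter_upwards [h.finite, hST, hle] with ω ⟨N, hN⟩ hωS hωle
    have hTk : ∀ k, |θ * T k ω| ≤ ε := fun k => by
      rw [abs_mul]
      calc |θ| * |T k ω| ≤ |θ| * 1 := by gcongr; exact hωle k
        _ ≤ ε := by rwa [mul_one]
    rw [finprod_eq_prod_range (N := N) fun k hk => by rw [hN k hk, mul_zero, hG0],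
      Finset.prod_congr rfl fun k _ => hGin _ (hωS k θ hθS) (hTk k),
      ← ENNReal.ofReal_prod_of_nonneg fun _ _ => (Real.exp_pos _).le, ← Real.exp_sum,
      ← ENNReal.ofReal_mul (Real.exp_pos _).le, ← Real.exp_add]
    have hsum : ∑ k ∈ Finset.range N, K * (θ * T k ω) ^ 2 = K * θ ^ 2 * powerSum T 2 ω := by
      rw [powerSum_eq_sum two_pos hN, Finset.mul_sum]
      refine Finset.sum_congr rfl fun k _ => ?_
      rw [Real.rpow_two, sq_abs]; ring
    rw [hsum]
    refine ENNReal.ofReal_le_ofReal ?_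
    have hV0 := powerSum_nonneg T 2 ω
    have hgω := hg0 ω
    have h1 := exp_add_le_exp_add_mul (θ * C ω) (K * θ ^ 2 * powerSum T 2 ω)
    have h2 := exp_le_one_add_add_sq (θ * C ω)
    have hθC := hSC θ hθS ω
    have h3 : Real.exp (max (θ * C ω) 0) ≤ Real.exp (θ₀ / 2 * g ω) := by
      refine Real.exp_le_exp.mpr (max_le (hθC.trans ?_) (by positivity))
      gcongr
      exact hθε.trans hε2
    have h4 : Real.exp (θ * C ω + K * θ ^ 2 * powerSum T 2 ω) ≤
        Real.exp (ε * g ω + K * ε ^ 2 * powerSum T 2 ω) := by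
      refine Real.exp_le_exp.mpr (add_le_add (hθC.trans ?_) ?_) <;> gcongr
    have h5 := mul_le_mul_of_nonneg_left h3 (sq_nonneg (θ * C ω))
    have h6 := mul_le_mul_of_nonneg_left h4 (show 0 ≤ K * θ ^ 2 * powerSum T 2 ω by positivity)
    calc _ ≤ _ := h1
      _ ≤ 1 + θ * C ω + (θ * C ω) ^ 2 * Real.exp (θ₀ / 2 * g ω) + K * θ ^ 2 * powerSum T 2 ω *
          Real.exp (ε * g ω + K * ε ^ 2 * powerSum T 2 ω) := by linarith
      _ = _ := by ring
  have hi1 : Integrable (fun ω => 1 + θ * C ω) μ :=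
    (integrable_const _).add (h.integrable_C.const_mul θ)
  have hi2 : Integrable (fun ω => 1 + θ * C ω +
      θ ^ 2 * (C ω ^ 2 * Real.exp (θ₀ / 2 * g ω))) μ := hi1.add (hci.const_mul _)
  have hi3 : Integrable (fun ω => 1 + θ * C ω +
      θ ^ 2 * (C ω ^ 2 * Real.exp (θ₀ / 2 * g ω)) + K * θ ^ 2 *
        (powerSum T 2 ω * Real.exp (ε * g ω + K * ε ^ 2 * powerSum T 2 ω))) μ :=
    hi2.add (hεi.const_mul (K * θ ^ 2))
  have hnn : 0 ≤ᵐ[μ] fun ω => 1 + θ * C ω + θ ^ 2 * (C ω ^ 2 * Real.exp (θ₀ / 2 * g ω)) +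
        K * θ ^ 2 * (powerSum T 2 ω * Real.exp (ε * g ω + K * ε ^ 2 * powerSum T 2 ω)) := by
    refine ae_of_all _ fun ω => ?_
    have hV0 := powerSum_nonneg T 2 ω
    have hgω := hg0 ω
    have h2 := exp_le_one_add_add_sq (θ * C ω)
    have h3 : Real.exp (max (θ * C ω) 0) ≤ Real.exp (θ₀ / 2 * g ω) := by
      refine Real.exp_le_exp.mpr (max_le ((hSC θ hθS ω).trans ?_) (by positivity))
      gcongr
      exact hθε.trans hε2
    have h5 := mul_le_mul_of_nonneg_left h3 (sq_nonneg (θ * C ω))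
    have h6 : 0 ≤ K * θ ^ 2 *
        (powerSum T 2 ω * Real.exp (ε * g ω + K * ε ^ 2 * powerSum T 2 ω)) := by positivity
    have h7 := Real.exp_pos (θ * C ω)
    simp only [Pi.zero_apply]
    rw [mul_pow, mul_assoc (θ ^ 2)] at h5
    linarith
  refine (lintegral_mono_ae hpt).trans ?_
  rw [← ofReal_integral_eq_lintegral_ofReal hi3 hnn]
  refine ENNReal.ofReal_le_ofReal ?_
  rw [integral_add hi2 (hεi.const_mul _), integral_add hi1 (hci.const_mul _),
    integral_add (integrable_const _) (h.integrable_C.const_mul θ), integral_const_mul,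
    integral_const_mul, integral_const_mul, h.integral_C, ← hc]
  have h8 := mul_le_mul_of_nonneg_left hεr.le (show 0 ≤ K * θ ^ 2 by positivity)
  have h9 := Real.add_one_le_exp (K * θ ^ 2)
  have h10 : θ ^ 2 * c + K * θ ^ 2 * r = K * θ ^ 2 := by linear_combination θ ^ 2 * hKc
  simp only [integral_const, probReal_univ, smul_eq_mul, mul_zero, mul_one, add_zero]
  linarith

lemma exists_gaussian_lower_bound (h : IsMinimalSolution μ C T W) :
    ∃ m > 0, ∀ θ, 0 ≤ θ → θ ≤ 1 → ENNReal.ofReal (Real.exp (m * θ ^ 2)) ≤ expMoment μ W θ := by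
  -- Truncating W⁺ gives a square that is integrable without any second moment of W. Its mean is
  -- positive, since a centred nonzero W cannot be almost surely ≤ 0.
  set f : Ω → ℝ := fun ω => min (max (W ω) 0) 1 ^ 2 with hf
  have hWm := h.integrable_W.aemeasurable
  have hf0 : ∀ ω, 0 ≤ f ω := fun ω => sq_nonneg _
  have hf1 : ∀ ω, f ω ≤ 1 := fun ω => by
    have h0 : 0 ≤ min (max (W ω) 0) 1 := le_min (le_max_right _ _) zero_le_one
    exact pow_le_one₀ h0 (min_le_right _ _)
  have hfi : Integrable f μ := by
    refine (integrable_const (1 : ℝ)).mono' ?_ (ae_of_all _ fun ω => ?_)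
    · exact (((hWm.max aemeasurable_const).min aemeasurable_const).pow_const 2).aestronglyMeasurable
    · rw [Real.norm_eq_abs, abs_of_nonneg (hf0 ω)]; exact hf1 ω
  have hm0 : 0 < ∫ ω, f ω ∂μ := by
    refine lt_of_le_of_ne (integral_nonneg hf0) fun h0 => ?_
    have h1 := (integral_eq_zero_iff_of_nonneg hf0 hfi).mp h0.symm
    have h2 : ∀ᵐ ω ∂μ, W ω ≤ 0 := by
      filter_upwards [h1] with ω hω
      simp only [hf, Pi.zero_apply, pow_eq_zero_iff, ne_eq, OfNat.ofNat_ne_zero,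
        not_false_eq_true] at hω
      by_contra! hpos
      have : 0 < min (max (W ω) 0) 1 := lt_min (lt_max_of_lt_left hpos) one_pos
      linarith
    exact lt_irrefl _ (h.pos_of_ae_le h2)
  have hm1 : ∫ ω, f ω ∂μ ≤ 1 := by
    have := integral_mono hfi (integrable_const (1 : ℝ)) hf1
    simpa using this
  -- With y = mθ² the quadratic term equals 2y, and y ≤ 1/4 makes e^y ≤ 1/(1 - y) ≤ 1 + 2y.
  refine ⟨(∫ ω, f ω ∂μ) / 4, by positivity, fun θ hθ0 hθ1 => ?_⟩
  rcases eq_or_lt_of_le (le_top : expMoment μ W θ ≤ ∞) with htop | hlt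
  · simp [htop]
  have hi := h.mem_iff.mpr hlt
  rw [expMoment_eq_ofReal hi]
  refine ENNReal.ofReal_le_ofReal ?_
  have hpt : ∀ ω, 1 + θ * W ω + θ ^ 2 / 2 * f ω ≤ Real.exp (θ * W ω) := by
    intro ω
    rcases le_total 0 (W ω) with hw | hw
    · have h1 := Real.quadratic_le_exp_of_nonneg (mul_nonneg hθ0 hw)
      have h2 : f ω ≤ W ω ^ 2 := by
        simp only [hf, max_eq_left hw]
        exact pow_le_pow_left₀ (le_min hw zero_le_one) (min_le_left _ _) 2
      have h3 : θ ^ 2 / 2 * f ω ≤ θ ^ 2 / 2 * W ω ^ 2 := by gcongr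
      nlinarith
    · have h2 : f ω = 0 := by simp [hf, max_eq_right hw]
      rw [h2]
      have := Real.add_one_le_exp (θ * W ω)
      linarith
  have hi1 : Integrable (fun ω => 1 + θ * W ω) μ :=
    (integrable_const _).add (h.integrable_W.const_mul θ)
  have h1 := integral_mono (hi1.add (hfi.const_mul (θ ^ 2 / 2))) hi hpt
  have h2 : ∫ ω, (1 + θ * W ω + θ ^ 2 / 2 * f ω) ∂μ = 1 + θ ^ 2 / 2 * ∫ ω, f ω ∂μ := by
    rw [integral_add hi1 (hfi.const_mul _),
      integral_add (integrable_const _) (h.integrable_W.const_mul θ), integral_const_mul,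
      integral_const_mul, h.integral_W]
    simp
  have h3 : ∫ ω, (1 + θ * W ω + θ ^ 2 / 2 * f ω) ∂μ ≤ ∫ ω, Real.exp (θ * W ω) ∂μ := h1
  rw [h2] at h3
  refine le_trans ?_ h3
  set y := (∫ ω, f ω ∂μ) / 4 * θ ^ 2 with hy
  have hθ2 : θ ^ 2 ≤ 1 := pow_le_one₀ hθ0 hθ1
  have hy0 : 0 ≤ y := by positivity
  have hy1 : y ≤ 1 / 4 := by
    rw [hy]
    calc (∫ ω, f ω ∂μ) / 4 * θ ^ 2 ≤ 1 / 4 * 1 := by gcongr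
      _ = 1 / 4 := by ring
  have h4 := mul_le_mul_of_nonneg_left (Real.add_one_le_exp (-y)) (Real.exp_pos y).le
  rw [← Real.exp_add, add_neg_cancel, Real.exp_zero] at h4
  have h5 : θ ^ 2 / 2 * ∫ ω, f ω ∂μ = 2 * y := by rw [hy]; ring
  rw [h5]
  nlinarith

/-- Inserting Ψ(t) ≥ e^{mt²} into the equation gives E exp(θC + mθ²Σ_2) < ∞. Combining it with E
e^{-θC} < ∞ eliminates C and leaves an exponential moment of Σ_2. Square integrability of C holds
since 0 is interior to its exponential domain. -/
lemma expCondition_of_expMoment (h : IsMinimalSolution μ C T W) (hle : WeightsLeOne μ T)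
    (hb : beta μ T = 0) {θ₀ θ₁ : ℝ} (hθ₀ : 0 < θ₀) (hθ₀' : expMoment μ W θ₀ < ∞) (hθ₁ : θ₁ < 0)
    (hθ₁' : θ₁ ∈ integrableExpSet C μ) : ExpCondition μ C T := by
  have hCm := h.measurable_C
  have hVm := measurable_powerSum h.measurable_T 2
  have h0C : (0 : ℝ) ∈ integrableExpSet C μ := by simp [integrableExpSet]
  have hθ₀C := h.integrableExpSet_subset (h.mem_iff.mpr hθ₀')
  have hIcc : Icc θ₁ θ₀ ⊆ integrableExpSet C μ :=
    convex_integrableExpSet.ordConnected.out hθ₁' hθ₀C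
  refine ⟨?_, ?_⟩
  · have hint : (0 : ℝ) ∈ interior (integrableExpSet C μ) :=
      mem_interior_iff_mem_nhds.mpr (mem_of_superset (Icc_mem_nhds hθ₁ hθ₀) hIcc)
    exact_mod_cast memLp_of_mem_interior_integrableExpSet hint 2
  obtain ⟨m, hm0, hm⟩ := h.exists_gaussian_lower_bound
  -- Small enough for Ψ at θ, for the transform of C at -θ, and for the Gaussian bound on [0, 1].
  set θ := min (min θ₀ (-θ₁)) 1 with hθ
  have hθpos : 0 < θ := lt_min (lt_min hθ₀ (by linarith)) one_pos
  have hθle : θ ≤ θ₀ := (min_le_left _ _).trans (min_le_left _ _)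
  have hθle' : θ ≤ -θ₁ := (min_le_left _ _).trans (min_le_right _ _)
  have hθ1 : θ ≤ 1 := min_le_right _ _
  have hθW : expMoment μ W θ < ∞ := by
    have := expMoment_le_scale h.integrable_W h.integral_W ((one_le_div hθpos).mpr hθle) θ
    rw [div_mul_cancel₀ _ hθpos.ne'] at this
    exact this.trans_lt hθ₀'
  have hneg : Integrable (fun ω => Real.exp (-θ * C ω)) μ := hIcc ⟨by linarith, by linarith⟩
  have hpos : Integrable (fun ω => Real.exp (θ * C ω + m * θ ^ 2 * powerSum T 2 ω)) μ := by
    refine ⟨by fun_prop, ?_⟩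
    rw [hasFiniteIntegral_iff_ofReal (ae_of_all _ fun ω => (Real.exp_pos _).le)]
    refine lt_of_le_of_lt ?_ hθW
    rw [h.expMoment_eq θ]
    refine lintegral_mono_ae ?_
    filter_upwards [h.finite, hle, beta_eq_zero_iff.mp hb] with ω ⟨N, hN⟩ h1 h2
    rw [h.finprod_eq θ hN, Real.exp_add, ENNReal.ofReal_mul (Real.exp_pos _).le]
    gcongr
    have h3 : Real.exp (m * θ ^ 2 * powerSum T 2 ω) =
        ∏ k ∈ Finset.range N, Real.exp (m * (θ * T k ω) ^ 2) := by
      rw [← Real.exp_sum, powerSum_eq_sum two_pos hN, Finset.mul_sum]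
      congr 1
      refine Finset.sum_congr rfl fun k _ => ?_
      rw [Real.rpow_two, sq_abs]; ring
    rw [h3, ENNReal.ofReal_prod_of_nonneg fun _ _ => (Real.exp_pos _).le]
    refine Finset.prod_le_prod' fun k _ => hm _ (mul_nonneg hθpos.le (h2 k)) ?_
    exact mul_le_one₀ hθ1 (h2 k) ((le_abs_self _).trans (h1 k))
  -- Half of mθ²: the average of the exponents θC + mθ²Σ_2 and -θC.
  refine ⟨m * θ ^ 2 / 2, by positivity, ?_⟩
  refine (hpos.add hneg).mono' (by fun_prop) (ae_of_all _ fun ω => ?_)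
  rw [Real.norm_eq_abs, abs_of_pos (Real.exp_pos _)]
  have h1 := exp_add_le_exp_two_mul ((θ * C ω + m * θ ^ 2 * powerSum T 2 ω) / 2) (-θ * C ω / 2)
  have h2 : (θ * C ω + m * θ ^ 2 * powerSum T 2 ω) / 2 + -θ * C ω / 2 =
      m * θ ^ 2 / 2 * powerSum T 2 ω := by ring
  rw [h2, mul_div_cancel₀ _ (two_ne_zero' ℝ), mul_div_cancel₀ _ (two_ne_zero' ℝ)] at h1
  exact h1

end IsMinimalSolution

/-! ### Consequences of the hypotheses, and relations between the cases. -/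

section

variable {Ω : Type*} [mΩ : MeasurableSpace Ω] {μ : Measure Ω} [IsProbabilityMeasure μ]

lemma lintegral_tsum_rpow {T : ℕ → Ω → ℝ} (hT : ∀ k, Measurable (T k))
    (hfin : ∀ᵐ ω ∂μ, ∃ N, ∀ k, N ≤ k → T k ω = 0) {p : ℝ} (hp : 0 < p) :
    ∑' k, ∫⁻ ω, ENNReal.ofReal (|T k ω| ^ p) ∂μ = eLpNorm (powerSum T p) 1 μ := by
  rw [← lintegral_tsum fun k => by have := hT k; fun_prop, eLpNorm_one_eq_lintegral_enorm]
  refine lintegral_congr_ae ?_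
  filter_upwards [hfin] with ω ⟨N, hN⟩
  rw [powerSum_eq_sum hp hN, Real.enorm_eq_ofReal (Finset.sum_nonneg fun k _ => by positivity),
    ENNReal.ofReal_sum_of_nonneg fun k _ => by positivity]
  refine tsum_eq_sum fun k hk => ?_
  rw [hN k (by simpa using hk), abs_zero, Real.zero_rpow hp.ne', ENNReal.ofReal_zero]

lemma isContractiveTree_of_momentCondition {C : List ℕ → Ω → ℝ} {T : List ℕ → ℕ → Ω → ℝ}
    (hiid : IsIIDTree μ C T) (hord : OrderedWeights μ (T [])) {p : ℝ} (hp : 1 ≤ p)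
    (hmom : MomentCondition μ (C []) (T []) p) : IsContractiveTree μ C T p := by
  have hp0 : 0 < p := by linarith
  have hpE : (ENNReal.ofReal p).toReal = p := ENNReal.toReal_ofReal hp0.le
  have hpne : ENNReal.ofReal p ≠ 0 := by simpa using hp0
  have hfin : ∀ᵐ ω ∂μ, ∃ N, ∀ k, N ≤ k → T [] k ω = 0 := by
    filter_upwards [hord] with ω ⟨N, _, _, hN⟩ using ⟨N, hN⟩
  obtain ⟨h0, hCp, hlt⟩ := hmom
  rw [← lintegral_tsum_rpow (hiid.measurable_T []) hfin hp0] at hlt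
  have hne : ∀ k, ∫⁻ ω, ENNReal.ofReal (|T [] k ω| ^ p) ∂μ ≠ ∞ := fun k =>
    ((ENNReal.le_tsum k).trans_lt (hlt.trans ENNReal.one_lt_top)).ne
  have hint : ∀ k, Integrable (fun ω => |T [] k ω| ^ p) μ := fun k => by
    have := hiid.measurable_T [] k
    refine ⟨(this.abs.pow_const p).aestronglyMeasurable, ?_⟩
    rw [hasFiniteIntegral_iff_ofReal (ae_of_all _ fun ω => by positivity)]
    exact (hne k).lt_top
  have heq : ∀ k, ∫ ω, |T [] k ω| ^ p ∂μ = (∫⁻ ω, ENNReal.ofReal (|T [] k ω| ^ p) ∂μ).toReal :=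
    fun k => integral_eq_lintegral_of_nonneg_ae (ae_of_all _ fun ω => by positivity)
      (hint k).aestronglyMeasurable
  refine ⟨hiid, hfin, h0, hCp, fun k => ?_, ?_, ?_⟩
  · rw [← integrable_norm_rpow_iff (hiid.measurable_T [] k).aestronglyMeasurable hpne
      ENNReal.ofReal_ne_top]
    simpa only [hpE, Real.norm_eq_abs] using hint k
  · simp only [heq]
    exact ENNReal.summable_toReal (hlt.trans ENNReal.one_lt_top).ne
  · simp only [heq]
    rw [← ENNReal.tsum_toReal_eq hne]
    exact (ENNReal.toReal_lt_toReal (hlt.trans ENNReal.one_lt_top).ne ENNReal.one_ne_top).mpr hlt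

lemma integral_powerSum_two_lt_one {T : ℕ → Ω → ℝ} (hT : ∀ k, Measurable (T k))
    (hfin : ∀ᵐ ω ∂μ, ∃ N, ∀ k, N ≤ k → T k ω = 0) (hle : WeightsLeOne μ T) {p : ℝ} (hp : 1 ≤ p)
    (hp2 : p ≤ 2) (hlt : eLpNorm (powerSum T p) 1 μ < 1) : ∫ ω, powerSum T 2 ω ∂μ < 1 := by
  rw [integral_eq_lintegral_of_nonneg_ae (ae_of_all _ fun ω => powerSum_nonneg T 2 ω)
    (measurable_powerSum hT 2).aestronglyMeasurable]
  have h1 : ∫⁻ ω, ENNReal.ofReal (powerSum T 2 ω) ∂μ < 1 := by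
    refine lt_of_le_of_lt ?_ hlt
    rw [eLpNorm_one_eq_lintegral_enorm]
    refine lintegral_mono_ae ?_
    filter_upwards [hfin, hle] with ω ⟨N, hN⟩ hω
    rw [Real.enorm_eq_ofReal (powerSum_nonneg T p ω)]
    refine ENNReal.ofReal_le_ofReal ?_
    rw [powerSum_eq_sum two_pos hN, powerSum_eq_sum (by linarith) hN]
    refine Finset.sum_le_sum fun k _ => ?_
    rcases eq_or_ne (T k ω) 0 with h0 | h0
    · rw [h0, abs_zero, Real.zero_rpow two_ne_zero, Real.zero_rpow (by linarith)]
    · exact Real.rpow_le_rpow_of_exponent_ge (abs_pos.mpr h0) (hω k) hp2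
  exact (ENNReal.toReal_lt_toReal (h1.trans ENNReal.one_lt_top).ne ENNReal.one_ne_top).mpr h1

lemma zero_mem_integrableExpSet (X : Ω → ℝ) : (0 : ℝ) ∈ integrableExpSet X μ := by
  simp [integrableExpSet]

lemma exists_ne_zero_of_ne_singleton {X : Ω → ℝ} (h : integrableExpSet X μ ≠ {0}) :
    ∃ θ ∈ integrableExpSet X μ, θ ≠ 0 := by
  by_contra! hc
  exact h (Subset.antisymm (fun θ hθ => hc θ hθ)
    (singleton_subset_iff.mpr (zero_mem_integrableExpSet X)))

lemma ne_singleton_of_mem {X : Ω → ℝ} {θ : ℝ} (h : θ ∈ integrableExpSet X μ) (h0 : θ ≠ 0) :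
    integrableExpSet X μ ≠ {0} := by
  intro hc
  rw [hc] at h
  exact h0 h

/-- By convexity the domain of X contains a nonzero point within ε of 0. -/
lemma integrableExpSet_ne_singleton {X Y : Ω → ℝ} (h : integrableExpSet X μ ≠ {0}) {ε : ℝ}
    (hε : 0 < ε) (hsub : Ioo (-ε) ε ∩ integrableExpSet X μ ⊆ integrableExpSet Y μ) :
    integrableExpSet Y μ ≠ {0} := by
  obtain ⟨θ, hθ, h0⟩ := exists_ne_zero_of_ne_singleton h
  have hord := (convex_integrableExpSet (X := X) (μ := μ)).ordConnected
  rcases lt_or_gt_of_ne h0 with hneg | hpos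
  · have h1 : max θ (-(ε / 2)) < 0 := max_lt hneg (by linarith)
    refine ne_singleton_of_mem (hsub ⟨⟨?_, by linarith⟩, ?_⟩) h1.ne
    · exact lt_of_lt_of_le (by linarith) (le_max_right _ _)
    · exact hord.out hθ (zero_mem_integrableExpSet X) ⟨le_max_left _ _, h1.le⟩
  · have h1 : 0 < min θ (ε / 2) := lt_min hpos (by linarith)
    refine ne_singleton_of_mem (hsub ⟨⟨by linarith, ?_⟩, ?_⟩) h1.ne'
    · exact lt_of_le_of_lt (min_le_right _ _) (by linarith)
    · exact hord.out (zero_mem_integrableExpSet X) hθ ⟨h1.le, min_le_left _ _⟩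

lemma CaseA2.ne_singleton {C : Ω → ℝ} {T : ℕ → Ω → ℝ} (h : CaseA2 μ C T) :
    integrableExpSet C μ ≠ {0} := by
  obtain ⟨-, -, ε, hε, hsub⟩ := h
  exact ne_singleton_of_mem (hsub (show ε / 2 ∈ Ioo (-ε) ε from ⟨by linarith, by linarith⟩))
    (by linarith)

lemma ExpCondition.neg {C : Ω → ℝ} {T : ℕ → Ω → ℝ} (h : ExpCondition μ C T) :
    ExpCondition μ (fun ω => -C ω) T := ⟨h.1.neg, h.2⟩

lemma not_weightsLeOne {T : ℕ → Ω → ℝ} (h : 0 < μ {ω | 1 < T 0 ω}) : ¬ WeightsLeOne μ T := by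
  intro hle
  refine h.ne' ?_
  have : ∀ᵐ ω ∂μ, ¬ 1 < T 0 ω := by
    filter_upwards [hle] with ω hω using not_lt.mpr ((le_abs_self _).trans (hω 0))
  simpa [ae_iff] using this

lemma CaseA4.caseA3_neg {C : Ω → ℝ} {T : ℕ → Ω → ℝ} (h : CaseA4 μ C T) :
    CaseA3 μ (fun ω => -C ω) T := by
  obtain ⟨h1, h2, w, hw, hC⟩ := h
  refine ⟨h1, h2, -w, by linarith, ?_⟩
  filter_upwards [hC] with ω hω
  linarith

/-- Nonnegative weights in decreasing order are all at most 1 as soon as the first one is. -/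
lemma measure_first_weight_pos {T : ℕ → Ω → ℝ} (hord : OrderedWeights μ T)
    (hb : beta μ T = 0) (hle : ¬ WeightsLeOne μ T) : 0 < μ {ω | 1 < T 0 ω} := by
  refine pos_iff_ne_zero.mpr fun h0 => hle ?_
  have h1 : ∀ᵐ ω ∂μ, ¬ 1 < T 0 ω := by rw [ae_iff]; simpa using h0
  filter_upwards [h1, hord, beta_eq_zero_iff.mp hb] with ω h1 ⟨N, _, h2, h3⟩ h4 k
  rw [abs_of_nonneg (h4 k)]
  rcases lt_or_ge k N with hk | hk
  · exact (h2 0 k (Nat.zero_le k) hk).trans (not_lt.mp h1)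
  · rw [h3 k hk]; exact zero_le_one

end

/-! ### The four cases. -/

namespace IsMinimalSolution

variable {Ω : Type*} [mΩ : MeasurableSpace Ω] {μ : Measure Ω} [IsProbabilityMeasure μ]
  {C : Ω → ℝ} {T : ℕ → Ω → ℝ} {W : Ω → ℝ}

/-- The Gaussian supersolution with S = [0, ∞) and g = C⁺, so that a one-sided exponential moment of
C is enough. -/
lemma exists_pos_expMoment_lt_top (h : IsMinimalSolution μ C T W) (hle : WeightsLeOne μ T)
    (hb : beta μ T = 0) (hexp : ExpCondition μ C T) (hV : ∫ ω, powerSum T 2 ω ∂μ < 1)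
    {θ₀ : ℝ} (hθ₀ : 0 < θ₀) (hθ₀' : θ₀ ∈ integrableExpSet C μ) :
    ∃ ε > 0, ∀ θ, 0 ≤ θ → θ ≤ ε → θ ∈ integrableExpSet W μ := by
  have hCm := h.measurable_C
  have hgi : Integrable (fun ω => Real.exp (θ₀ * max (C ω) 0)) μ := by
    refine ((integrable_const (1 : ℝ)).add (show Integrable (fun ω => Real.exp (θ₀ * C ω)) μ
      from hθ₀')).mono' (by fun_prop) (ae_of_all _ fun ω => ?_)
    rw [Real.norm_eq_abs, abs_of_pos (Real.exp_pos _)]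
    rcases le_total 0 (C ω) with hc | hc
    · simp [max_eq_left hc]
    · simp [max_eq_right hc, (Real.exp_pos _).le]
  have hgC : ∀ ω, max (C ω) 0 = 0 ∨ max (C ω) 0 = |C ω| := fun ω => by
    rcases le_total 0 (C ω) with hc | hc
    · exact Or.inr (by rw [max_eq_left hc, abs_of_nonneg hc])
    · exact Or.inl (max_eq_right hc)
  obtain ⟨ε, hε, hεW⟩ := h.exists_expMoment_lt_top (S := Ici 0) (g := fun ω => max (C ω) 0)
    (by fun_prop) (fun ω => le_max_right _ _) hgC self_mem_Ici
    (fun θ hθ ω => by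
      rw [abs_of_nonneg hθ]
      exact mul_le_mul_of_nonneg_left (le_max_left _ _) hθ)
    (by
      filter_upwards [beta_eq_zero_iff.mp hb] with ω hω k θ hθ using mul_nonneg hθ (hω k))
    hle hθ₀ hgi hexp hV
  refine ⟨ε, hε, fun θ h0 h1 => h.mem_iff.mpr (hεW θ h0 ?_)⟩
  rwa [abs_of_nonneg h0]

lemma nonneg_weights_subset (h : IsMinimalSolution μ C T W) (hle : WeightsLeOne μ T)
    (hb : beta μ T = 0) (hexp : ExpCondition μ C T) (hV : ∫ ω, powerSum T 2 ω ∂μ < 1) :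
    ∃ ε > 0, Ioo (-ε) ε ∩ integrableExpSet C μ ⊆ integrableExpSet W μ := by
  have hpos : ∃ ε > 0, ∀ θ, 0 ≤ θ → θ < ε → θ ∈ integrableExpSet C μ →
      θ ∈ integrableExpSet W μ := by
    by_cases hex : ∃ θ₀ > 0, θ₀ ∈ integrableExpSet C μ
    · obtain ⟨θ₀, h0, h1⟩ := hex
      obtain ⟨ε, hε, hεW⟩ := h.exists_pos_expMoment_lt_top hle hb hexp hV h0 h1
      exact ⟨ε, hε, fun θ h2 h3 _ => hεW θ h2 h3.le⟩
    · push Not at hex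
      refine ⟨1, one_pos, fun θ h2 _ h4 => ?_⟩
      rcases eq_or_lt_of_le h2 with rfl | h5
      · exact zero_mem_integrableExpSet W
      · exact absurd h4 (hex θ h5)
  have hneg : ∃ ε > 0, ∀ θ, 0 ≤ θ → θ < ε → -θ ∈ integrableExpSet C μ →
      -θ ∈ integrableExpSet W μ := by
    by_cases hex : ∃ θ₀ > 0, -θ₀ ∈ integrableExpSet C μ
    · obtain ⟨θ₀, h0, h1⟩ := hex
      obtain ⟨ε, hε, hεW⟩ := h.neg.exists_pos_expMoment_lt_top hle hb (ExpCondition.neg hexp) hV h0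
        (mem_integrableExpSet_neg.mpr h1)
      exact ⟨ε, hε, fun θ h2 h3 _ => mem_integrableExpSet_neg.mp (hεW θ h2 h3.le)⟩
    · push Not at hex
      refine ⟨1, one_pos, fun θ h2 _ h4 => ?_⟩
      rcases eq_or_lt_of_le h2 with rfl | h5
      · rw [neg_zero]; exact zero_mem_integrableExpSet W
      · exact absurd h4 (hex θ h5)
  obtain ⟨ε₁, hε₁, h1⟩ := hpos
  obtain ⟨ε₂, hε₂, h2⟩ := hneg
  refine ⟨min ε₁ ε₂, lt_min hε₁ hε₂, fun θ ⟨⟨h3, h4⟩, h5⟩ => ?_⟩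
  rcases le_total 0 θ with h0 | h0
  · exact h1 θ h0 (h4.trans_le (min_le_left _ _)) h5
  · have h6 : -θ < ε₂ := (by linarith : -θ < min ε₁ ε₂).trans_le (min_le_right _ _)
    have := h2 (-θ) (by linarith) h6 (by rwa [neg_neg])
    rwa [neg_neg] at this

/-- The Gaussian supersolution with S = ℝ and g = |C|: signed weights require control on both sides
of 0. -/
lemma signed_weights_subset (h : IsMinimalSolution μ C T W) (hcase : CaseA2 μ C T)
    (hexp : ExpCondition μ C T) (hV : ∫ ω, powerSum T 2 ω ∂μ < 1) :
    ∃ ε > 0, Ioo (-ε) ε ⊆ integrableExpSet W μ := by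
  obtain ⟨hle, -, ε₀, hε₀, hsub⟩ := hcase
  have hCm := h.measurable_C
  have h1 : ε₀ / 2 ∈ integrableExpSet C μ := hsub ⟨by linarith, by linarith⟩
  have h2 : -(ε₀ / 2) ∈ integrableExpSet C μ := hsub ⟨by linarith, by linarith⟩
  obtain ⟨ε, hε, hεW⟩ := h.exists_expMoment_lt_top (S := univ) (g := fun ω => |C ω|)
    (by fun_prop) (fun ω => abs_nonneg _) (fun ω => Or.inr rfl) (mem_univ _)
    (fun θ _ ω => by rw [← abs_mul]; exact le_abs_self _)
    (ae_of_all _ fun ω k θ _ => mem_univ _) hle (θ₀ := ε₀ / 2) (by positivity)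
    (integrable_exp_mul_abs h1 h2) hexp hV
  exact ⟨ε, hε, fun θ hθ => h.mem_iff.mpr (hεW θ (mem_univ _) (abs_le.mpr ⟨hθ.1.le, hθ.2.le⟩))⟩

/-- If C has an exponential moment at some negative θ, the missing condition follows from finiteness
of Ψ on the positive side. Otherwise only θ ≥ 0 matters, and convexity settles it. -/
lemma nonneg_weights_subset_of_pos (h : IsMinimalSolution μ C T W) (hle : WeightsLeOne μ T)
    (hb : beta μ T = 0) (hV : ∫ ω, powerSum T 2 ω ∂μ < 1) {θ : ℝ} (hθ0 : 0 < θ)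
    (hθ : θ ∈ integrableExpSet W μ) :
    ∃ ε > 0, Ioo (-ε) ε ∩ integrableExpSet C μ ⊆ integrableExpSet W μ := by
  by_cases hex : ∃ θ₁ < 0, θ₁ ∈ integrableExpSet C μ
  · obtain ⟨θ₁, h0, h1⟩ := hex
    exact h.nonneg_weights_subset hle hb
      (h.expCondition_of_expMoment hle hb hθ0 (h.mem_iff.mp hθ) h0 h1) hV
  · push Not at hex
    refine ⟨θ, hθ0, fun t ⟨⟨_, h2⟩, h3⟩ => ?_⟩
    have h4 : 0 ≤ t := by
      by_contra! hc
      exact hex t hc h3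
    exact convex_integrableExpSet.ordConnected.out (zero_mem_integrableExpSet W) hθ ⟨h4, h2.le⟩

lemma subset_of_caseA1 (h : IsMinimalSolution μ C T W) (hcase : CaseA1 μ C T)
    (hV : ∫ ω, powerSum T 2 ω ∂μ < 1) (hne : integrableExpSet W μ ≠ {0}) :
    ∃ ε > 0, Ioo (-ε) ε ∩ integrableExpSet C μ ⊆ integrableExpSet W μ := by
  obtain ⟨hle, hb, -⟩ := hcase
  obtain ⟨θ, hθ, hθ0⟩ := exists_ne_zero_of_ne_singleton hne
  rcases lt_or_gt_of_ne hθ0 with h0 | h0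
  · obtain ⟨ε, hε, hsub⟩ := h.neg.nonneg_weights_subset_of_pos hle hb hV (θ := -θ) (by linarith)
      (mem_integrableExpSet_neg.mpr (by rwa [neg_neg]))
    refine ⟨ε, hε, fun t ⟨⟨h1, h2⟩, h3⟩ => ?_⟩
    have := hsub (a := -t) ⟨⟨by linarith, by linarith⟩,
      mem_integrableExpSet_neg.mpr (by rwa [neg_neg])⟩
    simpa using mem_integrableExpSet_neg.mp this
  · exact h.nonneg_weights_subset_of_pos hle hb hV h0 hθ

lemma exists_Ioo_subset_of_beta_pos (h : IsMinimalSolution μ C T W) (hb : 0 < beta μ T)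
    (hne : integrableExpSet W μ ≠ {0}) : ∃ ε > 0, Ioo (-ε) ε ⊆ integrableExpSet W μ := by
  obtain ⟨θ, hθ, hθ0⟩ := exists_ne_zero_of_ne_singleton hne
  obtain ⟨k, hk⟩ := exists_weight_neg hb
  obtain ⟨t, ht, ht'⟩ := h.exists_opposite_sign hθ0 (h.mem_iff.mp hθ) hk
  have ht' := h.mem_iff.mpr ht'
  have hord := (convex_integrableExpSet (X := W) (μ := μ)).ordConnected
  rcases lt_or_gt_of_ne hθ0 with h0 | h0
  · have h1 : 0 < t := by nlinarith
    refine ⟨min (-θ) t, lt_min (by linarith) h1, fun x hx => hord.out hθ ht' ⟨?_, ?_⟩⟩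
    · linarith [hx.1, min_le_left (-θ) t]
    · linarith [hx.2, min_le_right (-θ) t]
  · have h1 : t < 0 := by nlinarith
    refine ⟨min θ (-t), lt_min h0 (by linarith), fun x hx => hord.out ht' hθ ⟨?_, ?_⟩⟩
    · linarith [hx.1, min_le_right θ (-t)]
    · linarith [hx.2, min_le_left θ (-t)]

lemma caseA3_of_pos (h : IsMinimalSolution μ C T W) (hord : OrderedWeights μ T)
    (hle : ¬ WeightsLeOne μ T) {θ : ℝ} (hθ0 : 0 < θ) (hθ : θ ∈ integrableExpSet W μ) :
    CaseA3 μ C T := by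
  have hθ := h.mem_iff.mp hθ
  have hb := h.beta_eq_zero_of_not_weightsLeOne hle hθ0.ne' hθ
  obtain ⟨B, hB⟩ := h.bddAbove_of_not_weightsLeOne hle hθ0 hθ
  obtain ⟨s, hs0, -, -, hs⟩ := h.exists_tight_invariant_bound hb hB
  exact ⟨measure_first_weight_pos hord hb hle, hb, s, hs0.le, hs⟩

lemma exists_case (h : IsMinimalSolution μ C T W) (hord : OrderedWeights μ T)
    (hne : integrableExpSet W μ ≠ {0}) :
    CaseA1 μ C T ∨ CaseA2 μ C T ∨ CaseA3 μ C T ∨ CaseA4 μ C T := by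
  obtain ⟨θ, hθ, hθ0⟩ := exists_ne_zero_of_ne_singleton hne
  by_cases hle : WeightsLeOne μ T
  · rcases eq_or_ne (beta μ T) 0 with hb | hb
    · exact Or.inl ⟨hle, hb, ne_singleton_of_mem (h.integrableExpSet_subset hθ) hθ0⟩
    · obtain ⟨ε, hε, hsub⟩ := h.exists_Ioo_subset_of_beta_pos (pos_iff_ne_zero.mpr hb) hne
      exact Or.inr (Or.inl ⟨hle, pos_iff_ne_zero.mpr hb, ε, hε,
        hsub.trans h.integrableExpSet_subset⟩)
  · rcases lt_or_gt_of_ne hθ0 with h0 | h0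
    · obtain ⟨h1, h2, w, hw, hC⟩ := h.neg.caseA3_of_pos hord hle (θ := -θ) (by linarith)
        (mem_integrableExpSet_neg.mpr (by rwa [neg_neg]))
      refine Or.inr (Or.inr (Or.inr ⟨h1, h2, -w, by linarith, ?_⟩))
      filter_upwards [hC] with ω hω
      linarith
    · exact Or.inr (Or.inr (Or.inl (h.caseA3_of_pos hord hle h0 hθ)))

/-- Subtracting the two inequalities where Σ_1 > 1 gives w ≤ w', hence w = w' = 0. Then W ≤ 0,
impossible for a centred nonzero W. -/
lemma not_caseA3_and_caseA4 (h : IsMinimalSolution μ C T W) (h3 : CaseA3 μ C T)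
    (h4 : CaseA4 μ C T) : False := by
  obtain ⟨hpos, hb, w, hw, hC⟩ := h3
  obtain ⟨-, -, w', hw', hC'⟩ := h4
  have hae := (hC.and hC').and ((beta_eq_zero_iff.mp hb).and h.finite)
  obtain ⟨ω, hω1, ⟨h1, h2⟩, h0, N, hN⟩ := ((frequently_ae_iff.mpr hpos.ne').and_eventually hae).exists
  have hN0 : 0 < N := by
    by_contra hc
    have := hN 0 (by omega)
    linarith
  have hsum : 1 < powerSum T 1 ω := by
    rw [powerSum_one_eq hN h0]
    exact hω1.trans_le (Finset.single_le_sum (f := fun k => T k ω) (fun k _ => h0 k)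
      (Finset.mem_range.mpr hN0))
  have hw0 : w = 0 := by nlinarith
  have hW := h.ae_le_of_invariant hb hw hC
  rw [hw0] at hW
  exact lt_irrefl _ (h.pos_of_ae_le hW)

lemma Ici_subset_of_caseA3 (h : IsMinimalSolution μ C T W) (hcase : CaseA3 μ C T) :
    Ici 0 ⊆ integrableExpSet W μ := by
  obtain ⟨-, hb, w, hw, hC⟩ := hcase
  exact fun θ hθ => h.mem_iff.mpr ((expMoment_le_exp (h.ae_le_of_invariant hb hw hC) hθ).trans_lt
    ENNReal.ofReal_lt_top)

lemma caseA3_conclusion (h : IsMinimalSolution μ C T W) (hcase : CaseA3 μ C T) :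
    eLpNorm (fun ω => max (C ω) 0) ∞ μ ≤ eLpNorm (fun ω => max (W ω) 0) ∞ μ ∧
      eLpNorm (fun ω => max (W ω) 0) ∞ μ < ∞ ∧ integrableExpSet W μ = Ici 0 := by
  have hsub := h.Ici_subset_of_caseA3 hcase
  obtain ⟨hpos, hb, w, hw, hC⟩ := hcase
  have hle := not_weightsLeOne hpos
  have hW := h.ae_le_of_invariant hb hw hC
  obtain ⟨s, hs0, hs, hs', hsC⟩ := h.exists_tight_invariant_bound hb hW
  refine ⟨?_, ?_, Subset.antisymm (fun θ hθ => ?_) hsub⟩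
  -- The invariance of the essential supremum s gives C ≤ s - sΣ_1 ≤ s. Tightness of s shows that s
  -- does not exceed the norm of W⁺.
  · have h1 : eLpNorm (fun ω => max (C ω) 0) ∞ μ ≤ ENNReal.ofReal s := by
      rw [eLpNorm_exponent_top]
      refine eLpNormEssSup_le_of_ae_bound ?_
      filter_upwards [hsC] with ω hω
      rw [Real.norm_eq_abs, abs_of_nonneg (le_max_right _ _)]
      have := mul_nonneg hs0.le (powerSum_nonneg T 1 ω)
      exact max_le (by linarith) hs0.le
    refine h1.trans ?_
    by_contra! hlt
    set M := eLpNorm (fun ω => max (W ω) 0) ∞ μ with hM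
    have hMs : M.toReal < s := by
      rw [← ENNReal.toReal_ofReal hs0.le]
      exact (ENNReal.toReal_lt_toReal hlt.ne_top ENNReal.ofReal_ne_top).mpr hlt
    have h2 : ∀ᵐ ω ∂μ, ‖max (W ω) 0‖ₑ ≤ M := by
      rw [hM, eLpNorm_exponent_top]
      exact enorm_ae_le_eLpNormEssSup _ _
    refine hs' ((M.toReal + s) / 2) (by linarith) ?_
    have h3 : ∀ᵐ ω ∂μ, ¬ ((M.toReal + s) / 2 ≤ W ω) := by
      filter_upwards [h2] with ω hω
      rw [Real.enorm_eq_ofReal (le_max_right _ _),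
        ENNReal.ofReal_le_iff_le_toReal hlt.ne_top] at hω
      have := (le_max_left (W ω) 0).trans hω
      linarith
    simpa [ae_iff] using h3
  · rw [eLpNorm_exponent_top]
    refine (eLpNormEssSup_le_of_ae_bound (C := s) ?_).trans_lt ENNReal.ofReal_lt_top
    filter_upwards [hs] with ω hω
    rw [Real.norm_eq_abs, abs_of_nonneg (le_max_right _ _)]
    exact max_le hω hs0.le
  -- A negative θ in the domain would make Ψ finite on both sides of 0, forcing weights of modulus
  -- at most 1.
  · by_contra hc
    have h1 : (1 : ℝ) ∈ integrableExpSet W μ := hsub (mem_Ici.mpr zero_le_one)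
    exact hle (h.weightsLeOne_of_expMoment one_pos (h.mem_iff.mp h1) (not_le.mp hc)
      (h.mem_iff.mp hθ))

lemma caseA4_conclusion (h : IsMinimalSolution μ C T W) (hcase : CaseA4 μ C T) :
    eLpNorm (fun ω => max (-C ω) 0) ∞ μ ≤ eLpNorm (fun ω => max (-W ω) 0) ∞ μ ∧
      eLpNorm (fun ω => max (-W ω) 0) ∞ μ < ∞ ∧ integrableExpSet W μ = Iic 0 := by
  obtain ⟨h1, h2, h3⟩ := h.neg.caseA3_conclusion (CaseA4.caseA3_neg hcase)
  refine ⟨h1, h2, ?_⟩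
  ext θ
  have := Set.ext_iff.mp h3 (-θ)
  rw [mem_integrableExpSet_neg, neg_neg] at this
  rw [this]
  simp

lemma existsUnique_case (h : IsMinimalSolution μ C T W) (hord : OrderedWeights μ T)
    (hne : integrableExpSet W μ ≠ {0}) :
    ∃! i : Fin 4, (![CaseA1 μ C T, CaseA2 μ C T, CaseA3 μ C T, CaseA4 μ C T] : Fin 4 → Prop) i := by
  have h12 : CaseA1 μ C T → ¬ CaseA2 μ C T := fun h1 h2 => h2.2.1.ne' h1.2.1
  have h13 : CaseA1 μ C T → ¬ CaseA3 μ C T := fun h1 h2 => not_weightsLeOne h2.1 h1.1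
  have h14 : CaseA1 μ C T → ¬ CaseA4 μ C T := fun h1 h2 => not_weightsLeOne h2.1 h1.1
  have h23 : CaseA2 μ C T → ¬ CaseA3 μ C T := fun h1 h2 => not_weightsLeOne h2.1 h1.1
  have h24 : CaseA2 μ C T → ¬ CaseA4 μ C T := fun h1 h2 => not_weightsLeOne h2.1 h1.1
  have h34 : CaseA3 μ C T → ¬ CaseA4 μ C T := h.not_caseA3_and_caseA4
  rcases h.exists_case hord hne with hc | hc | hc | hc
  · exact ⟨0, hc, fun j hj => by fin_cases j <;> simp_all⟩
  · exact ⟨1, hc, fun j hj => by fin_cases j <;> simp_all⟩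
  · exact ⟨2, hc, fun j hj => by fin_cases j <;> simp_all⟩
  · exact ⟨3, hc, fun j hj => by fin_cases j <;> simp_all⟩

end IsMinimalSolution

end Smoothing

/-! ### The theorem. -/

theorem theorem3p2 {Ω : Type*} [MeasurableSpace Ω] (μ : Measure Ω) [IsProbabilityMeasure μ]
    (C : List ℕ → Ω → ℝ) (T : List ℕ → ℕ → Ω → ℝ)
    (hiid : Smoothing.IsIIDTree μ C T)
    (hord : Smoothing.OrderedWeights μ (T []))
    (hC : 0 < μ {ω | C [] ω ≠ 0})
    (p : ℝ) (hp : p ∈ Icc (1 : ℝ) 2)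
    (hmom : Smoothing.MomentCondition μ (C []) (T []) p) :
    -- the canonical solution is well defined
    (∀ᵐ ω ∂μ, Tendsto (fun n => Smoothing.partialW C T n ω) atTop
      (𝓝 (Smoothing.canonicalW C T ω))) ∧
    -- part (a)
    (integrableExpSet (Smoothing.canonicalW C T) μ ≠ {0} →
      (∃! i : Fin 4, (![Smoothing.CaseA1 μ (C []) (T []), Smoothing.CaseA2 μ (C []) (T []),
        Smoothing.CaseA3 μ (C []) (T []), Smoothing.CaseA4 μ (C []) (T [])] : Fin 4 → Prop) i) ∧
      (Smoothing.CaseA1 μ (C []) (T []) ∨ Smoothing.CaseA2 μ (C []) (T []) →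
        ∃ ε > 0, Ioo (-ε) ε ∩ integrableExpSet (C []) μ ⊆
          integrableExpSet (Smoothing.canonicalW C T) μ) ∧
      (Smoothing.CaseA2 μ (C []) (T []) →
        ∃ ε > 0, Ioo (-ε) ε ⊆ integrableExpSet (Smoothing.canonicalW C T) μ) ∧
      (Smoothing.CaseA3 μ (C []) (T []) →
        eLpNorm (fun ω => max (C [] ω) 0) ∞ μ
          ≤ eLpNorm (fun ω => max (Smoothing.canonicalW C T ω) 0) ∞ μ ∧
        eLpNorm (fun ω => max (Smoothing.canonicalW C T ω) 0) ∞ μ < ∞ ∧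
        integrableExpSet (Smoothing.canonicalW C T) μ = Ici 0) ∧
      (Smoothing.CaseA4 μ (C []) (T []) →
        eLpNorm (fun ω => max (-C [] ω) 0) ∞ μ
          ≤ eLpNorm (fun ω => max (-Smoothing.canonicalW C T ω) 0) ∞ μ ∧
        eLpNorm (fun ω => max (-Smoothing.canonicalW C T ω) 0) ∞ μ < ∞ ∧
        integrableExpSet (Smoothing.canonicalW C T) μ = Iic 0)) ∧
    -- part (b)
    (Smoothing.CaseA3 μ (C []) (T []) ∨ Smoothing.CaseA4 μ (C []) (T []) →
      integrableExpSet (Smoothing.canonicalW C T) μ ≠ {0}) ∧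
    (Smoothing.ExpCondition μ (C []) (T []) →
      Smoothing.CaseA1 μ (C []) (T []) ∨ Smoothing.CaseA2 μ (C []) (T []) →
        integrableExpSet (Smoothing.canonicalW C T) μ ≠ {0} ∧
        ∃ ε > 0, Ioo (-ε) ε ∩ integrableExpSet (C []) μ ⊆
          integrableExpSet (Smoothing.canonicalW C T) μ) := by
  have hT : Smoothing.IsContractiveTree μ C T p :=
    Smoothing.isContractiveTree_of_momentCondition hiid hord hp.1 hmom
  have h := Smoothing.isMinimalSolution_canonicalW hp.1 hp.2 hT hC
  have hV : Smoothing.WeightsLeOne μ (T []) → ∫ ω, Smoothing.powerSum (T []) 2 ω ∂μ < 1 :=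
    fun hle => Smoothing.integral_powerSum_two_lt_one h.measurable_T h.finite hle hp.1 hp.2 hmom.2.2
  refine ⟨Smoothing.ae_tendsto_canonicalW hp.1 hp.2 hT, fun hne =>
    ⟨h.existsUnique_case hord hne, ?_, fun hcase => h.exists_Ioo_subset_of_beta_pos hcase.2.1 hne,
      h.caseA3_conclusion, h.caseA4_conclusion⟩, ?_, ?_⟩
  · rintro (hcase | hcase)
    · exact h.subset_of_caseA1 hcase (hV hcase.1) hne
    · obtain ⟨ε, hε, hsub⟩ := h.exists_Ioo_subset_of_beta_pos hcase.2.1 hne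
      exact ⟨ε, hε, inter_subset_left.trans hsub⟩
  · rintro (hcase | hcase)
    · exact Smoothing.ne_singleton_of_mem (h.Ici_subset_of_caseA3 hcase
        (mem_Ici.mpr zero_le_one)) one_ne_zero
    · refine Smoothing.ne_singleton_of_mem (θ := -1) ?_ (by norm_num)
      rw [(h.caseA4_conclusion hcase).2.2]
      simp
  · rintro hexp (hcase | hcase)
    · obtain ⟨ε, hε, hsub⟩ := h.nonneg_weights_subset hcase.1 hcase.2.1 hexp (hV hcase.1)
      exact ⟨Smoothing.integrableExpSet_ne_singleton hcase.2.2 hε hsub, ε, hε, hsub⟩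
    · obtain ⟨ε, hε, hsub⟩ := h.signed_weights_subset hcase hexp (hV hcase.1)
      have hsub' := inter_subset_left (t := integrableExpSet (C []) μ).trans hsub
      exact ⟨Smoothing.integrableExpSet_ne_singleton (Smoothing.CaseA2.ne_singleton hcase) hε hsub',
        ε, hε, hsub'⟩
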